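/- A \emph{LinearFIXP circuit} $C$ with $d$ inputs and $d$ outputs is an arithmetic circuit whose gates are rational constants, binary $+$, $-$, $\max$, $\min$, and multiplication by a rational constant. Its size $\mathrm{size}(C)$ is the number of inputs plus the number of gates plus the number of bits needed to write the constants used. \textbf{Theorem.} There are a polynomial $P$, a constant $K$ and a single deterministic algorithm such that the following holds for every $d\ge 1$, every $p\in[1,\infty]$, and every LinearFIXP circuit $C$ with $d$ inputs and $d$ outputs that computes a map $f:[0,1]^d\to[0,1]^d$ which is a contraction in the $\ell_p$ norm, i.e. for some $c\in(0,1)$, $\|f(x)-f(y)\|_p\le c\,\|x-y\|_p$ for all $x,y\in[0,1]^d$. Put $L=P(\mathrm{size}(C))$. Then $f$ has a unique fixpoint $x^*\in[0,1]^d$, its coordinates are rational numbers of bit-length at most $L$ (numerator plus denominator, in lowest terms), and on input $C$ the algorithm halts and outputs $x^*$ exactly, each coordinate as a fraction of two integers, within time $K\cdot L^{d}$. (In particular the time is polynomial in $\mathrm{size}(C)$ for fixed $d$, and exponential in $d$.) Time is bit cost: it is measured on a random access machine over the integers with the logarithmic cost criterion. The algorithm is given neither $p$ nor $c$. -/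

import Mathlib

open scoped ENNReal

/-- Bit length of a rational number: bits of the numerator plus bits of the denominator
(in lowest terms). -/
def ratBits (q : ℚ) : ℕ := Nat.size q.num.natAbs + Nat.size q.den

/-! ### LinearFIXP circuits -/

/-- The gates of a LinearFIXP circuit.  The natural numbers `a`, `b` are the indices of the wires
that feed the gate; `const` is a rational constant, `scale` is multiplication by a rational
constant. -/
inductive LinGate where
  | const (q : ℚ)
  | add (a b : ℕ)
  | sub (a b : ℕ)
  | max (a b : ℕ)
  | min (a b : ℕ)
  | scale (ζ : ℚ) (a : ℕ)

namespace LinGate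

/-- The wires that feed a gate. -/
def args : LinGate → List ℕ
  | const _ => []
  | add a b => [a, b]
  | sub a b => [a, b]
  | max a b => [a, b]
  | min a b => [a, b]
  | scale _ a => [a]

/-- Number of bits of the constant used by a gate. -/
def constBits : LinGate → ℕ
  | const q => ratBits q
  | scale ζ _ => ratBits ζ
  | _ => 0

/-- Value of a gate, given the list of the values of all earlier wires. -/
def eval {α : Type*} [Field α] [LinearOrder α] (w : List α) : LinGate → α
  | const q => (q : α)
  | add a b => w.getD a 0 + w.getD b 0
  | sub a b => w.getD a 0 - w.getD b 0
  | max a b => Max.max (w.getD a 0) (w.getD b 0)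
  | min a b => Min.min (w.getD a 0) (w.getD b 0)
  | scale ζ a => (ζ : α) * w.getD a 0

/-- A gate written as four integers: opcode and operands. -/
def code : LinGate → List ℤ
  | const q => [0, q.num, (q.den : ℤ), 0]
  | add a b => [1, (a : ℤ), (b : ℤ), 0]
  | sub a b => [2, (a : ℤ), (b : ℤ), 0]
  | max a b => [3, (a : ℤ), (b : ℤ), 0]
  | min a b => [4, (a : ℤ), (b : ℤ), 0]
  | scale ζ a => [5, (a : ℤ), ζ.num, (ζ.den : ℤ)]

end LinGate

/-- A LinearFIXP circuit with `d` inputs and `d` outputs.  Wires `0, …, d - 1` are the inputs and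
wire `d + k` is the value of the `k`-th gate, which may use only earlier wires. -/
structure LinearFIXPCircuit (d : ℕ) where
  gates : List LinGate
  out : Fin d → ℕ
  args_lt : ∀ (k : ℕ) (hk : k < gates.length), ∀ a ∈ (gates[k]).args, a < d + k
  out_lt : ∀ i, out i < d + gates.length

namespace LinearFIXPCircuit

variable {d : ℕ}

/-- The values of all wires on input `x`. -/
def wires {α : Type*} [Field α] [LinearOrder α] (C : LinearFIXPCircuit d) (x : Fin d → α) :
    List α :=
  C.gates.foldl (fun w g => w ++ [g.eval w]) (List.ofFn x)

/-- The function computed by the circuit. -/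
def eval {α : Type*} [Field α] [LinearOrder α] (C : LinearFIXPCircuit d) (x : Fin d → α) :
    Fin d → α :=
  fun i => (C.wires x).getD (C.out i) 0

/-- Number of inputs, plus number of gates, plus number of bits of the constants. -/
def size (C : LinearFIXPCircuit d) : ℕ :=
  d + C.gates.length + (C.gates.map LinGate.constBits).sum

/-- The circuit maps the cube `[0,1]^d` to itself and is a contraction there with respect to the
`ℓ_p` norm. -/
def IsContraction (C : LinearFIXPCircuit d) (p : ℝ≥0∞) [Fact (1 ≤ p)] : Prop :=
  Set.MapsTo (C.eval (α := ℝ)) (Set.Icc 0 1) (Set.Icc 0 1) ∧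
  ∃ c : ℝ, 0 < c ∧ c < 1 ∧
    ∀ x ∈ Set.Icc (0 : Fin d → ℝ) 1, ∀ y ∈ Set.Icc (0 : Fin d → ℝ) 1,
      ‖WithLp.toLp p (C.eval x - C.eval y)‖ ≤ c * ‖WithLp.toLp p (x - y)‖

/-- The circuit as a list of integers: dimension, number of gates, four integers for each gate,
and the indices of the output wires. -/
def code (C : LinearFIXPCircuit d) : List ℤ :=
  [(d : ℤ), (C.gates.length : ℤ)] ++ C.gates.flatMap LinGate.code ++
    List.ofFn (fun i => (C.out i : ℤ))

end LinearFIXPCircuit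

/-! ### Random access machines with the logarithmic cost criterion

The machine is the usual integer random access machine, with structured control (sequence,
conditional, loop) and with memory divided into banks.  A bank is named by a constant of the
program, so that each program uses finitely many; a cell inside a bank is addressed by the value
of an expression.  Every access and every operation is charged the bit lengths of the integers
(addresses and values) that it handles. -/

namespace RAM

/-- Bit length of an integer, with one bit for the sign. -/
def len (n : ℤ) : ℕ := Nat.size n.natAbs + 1

/-- `μ b i` is the content of cell `i` of bank `b`. -/
abbrev Mem := ℕ → ℕ → ℤ

/-- Arithmetic expressions.  `read b e` reads the cell of bank `b` with address `e` (a negative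
address is read as `0`); `div` is integer division with `x / 0 = 0`. -/
inductive Expr where
  | const (n : ℤ)
  | read (b : ℕ) (e : Expr)
  | add (e₁ e₂ : Expr)
  | sub (e₁ e₂ : Expr)
  | mul (e₁ e₂ : Expr)
  | div (e₁ e₂ : Expr)

namespace Expr

def val (μ : Mem) : Expr → ℤ
  | const n => n
  | read b e => μ b (e.val μ).toNat
  | add e₁ e₂ => e₁.val μ + e₂.val μ
  | sub e₁ e₂ => e₁.val μ - e₂.val μ
  | mul e₁ e₂ => e₁.val μ * e₂.val μ
  | div e₁ e₂ => e₁.val μ / e₂.val μ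

/-- Logarithmic cost of evaluating an expression. -/
def cost (μ : Mem) : Expr → ℕ
  | const n => len n
  | read b e => e.cost μ + len (e.val μ) + len (μ b (e.val μ).toNat)
  | add e₁ e₂ => e₁.cost μ + e₂.cost μ + len (e₁.val μ) + len (e₂.val μ)
  | sub e₁ e₂ => e₁.cost μ + e₂.cost μ + len (e₁.val μ) + len (e₂.val μ)
  | mul e₁ e₂ => e₁.cost μ + e₂.cost μ + len (e₁.val μ) + len (e₂.val μ)
  | div e₁ e₂ => e₁.cost μ + e₂.cost μ + len (e₁.val μ) + len (e₂.val μ)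

end Expr

/-- Programs.  `write b e₁ e₂` stores the value of `e₂` in the cell of bank `b` with address `e₁`.
Tests are for positivity. -/
inductive Prog where
  | skip
  | write (b : ℕ) (e₁ e₂ : Expr)
  | seq (c₁ c₂ : Prog)
  | ite (e : Expr) (c₁ c₂ : Prog)
  | loop (e : Expr) (c : Prog)

/-- Update of one cell. -/
def Mem.set (μ : Mem) (b i : ℕ) (v : ℤ) : Mem :=
  fun b' i' => if b' = b ∧ i' = i then v else μ b' i'

/-- `Exec c μ ν t`: started in memory `μ`, the program `c` halts in memory `ν` after time `t`. -/
inductive Exec : Prog → Mem → Mem → ℕ → Prop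
  | skip (μ : Mem) : Exec Prog.skip μ μ 1
  | write (b : ℕ) (e₁ e₂ : Expr) (μ : Mem) :
      Exec (Prog.write b e₁ e₂) μ (μ.set b (e₁.val μ).toNat (e₂.val μ))
        (e₁.cost μ + e₂.cost μ + len (e₁.val μ) + len (e₂.val μ))
  | seq {c₁ c₂ : Prog} {μ₁ μ₂ μ₃ : Mem} {t₁ t₂ : ℕ} :
      Exec c₁ μ₁ μ₂ t₁ → Exec c₂ μ₂ μ₃ t₂ → Exec (Prog.seq c₁ c₂) μ₁ μ₃ (t₁ + t₂)
  | ite_pos {e : Expr} {c₁ c₂ : Prog} {μ ν : Mem} {t : ℕ} :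
      0 < e.val μ → Exec c₁ μ ν t →
      Exec (Prog.ite e c₁ c₂) μ ν (e.cost μ + len (e.val μ) + t)
  | ite_neg {e : Expr} {c₁ c₂ : Prog} {μ ν : Mem} {t : ℕ} :
      e.val μ ≤ 0 → Exec c₂ μ ν t →
      Exec (Prog.ite e c₁ c₂) μ ν (e.cost μ + len (e.val μ) + t)
  | loop_done {e : Expr} {c : Prog} {μ : Mem} :
      e.val μ ≤ 0 → Exec (Prog.loop e c) μ μ (e.cost μ + len (e.val μ))
  | loop_step {e : Expr} {c : Prog} {μ₁ μ₂ μ₃ : Mem} {t₁ t₂ : ℕ} :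
      0 < e.val μ₁ → Exec c μ₁ μ₂ t₁ → Exec (Prog.loop e c) μ₂ μ₃ t₂ →
      Exec (Prog.loop e c) μ₁ μ₃ (e.cost μ₁ + len (e.val μ₁) + t₁ + t₂)

/-- Initial memory: the input is in bank `0`, all other cells are `0`. -/
def input (l : List ℤ) : Mem := fun b i => if b = 0 then l.getD i 0 else 0

/-- The memory holds the vector `x` in bank `1`: cells `2 i` and `2 i + 1` contain a numerator and
a positive denominator of `x i`. -/
def Outputs {d : ℕ} (μ : Mem) (x : Fin d → ℚ) : Prop :=
  ∀ i : Fin d, 0 < μ 1 (2 * i + 1) ∧ x i = (μ 1 (2 * i) : ℚ) / (μ 1 (2 * i + 1) : ℚ)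

/-- On the input `l`, the program `c` halts within time `T` and outputs the vector `x`. -/
def ComputesWithin {d : ℕ} (c : Prog) (l : List ℤ) (x : Fin d → ℚ) (T : ℕ) : Prop :=
  ∃ (ν : Mem) (t : ℕ), Exec c (input l) ν t ∧ t ≤ T ∧ Outputs ν x

end RAM

/-! The contraction factor may be arbitrarily close to `1` and neither it nor `p` is known, so
iterating `f` is no option. Contraction is used only qualitatively, together with piecewise
linearity. Extend `f` to the whole space by clamping. On an open dense set it is locally affine, `x
↦ A x + b`, where all coefficients are fractions with one common denominator `D` and of magnitude at
most `B`, both read off the constants (`exists_open_gridAffine`). A piece that occurs on an open set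
is itself contracting, so `A v = v` forces `v = 0`. Then `D (1 - A)` is an integer matrix with
nonzero determinant, hence of determinant at least `1` in absolute value, and Cramer's rule bounds
the inverse of `1 - A` independently of `p` and `c` (`norm_le_of_isGrid`).

The residual map `x ↦ x - g x` of a contraction `g` is a homeomorphism. Following its inverse along
a segment, which meets finitely many pieces, turns the bounds on the pieces into a global Lipschitz
bound in the sup norm (`IsPiecewise.norm_sub_le_norm_residual`). The `ℓ_p` norm is monotone in the
absolute values of the coordinates, so replacing the first `k` output coordinates by `0` leaves a
contraction, and the same bound holds on every slice with the first `k` coordinates frozen. This is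
`IsConditioned`, with constant `Λ = C.cond`.

The fixpoint is approximated by nested bisection. For a trial value of coordinate `k` the later
coordinates are first made almost fixed by the inner bisections; then the sign of the residual in
coordinate `k` chooses the half interval. That sign belongs to an inexact point and may be
misleading, but this does no harm: each end of the bracket is a face of the cube or remembers a
point with the observed sign, and conditioning shows that at width one grid unit the residual at the
lower end is small (`le_residual`, `residual_le`). Each coordinate multiplies the error by at most
`4 Λ ^ 3`. With grid denominator `2 ^ (n + 1)` there are `n + 1` halvings per coordinate and `(n +
2) ^ d - 1` evaluations altogether (`iterate_tick_spec`).

The fixpoint solves a linear system of one piece, so its coordinates have denominators at most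
`C.base ^ d` (`exists_rat`). The approximation is fine enough for the extended Euclidean algorithm
to recover them exactly (`Inv.mul_eq`).

For the running time, all numbers stay below `C.memBound`. `Steps` counts elementary steps under
this bound, and each costs at most a constant of the program times the length of `C.memBound`. Since
`C.bits` is cubic in the size of the circuit, both the number of steps and the length of the numbers
fit the claimed bound. -/

/-! ### Wires of a circuit -/

namespace LinGate

/-- Value of a gate whose operands are looked up in a function. -/
def evalFn {α : Type*} [Field α] [LinearOrder α] (v : ℕ → α) : LinGate → α
  | const q => (q : α)
  | add a b => v a + v b
  | sub a b => v a - v b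
  | max a b => Max.max (v a) (v b)
  | min a b => Min.min (v a) (v b)
  | scale ζ a => (ζ : α) * v a

theorem eval_eq_evalFn {α : Type*} [Field α] [LinearOrder α] (w : List α) (g : LinGate) :
    g.eval w = g.evalFn (fun j => w.getD j 0) := by
  cases g <;> rfl

theorem evalFn_congr {α : Type*} [Field α] [LinearOrder α] {v v' : ℕ → α} {g : LinGate}
    (h : ∀ a ∈ g.args, v a = v' a) : g.evalFn v = g.evalFn v' := by
  cases g <;> simp_all [args, evalFn]

/-- Numerator of the constant of a gate. -/
def num : LinGate → ℤ
  | const q => q.num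
  | scale ζ _ => ζ.num
  | _ => 0

/-- Denominator of the constant of a gate. -/
def den : LinGate → ℕ
  | const q => q.den
  | scale ζ _ => ζ.den
  | _ => 1

theorem den_pos (g : LinGate) : 0 < g.den := by
  cases g <;> simp [den, Rat.den_pos]

/-- A factor by which a gate may increase the magnitude of the wires. -/
def growth (g : LinGate) : ℕ := 2 + g.num.natAbs ^ 2

end LinGate

namespace LinearFIXPCircuit

variable {d : ℕ}

theorem foldl_getD_of_lt {α : Type*} [Field α] [LinearOrder α] (gs : List LinGate) (w : List α)
    {j : ℕ} (hj : j < w.length) :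
    (gs.foldl (fun w g => w ++ [g.eval w]) w).getD j 0 = w.getD j 0 := by
  induction gs generalizing w with
  | nil => rfl
  | cons g gs ih =>
    rw [List.foldl_cons, ih _ (by simp; omega), List.getD_append _ _ _ _ hj]

/-- Gate `k` is evaluated when only the wires before it exist, so any later index reads the default
`0`. The conditional in the lookup records this until `args_lt` removes it in `wire_gate`. -/
theorem foldl_getD_add {α : Type*} [Field α] [LinearOrder α] (gs : List LinGate) (w : List α)
    {k : ℕ} (hk : k < gs.length) :
    (gs.foldl (fun w g => w ++ [g.eval w]) w).getD (w.length + k) 0 =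
      (gs[k]).evalFn (fun j => if j < w.length + k then
        (gs.foldl (fun w g => w ++ [g.eval w]) w).getD j 0 else 0) := by
  induction gs generalizing w k with
  | nil => simp at hk
  | cons g gs ih =>
    cases k with
    | zero =>
      rw [List.foldl_cons, foldl_getD_of_lt _ _ (by simp)]
      simp only [add_zero, List.getElem_cons_zero]
      rw [List.getD_append_right _ _ _ _ le_rfl, Nat.sub_self, List.getD_cons_zero,
        LinGate.eval_eq_evalFn]
      congr 1
      funext j
      split_ifs with h
      · rw [foldl_getD_of_lt _ _ (by simp; omega), List.getD_append _ _ _ _ h]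
      · rw [List.getD_eq_default _ _ (by omega)]
    | succ k =>
      have := ih (w ++ [g.eval w]) (k := k) (by simpa using hk)
      simp only [List.length_append, List.length_singleton] at this
      rw [List.foldl_cons, List.getElem_cons_succ, show w.length + (k + 1) = w.length + 1 + k by ring]
      exact this

/-- The value of wire `j` on input `x`. -/
def wire {α : Type*} [Field α] [LinearOrder α] (C : LinearFIXPCircuit d) (x : Fin d → α) (j : ℕ) :
    α := (C.wires x).getD j 0

theorem wire_input {α : Type*} [Field α] [LinearOrder α] (C : LinearFIXPCircuit d) (x : Fin d → α)
    {j : ℕ} (hj : j < d) : C.wire x j = x ⟨j, hj⟩ := by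
  rw [wire, wires, foldl_getD_of_lt _ _ (by simpa using hj)]
  simp [List.getD_eq_getElem?_getD, hj]

theorem wire_gate {α : Type*} [Field α] [LinearOrder α] (C : LinearFIXPCircuit d) (x : Fin d → α)
    {k : ℕ} (hk : k < C.gates.length) : C.wire x (d + k) = (C.gates[k]).evalFn (C.wire x) := by
  have h := foldl_getD_add C.gates (List.ofFn x) hk
  rw [List.length_ofFn] at h
  rw [wire, wires, h]
  refine LinGate.evalFn_congr fun a ha => ?_
  rw [if_pos (C.args_lt k hk a ha)]
  rfl

/-- Induction over the wires of a circuit. -/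
theorem wire_induction (C : LinearFIXPCircuit d) {motive : ℕ → Prop}
    (input : ∀ i (_ : i < d), motive i)
    (gate : ∀ k (hk : k < C.gates.length), (∀ a ∈ (C.gates[k]).args, motive a) → motive (d + k)) :
    ∀ j < d + C.gates.length, motive j := by
  intro j
  induction j using Nat.strong_induction_on with
  | _ j ih =>
    intro hj
    rcases lt_or_ge j d with h | h
    · exact input j h
    · obtain ⟨k, rfl⟩ := Nat.exists_eq_add_of_le h
      have hk : k < C.gates.length := by omega
      refine gate k hk fun a ha => ?_
      have := C.args_lt k hk a ha
      exact ih a this (by omega)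

/-- Product of the denominators of the first `k` gates. -/
def denUpTo (C : LinearFIXPCircuit d) (k : ℕ) : ℕ := ((C.gates.take k).map LinGate.den).prod

/-- Product of the growth factors of the first `k` gates. -/
def growthUpTo (C : LinearFIXPCircuit d) (k : ℕ) : ℕ := ((C.gates.take k).map LinGate.growth).prod

theorem denUpTo_succ (C : LinearFIXPCircuit d) {k : ℕ} (hk : k < C.gates.length) :
    C.denUpTo (k + 1) = C.denUpTo k * (C.gates[k]).den := by
  rw [denUpTo, List.map_take, List.prod_take_succ _ _ (by simpa using hk), ← List.map_take]
  simp [denUpTo]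

theorem growthUpTo_succ (C : LinearFIXPCircuit d) {k : ℕ} (hk : k < C.gates.length) :
    C.growthUpTo (k + 1) = C.growthUpTo k * (C.gates[k]).growth := by
  rw [growthUpTo, List.map_take, List.prod_take_succ _ _ (by simpa using hk), ← List.map_take]
  simp [growthUpTo]

theorem growthUpTo_pos (C : LinearFIXPCircuit d) (k : ℕ) : 0 < C.growthUpTo k := by
  refine List.prod_pos fun a ha => ?_
  obtain ⟨g, -, rfl⟩ := List.mem_map.1 ha
  simp [LinGate.growth]

theorem denUpTo_pos (C : LinearFIXPCircuit d) (k : ℕ) : 0 < C.denUpTo k := by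
  refine List.prod_pos fun a ha => ?_
  obtain ⟨g, -, rfl⟩ := List.mem_map.1 ha
  exact g.den_pos

theorem denUpTo_mono (C : LinearFIXPCircuit d) {k l : ℕ} (h : k ≤ l) (hl : l ≤ C.gates.length) :
    C.denUpTo k ∣ C.denUpTo l := by
  induction l, h using Nat.le_induction with
  | base => rfl
  | succ l _ ih => exact (ih (by omega)).trans (C.denUpTo_succ hl ▸ dvd_mul_right _ _)

theorem growthUpTo_mono (C : LinearFIXPCircuit d) {k l : ℕ} (h : k ≤ l) (hl : l ≤ C.gates.length) :
    C.growthUpTo k ≤ C.growthUpTo l := by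
  induction l, h using Nat.le_induction with
  | base => rfl
  | succ l _ ih =>
    refine (ih (by omega)).trans ?_
    rw [C.growthUpTo_succ hl]
    exact Nat.le_mul_of_pos_right _ (by simp [LinGate.growth])

/-- Common denominator of the constants. -/
def denProd (C : LinearFIXPCircuit d) : ℕ := C.denUpTo C.gates.length

/-- Bound on the magnitude of the coefficients. -/
def growthProd (C : LinearFIXPCircuit d) : ℕ := C.growthUpTo C.gates.length

end LinearFIXPCircuit

/-! ### Numbers with bounded denominator and magnitude. -/

/-- `a` is a fraction with denominator `D`, of absolute value at most `B`. -/
def IsGrid (D B : ℕ) (a : ℝ) : Prop := (∃ n : ℤ, a * D = n) ∧ |a| ≤ B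

namespace IsGrid

variable {D D' B B' : ℕ} {a b : ℝ}

theorem mono (h : IsGrid D B a) (hD : D ∣ D') (hB : B ≤ B') : IsGrid D' B' a := by
  obtain ⟨⟨n, hn⟩, h2⟩ := h
  obtain ⟨e, rfl⟩ := hD
  refine ⟨⟨n * e, ?_⟩, h2.trans (by exact_mod_cast hB)⟩
  push_cast
  rw [← hn]
  ring

theorem zero : IsGrid D B 0 := ⟨⟨0, by simp⟩, by simp⟩

theorem one (hB : 1 ≤ B) : IsGrid D B 1 := ⟨⟨D, by simp⟩, by simpa using hB⟩

theorem add (ha : IsGrid D B a) (hb : IsGrid D B b) : IsGrid D (B * 2) (a + b) := by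
  obtain ⟨⟨m, hm⟩, h1⟩ := ha
  obtain ⟨⟨n, hn⟩, h2⟩ := hb
  refine ⟨⟨m + n, by push_cast; rw [← hm, ← hn]; ring⟩, (abs_add_le _ _).trans ?_⟩
  push_cast
  linarith

theorem neg (ha : IsGrid D B a) : IsGrid D B (-a) := by
  obtain ⟨⟨m, hm⟩, h1⟩ := ha
  exact ⟨⟨-m, by push_cast; rw [← hm]; ring⟩, by rwa [abs_neg]⟩

theorem sub (ha : IsGrid D B a) (hb : IsGrid D B b) : IsGrid D (B * 2) (a - b) := by
  rw [sub_eq_add_neg]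
  exact ha.add hb.neg

theorem abs_rat_le (q : ℚ) : |(q : ℝ)| ≤ (q.num.natAbs : ℝ) := by
  have h := Rat.num_div_den q
  have h1 : (1 : ℝ) ≤ q.den := by exact_mod_cast q.den_pos
  rw [Rat.cast_def, abs_div, Nat.abs_cast, Nat.cast_natAbs, Int.cast_abs]
  exact div_le_self (abs_nonneg _) h1

theorem rat (q : ℚ) : IsGrid q.den q.num.natAbs (q : ℝ) := by
  refine ⟨⟨q.num, ?_⟩, abs_rat_le q⟩
  exact_mod_cast Rat.mul_den_eq_num q

theorem rat_mul (q : ℚ) (ha : IsGrid D B a) :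
    IsGrid (D * q.den) (B * q.num.natAbs) ((q : ℝ) * a) := by
  obtain ⟨⟨m, hm⟩, h1⟩ := ha
  obtain ⟨⟨n, hn⟩, h2⟩ := rat q
  refine ⟨⟨n * m, by push_cast; rw [← hm, ← hn]; ring⟩, ?_⟩
  rw [abs_mul, mul_comm]
  push_cast
  exact mul_le_mul h1 h2 (abs_nonneg _) (by positivity)

theorem finite (hD : 0 < D) : {a : ℝ | IsGrid D B a}.Finite := by
  refine (((Set.finite_Icc (-(B * D : ℤ)) (B * D)).image (fun n : ℤ => (n : ℝ) / D))).subset ?_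
  rintro a ⟨⟨n, hn⟩, h⟩
  have hD' : (0 : ℝ) < D := by exact_mod_cast hD
  refine ⟨n, ?_, by simp only; rw [← hn]; field_simp⟩
  have : |(n : ℝ)| ≤ B * D := by
    rw [← hn, abs_mul, Nat.abs_cast]
    gcongr
  rw [abs_le] at this
  constructor <;> [have := this.1; have := this.2] <;> exact_mod_cast this

end IsGrid

/-- The square in `growth` lets the machine compute the factor from a signed numerator without
taking an absolute value; the summand `2` covers sums and differences. -/
theorem LinGate.natAbs_num_le_growth (g : LinGate) : g.num.natAbs ≤ g.growth := by
  have := Nat.le_self_pow (two_ne_zero) g.num.natAbs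
  simp only [growth]
  omega

theorem LinGate.two_le_growth (g : LinGate) : 2 ≤ g.growth := by simp [growth]

/-! ### Local affine pieces -/

section Pieces

variable {d : ℕ}

/-- On `O` the function is affine, with coefficients on a grid. -/
def IsGridAffineOn (D B : ℕ) (φ : (Fin d → ℝ) → ℝ) (O : Set (Fin d → ℝ)) : Prop :=
  ∃ (a : Fin d → ℝ) (b : ℝ), (∀ i, IsGrid D B (a i)) ∧ IsGrid D B b ∧
    ∀ x ∈ O, φ x = ∑ i, a i * x i + b

namespace IsGridAffineOn

variable {D D' B B' : ℕ} {φ ψ : (Fin d → ℝ) → ℝ} {O U : Set (Fin d → ℝ)}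

theorem mono (h : IsGridAffineOn D B φ O) (hD : D ∣ D') (hB : B ≤ B') :
    IsGridAffineOn D' B' φ O := by
  obtain ⟨a, b, h1, h2, h3⟩ := h
  exact ⟨a, b, fun i => (h1 i).mono hD hB, h2.mono hD hB, h3⟩

theorem congr_subset (h : IsGridAffineOn D B φ O) (hU : U ⊆ O) (e : ∀ x ∈ U, ψ x = φ x) :
    IsGridAffineOn D B ψ U := by
  obtain ⟨a, b, h1, h2, h3⟩ := h
  exact ⟨a, b, h1, h2, fun x hx => (e x hx).trans (h3 x (hU hx))⟩

theorem const {c : ℝ} (h : IsGrid D B c) : IsGridAffineOn D B (fun _ => c) O :=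
  ⟨0, c, fun _ => IsGrid.zero, h, fun x _ => by simp⟩

theorem coord (i : Fin d) (hB : 1 ≤ B) : IsGridAffineOn D B (fun x => x i) O := by
  refine ⟨Pi.single i 1, 0, fun j => ?_, IsGrid.zero, fun x _ => by simp [Pi.single_apply]⟩
  rcases eq_or_ne j i with rfl | h
  · simpa using IsGrid.one hB
  · simpa [h] using IsGrid.zero

theorem add (hφ : IsGridAffineOn D B φ O) (hψ : IsGridAffineOn D B ψ O) :
    IsGridAffineOn D (B * 2) (fun x => φ x + ψ x) O := by
  obtain ⟨a, b, h1, h2, h3⟩ := hφ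
  obtain ⟨a', b', h1', h2', h3'⟩ := hψ
  refine ⟨a + a', b + b', fun i => (h1 i).add (h1' i), h2.add h2', fun x hx => ?_⟩
  simp only [h3 x hx, h3' x hx, Pi.add_apply, add_mul, Finset.sum_add_distrib]
  ring

theorem sub (hφ : IsGridAffineOn D B φ O) (hψ : IsGridAffineOn D B ψ O) :
    IsGridAffineOn D (B * 2) (fun x => φ x - ψ x) O := by
  obtain ⟨a, b, h1, h2, h3⟩ := hφ
  obtain ⟨a', b', h1', h2', h3'⟩ := hψ
  refine ⟨a - a', b - b', fun i => (h1 i).sub (h1' i), h2.sub h2', fun x hx => ?_⟩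
  simp only [h3 x hx, h3' x hx, Pi.sub_apply, sub_mul, Finset.sum_sub_distrib]
  ring

theorem rat_mul (q : ℚ) (hφ : IsGridAffineOn D B φ O) :
    IsGridAffineOn (D * q.den) (B * q.num.natAbs) (fun x => (q : ℝ) * φ x) O := by
  obtain ⟨a, b, h1, h2, h3⟩ := hφ
  refine ⟨fun i => q * a i, q * b, fun i => (h1 i).rat_mul q, h2.rat_mul q, fun x hx => ?_⟩
  simp only [h3 x hx, mul_add, Finset.mul_sum, mul_assoc]

end IsGridAffineOn

/-- Either the first inequality holds throughout, or its strict failure at one point persists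
nearby. This resolves each maximum, minimum and clamp after shrinking the open set, without
describing the regions of linearity. -/
theorem exists_open_le_or_ge {X : Type*} [TopologicalSpace X] {φ ψ : X → ℝ} (hφ : Continuous φ)
    (hψ : Continuous ψ) {O : Set X} (hO : IsOpen O) (hne : O.Nonempty) :
    ∃ U ⊆ O, IsOpen U ∧ U.Nonempty ∧ ((∀ x ∈ U, φ x ≤ ψ x) ∨ ∀ x ∈ U, ψ x ≤ φ x) := by
  by_cases h : ∀ x ∈ O, φ x ≤ ψ x
  · exact ⟨O, subset_rfl, hO, hne, Or.inl h⟩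
  · push Not at h
    obtain ⟨x, hx, hlt⟩ := h
    exact ⟨O ∩ {y | ψ y < φ y}, Set.inter_subset_left, hO.inter (isOpen_lt hψ hφ), ⟨x, hx, hlt⟩,
      Or.inr fun y hy => hy.2.le⟩

theorem exists_open_forall_lt {X : Type*} [TopologicalSpace X] {P : ℕ → Set X → Prop} {n : ℕ}
    (mono : ∀ j U V, U ⊆ V → P j V → P j U)
    (step : ∀ j < n, ∀ O, IsOpen O → O.Nonempty → (∀ i < j, P i O) →
      ∃ U ⊆ O, IsOpen U ∧ U.Nonempty ∧ P j U)
    {O : Set X} (hO : IsOpen O) (hne : O.Nonempty) :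
    ∃ U ⊆ O, IsOpen U ∧ U.Nonempty ∧ ∀ j < n, P j U := by
  induction n with
  | zero => exact ⟨O, subset_rfl, hO, hne, by simp⟩
  | succ n ih =>
    obtain ⟨U, hUO, hU, hUne, h⟩ := ih fun j hj => step j (by omega)
    obtain ⟨V, hVU, hV, hVne, h'⟩ := step n (by omega) U hU hUne h
    refine ⟨V, hVU.trans hUO, hV, hVne, fun j hj => ?_⟩
    rcases Nat.lt_succ_iff_lt_or_eq.1 hj with h1 | rfl
    · exact mono j V U hVU (h j h1)
    · exact h'

/-- Coordinatewise projection to the unit cube. -/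
def clamp (x : Fin d → ℝ) : Fin d → ℝ := fun i => max 0 (min 1 (x i))

theorem clamp_mem (x : Fin d → ℝ) : clamp x ∈ Set.Icc (0 : Fin d → ℝ) 1 :=
  ⟨fun _ => le_max_left _ _, fun _ => max_le zero_le_one (min_le_left _ _)⟩

theorem clamp_of_mem {x : Fin d → ℝ} (hx : x ∈ Set.Icc (0 : Fin d → ℝ) 1) : clamp x = x := by
  funext i
  have h0 : 0 ≤ x i := hx.1 i
  have h1 : x i ≤ 1 := hx.2 i
  simp [clamp, h0, h1]

theorem continuous_clamp : Continuous (clamp : (Fin d → ℝ) → _) := by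
  unfold clamp
  fun_prop

theorem abs_clamp_sub_le (x y : Fin d → ℝ) (i : Fin d) : |clamp x i - clamp y i| ≤ |x i - y i| := by
  have h1 : |clamp x i - clamp y i| ≤ |min 1 (x i) - min 1 (y i)| := by
    simp only [clamp, max_comm (0 : ℝ)]
    exact abs_max_sub_max_le_abs _ _ _
  refine h1.trans ((abs_min_sub_min_le_max _ _ _ _).trans ?_)
  simp

namespace LinearFIXPCircuit

theorem continuous_wire (C : LinearFIXPCircuit d) :
    ∀ j < d + C.gates.length, Continuous fun x : Fin d → ℝ => C.wire x j := by
  refine C.wire_induction (fun i hi => ?_) fun k hk ih => ?_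
  · simp only [C.wire_input _ hi]
    fun_prop
  · simp only [C.wire_gate _ hk]
    revert ih
    generalize C.gates[k] = g
    intro ih
    cases g <;> simp only [LinGate.args, List.mem_cons, List.not_mem_nil, or_false,
      forall_eq_or_imp, forall_eq] at ih <;> simp only [LinGate.evalFn]
    · exact continuous_const
    · exact ih.1.add ih.2
    · exact ih.1.sub ih.2
    · exact ih.1.max ih.2
    · exact ih.1.min ih.2
    · exact continuous_const.mul ih

theorem continuous_eval (C : LinearFIXPCircuit d) :
    Continuous (C.eval : (Fin d → ℝ) → Fin d → ℝ) :=
  continuous_pi fun i => C.continuous_wire _ (C.out_lt i)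

/-- On a suitable open subset of any nonempty open set all wires, on clamped inputs, are affine. -/
theorem exists_open_gridAffine (C : LinearFIXPCircuit d) {O : Set (Fin d → ℝ)} (hO : IsOpen O)
    (hne : O.Nonempty) :
    ∃ U ⊆ O, IsOpen U ∧ U.Nonempty ∧ ∀ j < d + C.gates.length,
      IsGridAffineOn C.denProd C.growthProd (fun x => C.wire (clamp x) j) U := by
  -- The truncated difference `j + 1 - d` is `0` for an input and `k + 1` for the output of gate
  -- `k`, so each wire is charged only for the gates up to its own.
  have key : ∃ U ⊆ O, IsOpen U ∧ U.Nonempty ∧ ∀ j < d + C.gates.length,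
      IsGridAffineOn (C.denUpTo (j + 1 - d)) (C.growthUpTo (j + 1 - d))
        (fun x => C.wire (clamp x) j) U := by
    refine exists_open_forall_lt (fun j U V hUV h => h.congr_subset hUV fun _ _ => rfl) ?_ hO hne
    intro j hj O hO hne ih
    rcases lt_or_ge j d with h | h
    · simp only [C.wire_input _ h]
      have h1 : 1 ≤ C.growthUpTo (j + 1 - d) := C.growthUpTo_pos _
      have hc : Continuous fun x : Fin d → ℝ => x ⟨j, h⟩ := continuous_apply _
      -- Two shrinkings decide on which side of `0` and of `1` the coordinate lies; clamping is then
      -- constant or the identity.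
      obtain ⟨U, hUO, hU, hUne, hU'⟩ := exists_open_le_or_ge continuous_const hc hO hne (φ := fun _ => 0)
      obtain ⟨V, hVU, hV, hVne, hV'⟩ := exists_open_le_or_ge continuous_const hc hU hUne (φ := fun _ => 1)
      refine ⟨V, hVU.trans hUO, hV, hVne, ?_⟩
      rcases hV' with hV' | hV'
      · refine (IsGridAffineOn.const (IsGrid.one h1)).congr_subset subset_rfl fun x hx => ?_
        have := hV' x hx
        simp [clamp, this]
      · rcases hU' with hU' | hU'
        · refine (IsGridAffineOn.coord ⟨j, h⟩ h1).congr_subset subset_rfl fun x hx => ?_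
          have h1 := hV' x hx
          have h2 := hU' x (hVU hx)
          simp [clamp, h1, h2]
        · refine (IsGridAffineOn.const (IsGrid.zero)).congr_subset subset_rfl fun x hx => ?_
          have h2 := hU' x (hVU hx)
          simp [clamp, h2]
    · obtain ⟨k, rfl⟩ := Nat.exists_eq_add_of_le h
      have hk : k < C.gates.length := by omega
      rw [show d + k + 1 - d = k + 1 by omega, C.denUpTo_succ hk, C.growthUpTo_succ hk]
      simp only [C.wire_gate _ hk]
      have args : ∀ a ∈ (C.gates[k]).args, IsGridAffineOn (C.denUpTo k) (C.growthUpTo k)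
          (fun x => C.wire (clamp x) a) O ∧ Continuous fun x => C.wire (clamp x) a := by
        intro a ha
        have hlt := C.args_lt k hk a ha
        exact ⟨(ih a hlt).mono (C.denUpTo_mono (by omega) (by omega))
          (C.growthUpTo_mono (by omega) (by omega)),
          (C.continuous_wire a (by omega)).comp continuous_clamp⟩
      have hpos : 1 ≤ C.growthUpTo k := C.growthUpTo_pos k
      have hg1 := (C.gates[k]).natAbs_num_le_growth
      have hg2 := (C.gates[k]).two_le_growth
      revert args hg1 hg2
      generalize C.gates[k] = g
      intro args hg1 hg2
      have hm : C.growthUpTo k ≤ C.growthUpTo k * g.growth :=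
        Nat.le_mul_of_pos_right _ (by omega)
      have hm2 : C.growthUpTo k * 2 ≤ C.growthUpTo k * g.growth := Nat.mul_le_mul_left _ hg2
      have hmn : C.growthUpTo k * g.num.natAbs ≤ C.growthUpTo k * g.growth :=
        Nat.mul_le_mul_left _ hg1
      cases g with
      | const q =>
        exact ⟨O, subset_rfl, hO, hne, .const ((IsGrid.rat q).mono (dvd_mul_left _ _)
          (hmn.trans' (Nat.le_mul_of_pos_left _ hpos)))⟩
      | add a b =>
        simp only [LinGate.args, List.mem_cons, List.not_mem_nil, or_false,
          forall_eq_or_imp, forall_eq] at args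
        exact ⟨O, subset_rfl, hO, hne, (args.1.1.add args.2.1).mono (dvd_mul_right _ _) hm2⟩
      | sub a b =>
        simp only [LinGate.args, List.mem_cons, List.not_mem_nil, or_false,
          forall_eq_or_imp, forall_eq] at args
        exact ⟨O, subset_rfl, hO, hne, (args.1.1.sub args.2.1).mono (dvd_mul_right _ _) hm2⟩
      | max a b =>
        simp only [LinGate.args, List.mem_cons, List.not_mem_nil, or_false,
          forall_eq_or_imp, forall_eq] at args
        obtain ⟨U, hUO, hU, hUne, h'⟩ := exists_open_le_or_ge args.1.2 args.2.2 hO hne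
        refine ⟨U, hUO, hU, hUne, ?_⟩
        rcases h' with h' | h'
        · exact (args.2.1.mono (dvd_mul_right _ _) hm).congr_subset hUO fun x hx =>
            max_eq_right (h' x hx)
        · exact (args.1.1.mono (dvd_mul_right _ _) hm).congr_subset hUO fun x hx =>
            max_eq_left (h' x hx)
      | min a b =>
        simp only [LinGate.args, List.mem_cons, List.not_mem_nil, or_false,
          forall_eq_or_imp, forall_eq] at args
        obtain ⟨U, hUO, hU, hUne, h'⟩ := exists_open_le_or_ge args.1.2 args.2.2 hO hne
        refine ⟨U, hUO, hU, hUne, ?_⟩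
        rcases h' with h' | h'
        · exact (args.1.1.mono (dvd_mul_right _ _) hm).congr_subset hUO fun x hx =>
            min_eq_left (h' x hx)
        · exact (args.2.1.mono (dvd_mul_right _ _) hm).congr_subset hUO fun x hx =>
            min_eq_right (h' x hx)
      | scale ζ a =>
        simp only [LinGate.args, List.mem_cons, List.not_mem_nil, or_false, forall_eq] at args
        exact ⟨O, subset_rfl, hO, hne, (args.1.rat_mul ζ).mono dvd_rfl hmn⟩
  obtain ⟨U, hUO, hU, hUne, h⟩ := key
  exact ⟨U, hUO, hU, hUne, fun j hj => (h j hj).mono (C.denUpTo_mono (by omega) le_rfl)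
    (C.growthUpTo_mono (by omega) le_rfl)⟩

end LinearFIXPCircuit

end Pieces

/-! ### Conditioning of piecewise affine contractions -/

section Conditioning

variable {d : ℕ}

/-- Monotonicity in the absolute values is the special property of `ℓ_p` norms on which the argument
rests: it makes clamping nonexpansive and lets coordinates be replaced by zero. -/
theorem PiLp.norm_toLp_le_of_abs_le {p : ℝ≥0∞} [Fact (1 ≤ p)] {x y : Fin d → ℝ}
    (h : ∀ i, |x i| ≤ |y i|) : ‖WithLp.toLp p x‖ ≤ ‖WithLp.toLp p y‖ := by
  rcases eq_or_ne p ∞ with rfl | hp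
  · rw [PiLp.norm_toLp, PiLp.norm_toLp]
    exact (pi_norm_le_iff_of_nonneg (norm_nonneg _)).2 fun i => (h i).trans (norm_le_pi_norm y i)
  · have hp0 : 0 < p.toReal :=
      ENNReal.toReal_pos (zero_lt_one.trans_le (Fact.out : 1 ≤ p)).ne' hp
    rw [PiLp.norm_eq_sum hp0, PiLp.norm_eq_sum hp0]
    refine Real.rpow_le_rpow (Finset.sum_nonneg fun i _ => by positivity)
      (Finset.sum_le_sum fun i _ => ?_) (by positivity)
    exact Real.rpow_le_rpow (norm_nonneg _) (h i) hp0.le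

/-- A function on the line that is Lipschitz on each set of a finite closed cover is Lipschitz. -/
theorem norm_sub_le_of_finite_closed_cover {E ι : Type*} [NormedAddCommGroup E] {φ : ℝ → E} {K : ℝ}
    {F : Set ι} (hF : F.Finite) {S : ι → Set ℝ} (hS : ∀ i ∈ F, IsClosed (S i))
    (hcov : ∀ s, ∃ i ∈ F, s ∈ S i)
    (hlip : ∀ i ∈ F, ∀ s ∈ S i, ∀ t ∈ S i, ‖φ t - φ s‖ ≤ K * |t - s|) {a b : ℝ} (hab : a ≤ b) :
    ‖φ b - φ a‖ ≤ K * (b - a) := by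
  have near : ∀ s, ∀ᶠ t in nhds s, ‖φ t - φ s‖ ≤ K * |t - s| := by
    intro s
    -- Closed sets missing `s` miss a neighbourhood of it. So every `t` near `s` shares with `s` a
    -- set of the cover, which gives the estimate around `s`.
    have h1 : ∀ i ∈ F, ∀ᶠ t in nhds s, t ∈ S i → s ∈ S i := by
      intro i hi
      by_cases hs : s ∈ S i
      · exact Filter.Eventually.of_forall fun _ _ => hs
      · filter_upwards [(hS i hi).isOpen_compl.mem_nhds hs] with t ht h
        exact absurd h ht
    filter_upwards [(Filter.eventually_all_finite hF).2 h1] with t ht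
    obtain ⟨i, hi, hti⟩ := hcov t
    exact hlip i hi s (ht i hi hti) t hti
  have hcont : Continuous φ := by
    refine continuous_iff_continuousAt.2 fun s => ?_
    rw [ContinuousAt, tendsto_iff_norm_sub_tendsto_zero]
    refine squeeze_zero' (Filter.Eventually.of_forall fun _ => norm_nonneg _) (near s) ?_
    have : Continuous fun t : ℝ => K * |t - s| := by fun_prop
    simpa using this.tendsto s
  have hclosed : IsClosed ({t | ‖φ t - φ a‖ ≤ K * (t - a)} ∩ Set.Icc a b) :=
    (isClosed_le (by fun_prop) (by fun_prop)).inter isClosed_Icc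
  -- Continuous induction along the interval: the estimate holds on a closed set that can always be
  -- prolonged to the right.
  refine hclosed.Icc_subset_of_forall_mem_nhdsWithin (by simp) ?_ ⟨hab, le_rfl⟩
  rintro s ⟨hs, -⟩
  filter_upwards [nhdsWithin_le_nhds (near s), self_mem_nhdsWithin] with t ht hst
  have hst' : s < t := hst
  rw [abs_of_pos (by linarith)] at ht
  have hs' : ‖φ s - φ a‖ ≤ K * (s - a) := hs
  calc ‖φ t - φ a‖ = ‖(φ t - φ s) + (φ s - φ a)‖ := by congr 1; abel
    _ ≤ K * (t - s) + K * (s - a) := (norm_add_le _ _).trans (add_le_add ht hs')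
    _ = K * (t - a) := by ring

/-- An affine map of `ℝ^d`, as a matrix and a vector. -/
abbrev AffinePiece (d : ℕ) := Matrix (Fin d) (Fin d) ℝ × (Fin d → ℝ)

/-- `g` coincides at every point with one of the finitely many affine maps in `F`. -/
def IsPiecewise (F : Set (AffinePiece d)) (g : (Fin d → ℝ) → Fin d → ℝ) : Prop :=
  F.Finite ∧ ∀ x, ∃ P ∈ F, g x = P.1.mulVec x + P.2

/-- On a segment, the sets where `g` agrees with a given piece form a finite closed cover, however
complicated the regions are, so a common bound on the pieces passes to `g`. -/
theorem IsPiecewise.norm_sub_le {F : Set (AffinePiece d)} {g : (Fin d → ℝ) → Fin d → ℝ}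
    (hg : IsPiecewise F g) (hc : Continuous g) {K : ℝ}
    (hK : ∀ P ∈ F, ∀ v, ‖P.1.mulVec v‖ ≤ K * ‖v‖) (x y : Fin d → ℝ) :
    ‖g y - g x‖ ≤ K * ‖y - x‖ := by
  have := norm_sub_le_of_finite_closed_cover (φ := fun s : ℝ => g (x + s • (y - x)))
    (K := K * ‖y - x‖) hg.1
    (S := fun P => {s | g (x + s • (y - x)) = P.1.mulVec (x + s • (y - x)) + P.2}) ?_ ?_ ?_
    zero_le_one
  · simpa using this
  · intro P _
    exact isClosed_eq (by fun_prop)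
      (((Matrix.mulVecLin P.1).continuous_of_finiteDimensional.comp (by fun_prop)).add
        continuous_const)
  · intro s
    exact hg.2 _
  · intro P hP s hs t ht
    simp only [Set.mem_ofPred_eq] at hs ht
    rw [hs, ht, add_sub_add_right_eq_sub, ← Matrix.mulVec_sub]
    refine (hK P hP _).trans ?_
    rw [add_sub_add_left_eq_sub, ← sub_smul, norm_smul, Real.norm_eq_abs]
    exact le_of_eq (by ring)

/-- The residual map is a homeomorphism by contraction. Pulling back the segment between two
residuals gives a path on which the pieces again form a finite closed cover, and on each piece the
speed is controlled by `K`. The factor `c` serves only for the existence and continuity of the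
inverse and is absent from the estimate. -/
theorem IsPiecewise.norm_sub_le_norm_residual {F : Set (AffinePiece d)}
    {g : (Fin d → ℝ) → Fin d → ℝ} (hg : IsPiecewise F g) {p : ℝ≥0∞} [Fact (1 ≤ p)] {c : ℝ}
    (hc1 : c < 1)
    (hcontr : ∀ x y, ‖WithLp.toLp p (g x - g y)‖ ≤ c * ‖WithLp.toLp p (x - y)‖)
    (hc : Continuous g) {K : ℝ} (hK : ∀ P ∈ F, ∀ v, ‖v‖ ≤ K * ‖v - P.1.mulVec v‖)
    (x y : Fin d → ℝ) : ‖y - x‖ ≤ K * ‖(y - g y) - (x - g x)‖ := by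
  have expand : ∀ x y : Fin d → ℝ,
      (1 - c) * ‖WithLp.toLp p (x - y)‖ ≤ ‖WithLp.toLp p ((x - g x) - (y - g y))‖ := by
    intro x y
    have h1 := hcontr x y
    have h2 : WithLp.toLp p (x - y) =
        WithLp.toLp p ((x - g x) - (y - g y)) + WithLp.toLp p (g x - g y) := by
      rw [← WithLp.toLp_add]
      congr 1
      abel
    have h3 := norm_add_le (WithLp.toLp p ((x - g x) - (y - g y))) (WithLp.toLp p (g x - g y))
    rw [← h2] at h3
    linarith
  -- Preimages of `u` are the fixpoints of the contraction `x ↦ g x + u`.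
  have surj : ∀ u, ∃ x, x - g x = u := by
    intro u
    let G : PiLp p (fun _ : Fin d => ℝ) → PiLp p (fun _ : Fin d => ℝ) :=
      fun z => WithLp.toLp p (g (WithLp.ofLp z) + u)
    have hG : ContractingWith c.toNNReal G := by
      refine ⟨by simpa using hc1, LipschitzWith.of_dist_le_mul fun z w => ?_⟩
      rw [dist_eq_norm, dist_eq_norm]
      have h := hcontr (WithLp.ofLp z) (WithLp.ofLp w)
      have e : G z - G w = WithLp.toLp p (g (WithLp.ofLp z) - g (WithLp.ofLp w)) := by
        rw [← WithLp.toLp_sub]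
        congr 1
        abel
      rw [e]
      refine h.trans (mul_le_mul (Real.le_coe_toNNReal c) (le_of_eq ?_) (norm_nonneg _) (by simp))
      rw [WithLp.toLp_sub]
    refine ⟨WithLp.ofLp (hG.fixedPoint G), ?_⟩
    have h : G (hG.fixedPoint G) = hG.fixedPoint G := hG.fixedPoint_isFixedPt
    have h2 := congrArg WithLp.ofLp h
    simp only [G] at h2
    nth_rewrite 1 [← h2]
    abel
  choose inv hinv using surj
  have hinj : ∀ x, inv (x - g x) = x := by
    intro x
    have h := expand (inv (x - g x)) x
    rw [hinv, sub_self, WithLp.toLp_zero, norm_zero] at h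
    have h0 : ‖WithLp.toLp p (inv (x - g x) - x)‖ = 0 := by
      have := norm_nonneg (WithLp.toLp p (inv (x - g x) - x))
      nlinarith
    rw [norm_eq_zero] at h0
    have h2 := congrArg WithLp.ofLp h0
    simpa [sub_eq_zero] using h2
  have hinvc : Continuous inv := by
    have h : LipschitzWith (1 - c)⁻¹.toNNReal
        (fun u : PiLp p (fun _ : Fin d => ℝ) => WithLp.toLp p (inv (WithLp.ofLp u))) := by
      refine LipschitzWith.of_dist_le_mul fun u v => ?_
      have h := expand (inv (WithLp.ofLp u)) (inv (WithLp.ofLp v))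
      rw [hinv, hinv] at h
      have hpos : 0 < 1 - c := by linarith
      rw [dist_eq_norm, dist_eq_norm, Real.coe_toNNReal _ (by positivity), inv_mul_eq_div,
        le_div_iff₀' hpos, ← WithLp.toLp_sub]
      exact h
    exact (PiLp.continuous_ofLp p _).comp (h.continuous.comp (PiLp.continuous_toLp p _))
  have := norm_sub_le_of_finite_closed_cover
    (φ := fun s : ℝ => inv ((x - g x) + s • ((y - g y) - (x - g x))))
    (K := K * ‖(y - g y) - (x - g x)‖) hg.1
    (S := fun P => {s | g (inv ((x - g x) + s • ((y - g y) - (x - g x)))) =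
      P.1.mulVec (inv ((x - g x) + s • ((y - g y) - (x - g x)))) + P.2}) ?_ ?_ ?_
    zero_le_one
  · simpa [hinj] using this
  · intro P _
    exact isClosed_eq (by fun_prop)
      (((Matrix.mulVecLin P.1).continuous_of_finiteDimensional.comp (by fun_prop)).add
        continuous_const)
  · intro s
    exact hg.2 _
  · intro P hP s hs t ht
    simp only [Set.mem_ofPred_eq] at hs ht
    refine (hK P hP _).trans ?_
    have hs' := hinv ((x - g x) + s • ((y - g y) - (x - g x)))
    have ht' := hinv ((x - g x) + t • ((y - g y) - (x - g x)))
    rw [hs] at hs'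
    rw [ht] at ht'
    generalize inv ((x - g x) + s • ((y - g y) - (x - g x))) = a at hs'
    generalize inv ((x - g x) + t • ((y - g y) - (x - g x))) = b at ht'
    -- At two parameters governed by the same piece the constant term cancels, so `1 - A` maps the
    -- displacement of the path to the displacement of the residuals.
    have e : b - a - P.1.mulVec (b - a) = (t - s) • ((y - g y) - (x - g x)) := by
      rw [Matrix.mulVec_sub, sub_smul]
      calc _ = (b - (P.1.mulVec b + P.2)) - (a - (P.1.mulVec a + P.2)) := by abel
        _ = _ := by rw [hs', ht']; abel
    rw [e, norm_smul, Real.norm_eq_abs]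
    exact le_of_eq (by ring)

/-- A matrix on a grid whose difference with the identity is regular, through Cramer's rule. -/
theorem exists_int_matrix {D B : ℕ} {A : Matrix (Fin d) (Fin d) ℝ}
    (hA : ∀ i j, IsGrid D B (A i j)) (hB : 1 ≤ B)
    (hinj : ∀ v, A.mulVec v = v → v = 0) (hD : 0 < D) :
    ∃ N : Matrix (Fin d) (Fin d) ℤ, N.det ≠ 0 ∧ |N.det| ≤ (2 * d * (D * B) : ℤ) ^ d ∧
      (∀ i j, |N.adjugate i j| ≤ (2 * d * (D * B) : ℤ) ^ d) ∧
      N.map (Int.cast : ℤ → ℝ) = (D : ℝ) • (1 - A) := by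
  choose n hn using fun i j => (hA i j).1
  have hmap : (Matrix.of fun i j => (D : ℤ) * (1 : Matrix (Fin d) (Fin d) ℤ) i j - n i j).map
      (Int.cast : ℤ → ℝ) = (D : ℝ) • (1 - A) := by
    ext i j
    simp only [Matrix.map_apply, Matrix.of_apply, Matrix.smul_apply, Matrix.sub_apply,
      smul_eq_mul, Int.cast_sub, Int.cast_mul, Int.cast_natCast, ← hn]
    rw [Matrix.one_apply, Matrix.one_apply]
    split_ifs <;> simp <;> ring
  set N : Matrix (Fin d) (Fin d) ℤ :=
    Matrix.of fun i j => (D : ℤ) * (1 : Matrix (Fin d) (Fin d) ℤ) i j - n i j with hN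
  have hDB : (D : ℤ) ≤ D * B := by
    have : (1 : ℤ) ≤ B := by exact_mod_cast hB
    have : (0 : ℤ) < D := by exact_mod_cast hD
    nlinarith
  have hDB1 : (1 : ℤ) ≤ D * B := by
    have : (1 : ℤ) ≤ D := by exact_mod_cast hD
    linarith
  have hent : ∀ i j, |N i j| ≤ (2 * (D * B) : ℤ) := by
    intro i j
    have h1 : |n i j| ≤ (D * B : ℤ) := by
      have h2 : |(n i j : ℝ)| ≤ D * B := by
        rw [← hn, abs_mul, Nat.abs_cast, mul_comm]
        exact mul_le_mul_of_nonneg_left (hA i j).2 (by positivity)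
      exact_mod_cast h2
    have h3 : |(D : ℤ) * (1 : Matrix (Fin d) (Fin d) ℤ) i j| ≤ D := by
      rw [Matrix.one_apply]
      split_ifs <;> simp
    calc |N i j| ≤ |(D : ℤ) * (1 : Matrix (Fin d) (Fin d) ℤ) i j| + |n i j| := abs_sub _ _
      _ ≤ _ := by linarith
  have hdet : ∀ N' : Matrix (Fin d) (Fin d) ℤ, (∀ i j, |N' i j| ≤ (2 * (D * B) : ℤ)) →
      |N'.det| ≤ (2 * d * (D * B) : ℤ) ^ d := by
    intro N' h
    have h1 := Matrix.det_le (abv := AbsoluteValue.abs) (A := N') (x := (2 * (D * B) : ℤ)) h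
    -- Leibniz expansion gives `d! (2 D B) ^ d`, and `d! ≤ d ^ d` puts this under `(2 d D B) ^ d`.
    simp only [Fintype.card_fin, AbsoluteValue.abs_apply, nsmul_eq_mul] at h1
    refine h1.trans ?_
    have h2 : ((d.factorial : ℕ) : ℤ) ≤ (d : ℤ) ^ d := by exact_mod_cast d.factorial_le_pow
    calc _ ≤ (d : ℤ) ^ d * (2 * (D * B)) ^ d := mul_le_mul_of_nonneg_right h2 (by positivity)
      _ = _ := by rw [← mul_pow]; ring
  refine ⟨N, ?_, hdet N hent, fun i j => ?_, hmap⟩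
  · intro h0
    have h1 : (N.map (Int.cast : ℤ → ℝ)).det = 0 := by
      have := (Int.castRingHom ℝ).map_det N
      rw [h0] at this
      simpa using this.symm
    rw [hmap] at h1
    obtain ⟨v, hv, hv0⟩ := Matrix.exists_mulVec_eq_zero_iff.2 h1
    refine hv (hinj v ?_)
    rw [Matrix.smul_mulVec, Matrix.sub_mulVec, Matrix.one_mulVec] at hv0
    have hD' : (D : ℝ) ≠ 0 := by exact_mod_cast hD.ne'
    have := (smul_eq_zero.1 hv0).resolve_left hD'
    exact (sub_eq_zero.1 this).symm
  -- An adjugate entry is the determinant of `N` with a row replaced by a unit vector, whose entries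
  -- obey the same bound.
  · rw [Matrix.adjugate_apply]
    refine hdet _ fun a b => ?_
    rw [Matrix.updateRow_apply]
    split_ifs
    · rw [Pi.single_apply]
      split_ifs <;> simp <;> linarith
    · exact hent a b

/-- Cramer's rule with the integer determinant and adjugate kept visible: the determinant serves
both as a lower bound `1` in the conditioning and as a denominator of the fixpoint. -/
theorem det_mul_apply_eq {D : ℕ} {A : Matrix (Fin d) (Fin d) ℝ} {N : Matrix (Fin d) (Fin d) ℤ}
    (hmap : N.map (Int.cast : ℤ → ℝ) = (D : ℝ) • (1 - A)) (v : Fin d → ℝ) (i : Fin d) :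
    (N.det : ℝ) * v i = ∑ j, (N.adjugate i j : ℝ) * (D * (v - A.mulVec v) j) := by
  have h2 : (N.map (Int.cast : ℤ → ℝ)).mulVec v = (D : ℝ) • (v - A.mulVec v) := by
    rw [hmap, Matrix.smul_mulVec, Matrix.sub_mulVec, Matrix.one_mulVec]
  have h3 := congrArg ((N.adjugate.map (Int.cast : ℤ → ℝ)).mulVec) h2
  have e0 : N.adjugate.map (Int.cast : ℤ → ℝ) * N.map (Int.cast : ℤ → ℝ) =
      (N.adjugate * N).map (Int.castRingHom ℝ) := (Matrix.map_mul (f := Int.castRingHom ℝ)).symm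
  have e : (N.det • (1 : Matrix (Fin d) (Fin d) ℤ)).map (Int.castRingHom ℝ) =
      (N.det : ℝ) • (1 : Matrix (Fin d) (Fin d) ℝ) := by
    ext a b
    rw [Matrix.map_apply, Matrix.smul_apply, Matrix.smul_apply, Matrix.one_apply, Matrix.one_apply]
    split_ifs <;> simp
  rw [Matrix.mulVec_mulVec, e0, Matrix.adjugate_mul, e, Matrix.smul_mulVec, Matrix.one_mulVec] at h3
  simpa [Matrix.mulVec, dotProduct] using congrFun h3 i

/-- A nonzero integer determinant is at least `1` in absolute value, so the inverse of `1 - A` is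
bounded by the adjugate alone. Injectivity of `1 - A` enters only qualitatively. -/
theorem norm_le_of_isGrid {D B : ℕ} {A : Matrix (Fin d) (Fin d) ℝ}
    (hA : ∀ i j, IsGrid D B (A i j)) (hB : 1 ≤ B) (hD : 0 < D)
    (hinj : ∀ v, A.mulVec v = v → v = 0) (v : Fin d → ℝ) :
    ‖v‖ ≤ (2 * d * (D * B) : ℝ) ^ (d + 1) * ‖v - A.mulVec v‖ := by
  obtain ⟨N, h0, -, hadj, hmap⟩ := exists_int_matrix hA hB hinj hD
  refine (pi_norm_le_iff_of_nonneg (by positivity)).2 fun i => ?_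
  have hdet1 : (1 : ℝ) ≤ |(N.det : ℝ)| := by exact_mod_cast Int.one_le_abs h0
  set u := v - A.mulVec v with hu
  have h1 := det_mul_apply_eq hmap v i
  rw [← hu] at h1
  have hd : (0 : ℝ) < d := by exact_mod_cast i.pos
  calc ‖v i‖ ≤ |(N.det : ℝ)| * |v i| := le_mul_of_one_le_left (abs_nonneg _) hdet1
    _ = |∑ j, (N.adjugate i j : ℝ) * (D * u j)| := by rw [← abs_mul, h1]
    _ ≤ ∑ _j : Fin d, (2 * d * (D * B) : ℝ) ^ d * (D * ‖u‖) := by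
      refine (Finset.abs_sum_le_sum_abs _ _).trans (Finset.sum_le_sum fun j _ => ?_)
      rw [abs_mul, abs_mul, Nat.abs_cast]
      have h5 : |(N.adjugate i j : ℝ)| ≤ (2 * d * (D * B) : ℝ) ^ d := by
        exact_mod_cast hadj i j
      exact mul_le_mul h5 (mul_le_mul_of_nonneg_left (norm_le_pi_norm u j) (by positivity))
        (by positivity) (by positivity)
    _ = (2 * d * (D * B) : ℝ) ^ d * (d * D) * ‖u‖ := by
      rw [Finset.sum_const, Finset.card_univ, Fintype.card_fin, nsmul_eq_mul]
      ring
    _ ≤ _ := by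
      rw [pow_succ]
      have hB' : (1 : ℝ) ≤ B := by exact_mod_cast hB
      have : (d * D : ℝ) ≤ 2 * d * (D * B) := by
        have : (0 : ℝ) ≤ d * D := by positivity
        nlinarith
      gcongr

end Conditioning

/-! ### Conditioning constants of a circuit and the consequences of contraction. -/

namespace LinearFIXPCircuit

variable {d : ℕ}

/-- The base of the conditioning bounds. -/
def base (C : LinearFIXPCircuit d) : ℕ := 2 * d * (C.denProd * C.growthProd)

/-- Lipschitz bound for the circuit and for the inverses of its residual maps. -/
def cond (C : LinearFIXPCircuit d) : ℕ := C.base ^ (d + 1)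

/-- The coordinates from `k` on of the map of the circuit, extended to the whole space. -/
noncomputable def tailMap (C : LinearFIXPCircuit d) (k : ℕ) (x : Fin d → ℝ) : Fin d → ℝ :=
  fun i => if k ≤ i then C.eval (clamp x) i else 0

/-- The affine maps on the grid of the circuit that do not fix a direction. -/
def pieces (C : LinearFIXPCircuit d) : Set (AffinePiece d) :=
  {P | (∀ i j, IsGrid C.denProd C.growthProd (P.1 i j)) ∧
    (∀ i, IsGrid C.denProd C.growthProd (P.2 i)) ∧ ∀ v, P.1.mulVec v = v → v = 0}

variable {C : LinearFIXPCircuit d}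

theorem denProd_pos : 0 < C.denProd := C.denUpTo_pos _

theorem growthProd_pos : 0 < C.growthProd := C.growthUpTo_pos _

theorem one_le_base (hd : 1 ≤ d) : 1 ≤ C.base := by
  have h1 : 1 ≤ C.denProd * C.growthProd := Nat.mul_pos denProd_pos growthProd_pos
  have : 1 * 1 ≤ 2 * d * (C.denProd * C.growthProd) := Nat.mul_le_mul (by omega) h1
  simpa [base] using this

theorem base_le_cond (hd : 1 ≤ d) : C.base ≤ C.cond :=
  Nat.le_self_pow (by omega) _

theorem finite_pieces : C.pieces.Finite := by
  have hD : 0 < C.denProd := denProd_pos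
  have h1 : {A : Matrix (Fin d) (Fin d) ℝ |
      ∀ i, A i ∈ {r : Fin d → ℝ | ∀ j, r j ∈ {a | IsGrid C.denProd C.growthProd a}}}.Finite :=
    Set.Finite.pi' fun _ => Set.Finite.pi' fun _ => IsGrid.finite hD
  have h2 : {r : Fin d → ℝ | ∀ j, r j ∈ {a | IsGrid C.denProd C.growthProd a}}.Finite :=
    Set.Finite.pi' fun _ => IsGrid.finite hD
  exact (h1.prod h2).subset fun P hP => ⟨fun i j => hP.1 i j, fun i => hP.2.1 i⟩

theorem continuous_tailMap (k : ℕ) : Continuous (C.tailMap k) := by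
  refine continuous_pi fun i => ?_
  unfold tailMap
  split_ifs
  · exact ((continuous_apply i).comp C.continuous_eval).comp continuous_clamp
  · exact continuous_const

theorem norm_mulVec_le {P : AffinePiece d} (hP : P ∈ C.pieces) (v : Fin d → ℝ) :
    ‖P.1.mulVec v‖ ≤ d * C.growthProd * ‖v‖ := by
  refine (pi_norm_le_iff_of_nonneg (by positivity)).2 fun i => ?_
  calc |∑ j, P.1 i j * v j| ≤ ∑ _j : Fin d, (C.growthProd : ℝ) * ‖v‖ := by
        refine (Finset.abs_sum_le_sum_abs _ _).trans (Finset.sum_le_sum fun j _ => ?_)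
        rw [abs_mul]
        exact mul_le_mul (hP.1 i j).2 (norm_le_pi_norm v j) (abs_nonneg _) (by positivity)
    _ = _ := by
        rw [Finset.sum_const, Finset.card_univ, Fintype.card_fin, nsmul_eq_mul]
        ring

section Contraction

variable {p : ℝ≥0∞} [Fact (1 ≤ p)]

/-- Zeroing output coordinates and clamping inputs can only decrease absolute values of differences,
and the `ℓ_p` norm respects this; one factor `c` serves all `k`. -/
theorem IsContraction.tailMap (h : C.IsContraction p) :
    ∃ c : ℝ, 0 < c ∧ c < 1 ∧ ∀ k x y,
      ‖WithLp.toLp p (C.tailMap k x - C.tailMap k y)‖ ≤ c * ‖WithLp.toLp p (x - y)‖ := by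
  obtain ⟨-, c, hc0, hc1, h⟩ := h
  refine ⟨c, hc0, hc1, fun k x y => ?_⟩
  calc ‖WithLp.toLp p (C.tailMap k x - C.tailMap k y)‖
      ≤ ‖WithLp.toLp p (C.eval (clamp x) - C.eval (clamp y))‖ := by
        refine PiLp.norm_toLp_le_of_abs_le fun i => ?_
        simp only [LinearFIXPCircuit.tailMap, Pi.sub_apply]
        split_ifs
        · rfl
        · simp
    _ ≤ c * ‖WithLp.toLp p (clamp x - clamp y)‖ := h _ (clamp_mem x) _ (clamp_mem y)
    _ ≤ _ := by
        gcongr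
        exact PiLp.norm_toLp_le_of_abs_le fun i => abs_clamp_sub_le x y i

/-- The points governed by an admissible piece form a finite union of closed sets. It is dense since
every open set contains an open set of linearity, hence it is everything. Passing through density
keeps only pieces that occur on an open set, and these have no fixed direction. -/
theorem IsContraction.isPiecewise (h : C.IsContraction p) (k : ℕ) :
    IsPiecewise C.pieces (C.tailMap k) := by
  obtain ⟨c, hc0, hc1, hc⟩ := h.tailMap
  refine ⟨finite_pieces, ?_⟩
  have hclosed : IsClosed (⋃ P ∈ C.pieces, {x | C.tailMap k x = P.1.mulVec x + P.2}) := by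
    refine finite_pieces.isClosed_biUnion fun P _ => ?_
    exact isClosed_eq (continuous_tailMap k)
      ((Matrix.mulVecLin P.1).continuous_of_finiteDimensional.add continuous_const)
  have hdense : Dense (⋃ P ∈ C.pieces, {x | C.tailMap k x = P.1.mulVec x + P.2}) := by
    refine dense_iff_inter_open.2 fun O hO hne => ?_
    obtain ⟨U, hUO, hU, ⟨x, hx⟩, hU'⟩ := C.exists_open_gridAffine hO hne
    choose a b ha hb hab using fun i : Fin d => hU' (C.out i) (C.out_lt i)
    let P : AffinePiece d := (Matrix.of fun i j => if k ≤ i then a i j else 0,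
      fun i => if k ≤ i then b i else 0)
    have hP : ∀ y ∈ U, C.tailMap k y = P.1.mulVec y + P.2 := by
      intro y hy
      funext i
      simp only [LinearFIXPCircuit.tailMap, P, Pi.add_apply, Matrix.mulVec, dotProduct, Matrix.of_apply]
      split_ifs
      · exact hab i y hy
      · simp
    refine ⟨x, hUO hx, Set.mem_biUnion (x := P) ⟨fun i j => ?_, fun i => ?_, fun v hv => ?_⟩ (hP x hx)⟩
    · simp only [P, Matrix.of_apply]
      split_ifs
      exacts [ha i j, IsGrid.zero]
    · simp only [P]
      split_ifs
      exacts [hb i, IsGrid.zero]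
    -- A small displacement along a fixed direction stays inside `U` and would be carried over
    -- without shrinking.
    · have hcont : Continuous fun ε : ℝ => x + ε • v := by fun_prop
      have hnear : ∀ᶠ ε in nhds (0 : ℝ), x + ε • v ∈ U :=
        hcont.continuousAt.eventually_mem (by simpa using hU.mem_nhds hx)
      obtain ⟨ε, hε, hε0⟩ :=
        ((hnear.filter_mono nhdsWithin_le_nhds).and
          (self_mem_nhdsWithin (s := Set.Ioi (0 : ℝ)))).exists
      have hε0' : (0 : ℝ) < ε := hε0
      have h1 := hc k (x + ε • v) x
      rw [hP _ hε, hP _ hx, add_sub_add_right_eq_sub, ← Matrix.mulVec_sub, add_sub_cancel_left,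
        Matrix.mulVec_smul, hv] at h1
      have h0 : ‖WithLp.toLp p (ε • v)‖ = 0 := by
        have := norm_nonneg (WithLp.toLp p (ε • v))
        nlinarith
      rw [norm_eq_zero] at h0
      have h2 : ε • v = 0 := congrArg WithLp.ofLp h0
      exact (smul_eq_zero.1 h2).resolve_left hε0'.ne'
  intro x
  have hx : x ∈ ⋃ P ∈ C.pieces, {x | C.tailMap k x = P.1.mulVec x + P.2} := by
    rw [← hclosed.closure_eq]
    exact hdense x
  simpa using hx

/-- Points that agree in the first `k` coordinates, and almost agree in the other residuals, are
close. -/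
theorem IsContraction.norm_sub_le_of_residual (h : C.IsContraction p) {k : ℕ} {x y : Fin d → ℝ}
    (hx : x ∈ Set.Icc (0 : Fin d → ℝ) 1) (hy : y ∈ Set.Icc (0 : Fin d → ℝ) 1) {δ : ℝ} (hδ : 0 ≤ δ)
    (hlow : ∀ i : Fin d, i < k → x i = y i)
    (hres : ∀ i : Fin d, k ≤ i → |(C.eval x i - x i) - (C.eval y i - y i)| ≤ δ) :
    ‖x - y‖ ≤ C.cond * δ := by
  obtain ⟨c, hc0, hc1, hc⟩ := h.tailMap
  have := (h.isPiecewise k).norm_sub_le_norm_residual (p := p) hc1 (hc k) (continuous_tailMap k)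
    (K := C.cond) (fun P hP v => ?_) y x
  · refine this.trans (mul_le_mul_of_nonneg_left ?_ (by positivity))
    refine (pi_norm_le_iff_of_nonneg hδ).2 fun i => ?_
    -- Below `k` the tail map is `0`, so the residual there is the coordinate itself and agreement
    -- of the points gives agreement of the residuals.
    simp only [Pi.sub_apply, LinearFIXPCircuit.tailMap, clamp_of_mem hx, clamp_of_mem hy]
    split_ifs with hi
    · rw [Real.norm_eq_abs, ← abs_neg]
      refine le_of_eq_of_le ?_ (hres i hi)
      congr 1
      ring
    · simpa [hlow i (by omega)] using hδ
  · have := norm_le_of_isGrid hP.1 growthProd_pos denProd_pos hP.2.2 v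
    simpa [cond, base] using this

theorem IsContraction.norm_residual_sub_le (h : C.IsContraction p) (hd : 1 ≤ d) {x y : Fin d → ℝ}
    (hx : x ∈ Set.Icc (0 : Fin d → ℝ) 1) (hy : y ∈ Set.Icc (0 : Fin d → ℝ) 1) (i : Fin d) :
    |(C.eval x i - x i) - (C.eval y i - y i)| ≤ C.cond * ‖x - y‖ := by
  have h1 := (h.isPiecewise 0).norm_sub_le (continuous_tailMap 0)
    (fun P hP => norm_mulVec_le hP) y x
  have h2 := (norm_le_pi_norm (C.tailMap 0 x - C.tailMap 0 y) i).trans h1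
  have h3 := norm_le_pi_norm (x - y) i
  simp only [LinearFIXPCircuit.tailMap, Nat.zero_le, if_true, Pi.sub_apply, clamp_of_mem hx,
    clamp_of_mem hy, Real.norm_eq_abs] at h2 h3
  have h4 : (d * C.growthProd + 1 : ℝ) ≤ C.cond := by
    refine le_trans ?_ (Nat.cast_le.2 (base_le_cond hd))
    have h5 : 1 ≤ C.denProd := denProd_pos
    have h6 : 1 ≤ C.growthProd := growthProd_pos
    have h7 : d * C.growthProd + 1 ≤ C.base := by
      have e1 : C.growthProd ≤ C.denProd * C.growthProd := Nat.le_mul_of_pos_left _ h5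
      have e2 : d * C.growthProd ≤ d * (C.denProd * C.growthProd) := Nat.mul_le_mul_left _ e1
      have e3 : 1 ≤ d * (C.denProd * C.growthProd) := Nat.mul_pos hd (Nat.mul_pos h5 h6)
      rw [base, mul_assoc]
      omega
    exact_mod_cast h7
  calc |(C.eval x i - x i) - (C.eval y i - y i)|
      = |(C.eval x i - C.eval y i) - (x i - y i)| := by congr 1; ring
    _ ≤ |C.eval x i - C.eval y i| + |x i - y i| := abs_sub _ _
    _ ≤ (d * C.growthProd + 1) * ‖x - y‖ := by linarith
    _ ≤ _ := mul_le_mul_of_nonneg_right h4 (norm_nonneg _)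

theorem IsContraction.eq_of_isFixed (h : C.IsContraction p) {x y : Fin d → ℝ}
    (hx : x ∈ Set.Icc (0 : Fin d → ℝ) 1) (hy : y ∈ Set.Icc (0 : Fin d → ℝ) 1)
    (hfx : C.eval x = x) (hfy : C.eval y = y) : x = y := by
  have := h.norm_sub_le_of_residual (k := 0) hx hy le_rfl (by simp) (by simp [hfx, hfy])
  rw [mul_zero] at this
  exact sub_eq_zero.1 (norm_le_zero_iff.1 this)

theorem IsContraction.exists_isFixed (h : C.IsContraction p) :
    ∃ x ∈ Set.Icc (0 : Fin d → ℝ) 1, C.eval x = x := by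
  obtain ⟨c, hc0, hc1, hc⟩ := h.tailMap
  let G : PiLp p (fun _ : Fin d => ℝ) → PiLp p (fun _ : Fin d => ℝ) :=
    fun z => WithLp.toLp p (C.tailMap 0 (WithLp.ofLp z))
  have hG : ContractingWith c.toNNReal G := by
    refine ⟨by simpa using hc1, LipschitzWith.of_dist_le_mul fun z w => ?_⟩
    rw [dist_eq_norm, dist_eq_norm, Real.coe_toNNReal _ hc0.le]
    exact hc 0 (WithLp.ofLp z) (WithLp.ofLp w)
  have hfix : C.tailMap 0 (WithLp.ofLp (hG.fixedPoint G)) = WithLp.ofLp (hG.fixedPoint G) :=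
    congrArg WithLp.ofLp (show G (hG.fixedPoint G) = hG.fixedPoint G from hG.fixedPoint_isFixedPt)
  generalize WithLp.ofLp (hG.fixedPoint G) = x at hfix
  -- The fixpoint of the extended map is a value of `f` on the cube, so it lies in the cube and
  -- clamping does not move it.
  have hfix' : C.eval (clamp x) = x := by
    rw [← hfix]
    funext i
    simp [LinearFIXPCircuit.tailMap, hfix]
  have hx : x ∈ Set.Icc (0 : Fin d → ℝ) 1 := by
    rw [← hfix']
    exact h.1 (clamp_mem x)
  exact ⟨x, hx, by rwa [clamp_of_mem hx] at hfix'⟩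

/-- The fixpoint solves `(1 - A) x = b` for one piece; by Cramer's rule the integer determinant of
`D (1 - A)` is a common denominator of the coordinates. -/
theorem IsContraction.exists_rat (h : C.IsContraction p) {x : Fin d → ℝ}
    (hx : x ∈ Set.Icc (0 : Fin d → ℝ) 1) (hfx : C.eval x = x) (i : Fin d) :
    ∃ (a : ℤ) (q : ℕ), 0 < q ∧ q ≤ C.base ^ d ∧ x i * q = a := by
  obtain ⟨P, hP, hPx⟩ := (h.isPiecewise 0).2 x
  have hfix : x - P.1.mulVec x = P.2 := by
    have : C.tailMap 0 x = x := by
      funext i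
      simp [LinearFIXPCircuit.tailMap, clamp_of_mem hx, hfx]
    rw [this] at hPx
    nth_rewrite 1 [hPx]
    abel
  obtain ⟨N, h0, hle, -, hmap⟩ := exists_int_matrix hP.1 growthProd_pos hP.2.2 denProd_pos
  have hdet := det_mul_apply_eq hmap x i
  choose n hn using fun j => (hP.2.1 j).1
  have key : (N.det : ℝ) * x i = ((∑ j, N.adjugate i j * n j : ℤ) : ℝ) := by
    rw [hdet, hfix]
    push_cast
    exact Finset.sum_congr rfl fun j _ => by rw [← hn]; ring
  refine ⟨N.det.sign * ∑ j, N.adjugate i j * n j, N.det.natAbs, Int.natAbs_pos.2 h0, ?_, ?_⟩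
  · have : (N.det.natAbs : ℤ) ≤ (C.base : ℤ) ^ d := by
      rw [Int.natCast_natAbs]
      simpa [base] using hle
    exact_mod_cast this
  · have : ((N.det.natAbs : ℤ) : ℝ) = N.det.sign * N.det := by
      exact_mod_cast (Int.sign_mul_self_eq_natAbs N.det).symm
    rw [Int.cast_mul, ← key, ← Int.cast_natCast, this]
    ring

end Contraction

end LinearFIXPCircuit

/-! ### Nested bisection -/

/-- A map of the cube to itself whose residual `f - id` is `Λ`-Lipschitz, and whose restrictions to
the slices obtained by freezing the first `k` coordinates have residuals with `Λ`-Lipschitz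
inverse. -/
structure IsConditioned {d : ℕ} (f : (Fin d → ℝ) → Fin d → ℝ) (Λ : ℝ) : Prop where
  one_le : 1 ≤ Λ
  mapsTo : Set.MapsTo f (Set.Icc 0 1) (Set.Icc 0 1)
  norm_sub_le : ∀ (k : ℕ) (x y : Fin d → ℝ), x ∈ Set.Icc (0 : Fin d → ℝ) 1 →
    y ∈ Set.Icc (0 : Fin d → ℝ) 1 → ∀ δ : ℝ, 0 ≤ δ → (∀ i : Fin d, i < k → x i = y i) →
    (∀ i : Fin d, k ≤ i → |(f x i - x i) - (f y i - y i)| ≤ δ) → ‖x - y‖ ≤ Λ * δ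
  abs_residual_sub_le : ∀ x y : Fin d → ℝ, x ∈ Set.Icc (0 : Fin d → ℝ) 1 →
    y ∈ Set.Icc (0 : Fin d → ℝ) 1 → ∀ i, |(f x i - x i) - (f y i - y i)| ≤ Λ * ‖x - y‖

theorem LinearFIXPCircuit.IsContraction.isConditioned {d : ℕ} {C : LinearFIXPCircuit d} {p : ℝ≥0∞}
    [Fact (1 ≤ p)] (h : C.IsContraction p) (hd : 1 ≤ d) : IsConditioned C.eval (C.cond : ℝ) where
  one_le := by exact_mod_cast (one_le_base hd).trans (base_le_cond hd)
  mapsTo := h.1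
  norm_sub_le _ _ _ hx hy _ hδ h1 h2 := h.norm_sub_le_of_residual hx hy hδ h1 h2
  abs_residual_sub_le _ _ hx hy i := h.norm_residual_sub_le hd hx hy i

namespace IsConditioned

variable {d : ℕ} {f : (Fin d → ℝ) → Fin d → ℝ} {Λ : ℝ}

theorem norm_sub_update_le (x : Fin d → ℝ) (k : Fin d) (a : ℝ) :
    ‖x - Function.update x k a‖ ≤ |x k - a| := by
  refine (pi_norm_le_iff_of_nonneg (abs_nonneg _)).2 fun i => ?_
  rcases eq_or_ne i k with rfl | h
  · simp
  · simp [h]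

theorem update_mem {x : Fin d → ℝ} (hx : x ∈ Set.Icc (0 : Fin d → ℝ) 1) (k : Fin d) {a : ℝ}
    (h0 : 0 ≤ a) (h1 : a ≤ 1) : Function.update x k a ∈ Set.Icc (0 : Fin d → ℝ) 1 := by
  constructor <;> intro i <;> rcases eq_or_ne i k with rfl | h
  · simpa using h0
  · simpa [h] using hx.1 i
  · simpa using h1
  · simpa [h] using hx.2 i

/-- A lower bound for the residual at the end of a bisection. -/
theorem le_residual (hf : IsConditioned f Λ) {k : Fin d} {x : Fin d → ℝ}
    (hx : x ∈ Set.Icc (0 : Fin d → ℝ) 1) {ρ : ℝ} (hρ : 0 ≤ ρ)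
    (hres : ∀ i, k < i → |f x i - x i| ≤ ρ)
    (hlow : x k = 0 ∨ ∃ y ∈ Set.Icc (0 : Fin d → ℝ) 1, (∀ i < k, y i = x i) ∧ y k = x k ∧
      (∀ i, k < i → |f y i - y i| ≤ ρ) ∧ 0 ≤ f y k - y k) :
    -(2 * Λ ^ 2 * ρ) ≤ f x k - x k := by
  have hΛ := hf.one_le
  rcases hlow with h | ⟨y, hy, hyx, hyk, hyres, hpos⟩
  · have h1 : 0 ≤ f x k := (hf.mapsTo hx).1 k
    have : 0 ≤ 2 * Λ ^ 2 * ρ := by positivity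
    linarith
  -- The two points agree up to coordinate `k` and are almost fixed above it, so conditioning of the
  -- slice makes them close. The residual at `x` then differs little from the one at `y`.
  · have h1 := hf.norm_sub_le (k + 1) x y hx hy (2 * ρ) (by positivity) (fun i hi => ?_)
      fun i hi => ?_
    · have h2 := hf.abs_residual_sub_le x y hx hy k
      have h3 : Λ * ‖x - y‖ ≤ Λ * (Λ * (2 * ρ)) := mul_le_mul_of_nonneg_left h1 (by linarith)
      have h4 := (abs_le.1 (h2.trans h3)).1
      nlinarith
    · rcases (Nat.lt_succ_iff_lt_or_eq.1 hi) with h | h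
      · exact (hyx i h).symm
      · rw [Fin.ext h, hyk]
    · have hi' : k < i := hi
      refine (abs_sub _ _).trans ?_
      linarith [hres i hi', hyres i hi']

/-- An upper bound for the residual at the end of a bisection. -/
theorem residual_le (hf : IsConditioned f Λ) {k : Fin d} {x : Fin d → ℝ}
    (hx : x ∈ Set.Icc (0 : Fin d → ℝ) 1) {ρ η : ℝ} (hρ : 0 ≤ ρ) (hη : 0 ≤ η)
    (hres : ∀ i, k < i → |f x i - x i| ≤ ρ)
    (hupp : x k + η = 1 ∨ ∃ y ∈ Set.Icc (0 : Fin d → ℝ) 1, (∀ i < k, y i = x i) ∧ y k = x k + η ∧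
      (∀ i, k < i → |f y i - y i| ≤ ρ) ∧ f y k - y k ≤ 0) :
    f x k - x k ≤ 2 * Λ ^ 2 * ρ + 2 * Λ ^ 3 * η := by
  have hΛ := hf.one_le
  have hpow : Λ * η ≤ Λ ^ 3 * η := by
    have : Λ ≤ Λ ^ 3 := le_self_pow₀ hΛ (by norm_num)
    gcongr
  have hp0 : 0 ≤ 2 * Λ ^ 2 * ρ := by positivity
  have hp1 : 0 ≤ Λ ^ 3 * η := by positivity
  rcases hupp with h | ⟨y, hy, hyx, hyk, hyres, hneg⟩
  -- At the upper face the residual cannot be positive because `f` stays in the cube; `x` is within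
  -- `η` of that face.
  · have hz := update_mem hx k zero_le_one le_rfl
    have h1 := hf.abs_residual_sub_le x _ hx hz k
    have h2 : f (Function.update x k 1) k ≤ 1 := (hf.mapsTo hz).2 k
    have h3 := norm_sub_update_le x k 1
    rw [show x k - 1 = -η by linarith, abs_neg, abs_of_nonneg hη] at h3
    have h4 : Λ * ‖x - Function.update x k 1‖ ≤ Λ * η :=
      mul_le_mul_of_nonneg_left h3 (by linarith)
    have h5 := (abs_le.1 (h1.trans h4)).2
    rw [Function.update_self] at h5
    linarith
  · have h0 : 0 ≤ x k := hx.1 k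
    have h1 : x k ≤ 1 := hx.2 k
    have hz := update_mem hy k h0 h1
    -- Moving `y` by `η` puts it in the slice of `x`; it costs `Λ η` in each residual. Conditioning
    -- compares `x` with `z`, and `z` is compared with `y` directly.
    set z := Function.update y k (x k) with hzdef
    have hyz : ‖y - z‖ ≤ η := by
      refine (norm_sub_update_le y k (x k)).trans ?_
      rw [hyk, add_sub_cancel_left, abs_of_nonneg hη]
    have hLyz : Λ * ‖y - z‖ ≤ Λ * η := mul_le_mul_of_nonneg_left hyz (by linarith)
    have h2 := hf.norm_sub_le (k + 1) x z hx hz (2 * ρ + Λ * η) (by positivity) (fun i hi => ?_)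
      fun i hi => ?_
    · have h3 : ‖x - y‖ ≤ Λ * (2 * ρ + Λ * η) + η := by
        calc ‖x - y‖ = ‖(x - z) - (y - z)‖ := by congr 1; abel
          _ ≤ ‖x - z‖ + ‖y - z‖ := _root_.norm_sub_le _ _
          _ ≤ _ := add_le_add h2 hyz
      have h4 := (abs_le.1 ((hf.abs_residual_sub_le x y hx hy k).trans
        (mul_le_mul_of_nonneg_left h3 (by linarith)))).2
      nlinarith
    · rcases (Nat.lt_succ_iff_lt_or_eq.1 hi) with h | h
      · rw [hzdef, Function.update_of_ne (Fin.ne_of_lt h)]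
        exact (hyx i h).symm
      · rw [Fin.ext h, hzdef, Function.update_self]
    · have hi' : k < i := hi
      have h3 := (hf.abs_residual_sub_le y z hy hz i).trans hLyz
      have h4 := abs_le.1 (hres i hi')
      have h5 := abs_le.1 (hyres i hi')
      have h6 := abs_le.1 h3
      rw [abs_le]
      constructor <;> linarith [h4.1, h4.2, h5.1, h5.2, h6.1, h6.2]

end IsConditioned

namespace Bisection

/-- Positions and step widths of all coordinates. -/
abbrev State := (ℕ → ℤ) × (ℕ → ℤ)

open Classical in
/-- Accept or reject the position of coordinate `i`, and go on with half the step width. -/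
noncomputable def choose (r : ℕ → Prop) (i : ℕ) (s : State) : State :=
  (Function.update s.1 i ((if r i then s.1 i - s.2 i else s.1 i) + s.2 i / 2),
    Function.update s.2 i (s.2 i / 2))

/-- Start the bisection of coordinate `i` afresh. -/
def reset (H : ℤ) (i : ℕ) (s : State) : State :=
  (Function.update s.1 i H, Function.update s.2 i H)

/-- Reset the finished coordinates below `e`, from the last one on, down to the first unfinished
one, and advance that one. -/
noncomputable def carry (H : ℤ) (r : ℕ → Prop) : ℕ → State → State
  | 0, s => s
  | i + 1, s => if 0 < s.2 i then choose r i s else carry H r i (reset H i s)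

/-- The step width `w` fits around the position `t`. -/
def InRange (M t w : ℤ) : Prop := 0 ≤ w ∧ w ≤ t ∧ t + w ≤ M ∧ t < M

theorem InRange.choose {M t w : ℤ} (h : InRange M t w) : InRange M (t + w / 2) (w / 2) ∧
    InRange M (t - w + w / 2) (w / 2) := by
  obtain ⟨h1, h2, h3, h4⟩ := h
  refine ⟨⟨?_, ?_, ?_, ?_⟩, ⟨?_, ?_, ?_, ?_⟩⟩ <;> omega

theorem carry_inRange {H M : ℤ} (hH : 0 < H) (hM : H + H ≤ M) (r : ℕ → Prop) {d : ℕ} (e : ℕ)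
    {s : State} (h : ∀ i < d, InRange M (s.1 i) (s.2 i)) :
    ∀ i < d, InRange M ((carry H r e s).1 i) ((carry H r e s).2 i) := by
  induction e generalizing s with
  | zero => exact h
  | succ e ih =>
    rw [carry]
    split_ifs
    · intro i hi
      rcases eq_or_ne i e with rfl | hne
      · simp only [Bisection.choose, Function.update_self]
        split_ifs
        exacts [(h i hi).choose.2, (h i hi).choose.1]
      · simpa [Bisection.choose, hne] using h i hi
    · refine ih fun i hi => ?_
      rcases eq_or_ne i e with rfl | hne
      · simpa [reset] using ⟨hH.le, le_rfl, hM, by omega⟩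
      · simpa [reset, hne] using h i hi

-- The coordinates work as an odometer. Here `k` is the last unfinished one: it moves, everything
-- above it restarts, everything below it waits.
open Classical in
theorem carry_spec {H : ℤ} {r : ℕ → Prop} {k e : ℕ} {s : State} (hk : k < e) (hpos : 0 < s.2 k)
    (hfin : ∀ i, k < i → i < e → s.2 i = 0) :
    (∀ i, i < k → (carry H r e s).1 i = s.1 i ∧ (carry H r e s).2 i = s.2 i) ∧
    (carry H r e s).1 k = (if r k then s.1 k - s.2 k else s.1 k) + s.2 k / 2 ∧
    (carry H r e s).2 k = s.2 k / 2 ∧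
    (∀ i, k < i → i < e → (carry H r e s).1 i = H ∧ (carry H r e s).2 i = H) ∧
    ∀ i, e ≤ i → (carry H r e s).1 i = s.1 i ∧ (carry H r e s).2 i = s.2 i := by
  induction e generalizing s with
  | zero => omega
  | succ e ih =>
    rw [carry]
    rcases Nat.lt_succ_iff_lt_or_eq.1 hk with h | rfl
    · rw [if_neg (by rw [hfin e h (by omega)]; exact lt_irrefl 0)]
      obtain ⟨h1, h2, h3, h4, h5⟩ := ih (s := reset H e s) h
        (by simpa [reset, h.ne] using hpos) fun i hi hie => by
          simpa [reset, hie.ne] using hfin i hi (by omega)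
      simp only [reset] at h1 h2 h3 h4 h5 ⊢
      refine ⟨fun i hi => ?_, ?_, ?_, fun i hi hie => ?_, fun i hi => ?_⟩
      · simpa [(hi.trans h).ne] using h1 i hi
      · simpa [h.ne] using h2
      · simpa [h.ne] using h3
      · rcases Nat.lt_succ_iff_lt_or_eq.1 hie with h' | rfl
        · exact h4 i hi h'
        · simpa using h5 i le_rfl
      · have hne : i ≠ e := by omega
        simpa [hne] using h5 i (by omega)
    · rw [if_pos hpos]
      simp only [Bisection.choose]
      refine ⟨fun i hi => ?_, by simp, by simp, fun i hi hie => by omega, fun i hi => ?_⟩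
      · simp [hi.ne]
      · have hne : i ≠ k := by omega
        simp [hne]

variable {d : ℕ}

/-- The point of the cube that belongs to integer positions. -/
noncomputable def point (M : ℤ) (t : ℕ → ℤ) : Fin d → ℝ := fun i => (t i : ℝ) / M

/-- Coordinate `i` of the position is too large. -/
def Rejects (f : (Fin d → ℝ) → Fin d → ℝ) (M : ℤ) (t : ℕ → ℤ) (i : ℕ) : Prop :=
  ∃ hi : i < d, f (point M t) ⟨i, hi⟩ < point M t ⟨i, hi⟩

/-- One step of the nested bisection. -/
noncomputable def tick (f : (Fin d → ℝ) → Fin d → ℝ) (M H : ℤ) (s : State) : State :=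
  carry H (Rejects f M s.1) d s

theorem point_mem {M : ℤ} (hM : 0 < M) {s : State} (h : ∀ i < d, InRange M (s.1 i) (s.2 i)) :
    (point M s.1 : Fin d → ℝ) ∈ Set.Icc (0 : Fin d → ℝ) 1 := by
  have hM' : (0 : ℝ) < M := by exact_mod_cast hM
  constructor <;> intro i <;> obtain ⟨h1, h2, h3, -⟩ := h i i.2
  · have : (0 : ℝ) ≤ s.1 i := by exact_mod_cast h1.trans h2
    exact div_nonneg this hM'.le
  · have : (s.1 i : ℝ) ≤ M := by exact_mod_cast (show s.1 i ≤ M by omega)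
    exact (div_le_one hM').2 this

/-- All trial points stay in the cube and the stored positions stay bounded. The strict inequality
`t < M` inside `InRange` is what the Euclidean algorithm later needs for its start. -/
theorem iterate_tick_inRange (f : (Fin d → ℝ) → Fin d → ℝ) {H M : ℤ} (hH : 0 < H) (hM : H + H ≤ M)
    {s : State} (h : ∀ i < d, InRange M (s.1 i) (s.2 i)) (n : ℕ) :
    ∀ i < d, InRange M (((tick f M H)^[n] s).1 i) (((tick f M H)^[n] s).2 i) := by
  induction n with
  | zero => exact h
  | succ n ih =>
    rw [Function.iterate_succ_apply']
    exact carry_inRange hH hM _ _ ih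

/-- Induction on the number `l` of free coordinates. Bisecting coordinate `k` alternates complete
inner runs, which almost fix the later coordinates, with single ticks that move `k`. The inner
tolerance `ρ` and the final bracket width together cost one more factor `4 Λ ^ 3`. -/
theorem iterate_tick_spec {f : (Fin d → ℝ) → Fin d → ℝ} {Λ : ℝ} (hf : IsConditioned f Λ) (n : ℕ)
    (l k : ℕ) (hl : l + k = d) (s : State)
    (hr : ∀ i < d, InRange (2 ^ (n + 1)) (s.1 i) (s.2 i))
    (hs : ∀ i, k ≤ i → i < d → s.1 i = 2 ^ n ∧ s.2 i = 2 ^ n) :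
    (∀ i < k, ((tick f (2 ^ (n + 1)) (2 ^ n))^[(n + 2) ^ l - 1] s).1 i = s.1 i ∧
      ((tick f (2 ^ (n + 1)) (2 ^ n))^[(n + 2) ^ l - 1] s).2 i = s.2 i) ∧
    ∀ i : Fin d, k ≤ i → ((tick f (2 ^ (n + 1)) (2 ^ n))^[(n + 2) ^ l - 1] s).2 i = 0 ∧
      |f (point (2 ^ (n + 1)) ((tick f (2 ^ (n + 1)) (2 ^ n))^[(n + 2) ^ l - 1] s).1) i -
        point (2 ^ (n + 1)) ((tick f (2 ^ (n + 1)) (2 ^ n))^[(n + 2) ^ l - 1] s).1 i| ≤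
      (4 * Λ ^ 3) ^ l / 2 ^ (n + 1) := by
  induction l generalizing k s with
  | zero =>
    refine ⟨fun i _ => by simp, fun i hi => ?_⟩
    have := i.2
    omega
  | succ l ih =>
    have hkd : k < d := by omega
    set M : ℤ := 2 ^ (n + 1) with hM
    set H : ℤ := 2 ^ n with hH
    have hH0 : 0 < H := by positivity
    have hM0 : 0 < M := by positivity
    have hHM : H + H ≤ M := by rw [hM, hH, pow_succ]; omega
    have hMr : (M : ℝ) = 2 ^ (n + 1) := by simp [hM]
    have hMr0 : (0 : ℝ) < M := by exact_mod_cast hM0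
    set ρ : ℝ := (4 * Λ ^ 3) ^ l / 2 ^ (n + 1) with hρ
    have hΛ := hf.one_le
    have hρ0 : 0 ≤ ρ := by positivity
    have hτ : 0 < (n + 2) ^ l := by positivity
    set τ := (n + 2) ^ l - 1 with hτdef
    -- After `e` rounds the bracket for coordinate `k` has lower end `t - w` and width `2 ^ (n + 1 -
    -- e)`, in units of `1 / M`. Each end is a face of the cube or carries an earlier trial point,
    -- almost fixed above `k`, with residual of the sign pointing into the bracket. A round is one
    -- tick for `k` and `τ` inner ticks.
    have rounds : ∀ e ≤ n + 1, ∃ s', s' = (tick f M H)^[τ + e * (1 + τ)] s ∧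
        (∀ i < k, s'.1 i = s.1 i ∧ s'.2 i = s.2 i) ∧
        (∀ i : Fin d, k < i → s'.2 i = 0 ∧ |f (point M s'.1) i - point M s'.1 i| ≤ ρ) ∧
        s'.2 k = H / 2 ^ e ∧
        (s'.1 k - s'.2 k = 0 ∨ ∃ y ∈ Set.Icc (0 : Fin d → ℝ) 1,
          (∀ i : Fin d, i < k → y i = point M s.1 i) ∧
          y ⟨k, hkd⟩ = ((s'.1 k - s'.2 k : ℤ) : ℝ) / M ∧
          (∀ i : Fin d, k < i → |f y i - y i| ≤ ρ) ∧ 0 ≤ f y ⟨k, hkd⟩ - y ⟨k, hkd⟩) ∧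
        (s'.1 k - s'.2 k + 2 ^ (n + 1 - e) = M ∨ ∃ y ∈ Set.Icc (0 : Fin d → ℝ) 1,
          (∀ i : Fin d, i < k → y i = point M s.1 i) ∧
          y ⟨k, hkd⟩ = ((s'.1 k - s'.2 k + 2 ^ (n + 1 - e) : ℤ) : ℝ) / M ∧
          (∀ i : Fin d, k < i → |f y i - y i| ≤ ρ) ∧ f y ⟨k, hkd⟩ - y ⟨k, hkd⟩ ≤ 0) := by
      intro e
      induction e with
      | zero =>
        intro _
        obtain ⟨h1, h2⟩ := ih (k + 1) (by omega) s hr fun i hi hid => hs i (by omega) hid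
        refine ⟨_, rfl, ?_⟩
        rw [zero_mul, add_zero]
        set s' := (tick f M H)^[τ] s
        obtain ⟨hk1, hk2⟩ := h1 k (by omega)
        obtain ⟨hk3, hk4⟩ := hs k le_rfl hkd
        refine ⟨fun i hi => h1 i (by omega), fun i hi => h2 i hi, ?_, Or.inl ?_, Or.inl ?_⟩
        · rw [hk2, hk4]
          simp
        · rw [hk1, hk2, hk3, hk4, sub_self]
        · rw [hk1, hk2, hk3, hk4, sub_self]
          simp [hM]
      | succ e ihe =>
        intro he
        obtain ⟨s', hs', hlow, hhigh, hw, hlo, hhi⟩ := ihe (by omega)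
        have hr' : ∀ i < d, InRange M (s'.1 i) (s'.2 i) := by
          rw [hs']
          exact iterate_tick_inRange f hH0 hHM hr _
        have hw' : s'.2 k = 2 ^ (n - e) := by
          rw [hw, hH, Int.ediv_eq_of_eq_mul_left (by positivity)]
          rw [← pow_add]
          congr 1
          omega
        have hpos : 0 < s'.2 k := by rw [hw']; positivity
        obtain ⟨c1, c2, c3, c4, -⟩ := carry_spec (H := H) (r := Rejects f M s'.1) hkd hpos
          fun i hi hid => (hhigh ⟨i, hid⟩ hi).1
        set s₁ := tick f M H s' with hs₁
        change ∀ i, i < k → s₁.1 i = s'.1 i ∧ s₁.2 i = s'.2 i at c1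
        change s₁.1 k = _ at c2
        change s₁.2 k = _ at c3
        change ∀ i, k < i → i < d → s₁.1 i = H ∧ s₁.2 i = H at c4
        have hr₁ : ∀ i < d, InRange M (s₁.1 i) (s₁.2 i) :=
          iterate_tick_inRange f hH0 hHM hr' 1
        obtain ⟨h1, h2⟩ := ih (k + 1) (by omega) s₁ hr₁ fun i hi hid => c4 i hi hid
        refine ⟨_, rfl, ?_⟩
        rw [show τ + (e + 1) * (1 + τ) = (τ + 1) + (τ + e * (1 + τ)) by ring,
          Function.iterate_add_apply, ← hs', Function.iterate_succ_apply, ← hs₁]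
        set s₂ := (tick f M H)^[τ] s₁
        obtain ⟨hk1, hk2⟩ := h1 k (by omega)
        have hx' := point_mem hM0 hr'
        have hxlow : ∀ i : Fin d, i < k → point M s'.1 i = point M s.1 i := by
          intro i hi
          simp only [point, (hlow i hi).1]
        -- While the step is positive the width is twice the step, so the trial position is the
        -- midpoint of the bracket.
        have hwhalf : (2 : ℤ) ^ (n + 1 - e) = s'.2 k + s'.2 k := by
          rw [hw', show n + 1 - e = n - e + 1 by omega, pow_succ]
          ring
        have hwnext : (2 : ℤ) ^ (n + 1 - (e + 1)) = s'.2 k := by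
          rw [hw', show n + 1 - (e + 1) = n - e by omega]
        rw [hk1, hk2, c2, c3, hwnext]
        refine ⟨fun i hi => ?_, fun i hi => h2 i hi, ?_, ?_⟩
        · rw [(h1 i (by omega)).1, (h1 i (by omega)).2, (c1 i hi).1, (c1 i hi).2]
          exact hlow i hi
        · rw [hw, pow_succ, Int.ediv_ediv_of_nonneg (by positivity)]
        · rw [hwhalf] at hhi
          -- The current trial point becomes the witness of the upper end if rejected and of the
          -- lower end otherwise; the other witness is kept.
          by_cases hrej : Rejects f M s'.1 k
          · rw [if_pos hrej, add_sub_cancel_right]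
            refine ⟨hlo, Or.inr ⟨_, hx', hxlow, ?_, fun i hi => (hhigh i hi).2, ?_⟩⟩
            · rw [sub_add_cancel]
              rfl
            · obtain ⟨_, h⟩ := hrej
              linarith
          · rw [if_neg hrej, add_sub_cancel_right]
            refine ⟨Or.inr ⟨_, hx', hxlow, rfl, fun i hi => (hhigh i hi).2, ?_⟩, ?_⟩
            · have : ¬ f (point M s'.1) ⟨k, hkd⟩ < point M s'.1 ⟨k, hkd⟩ :=
                fun h => hrej ⟨hkd, h⟩
              linarith
            · rwa [show s'.1 k - s'.2 k + (s'.2 k + s'.2 k) = s'.1 k + s'.2 k by ring] at hhi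
    obtain ⟨s', hs', hlow, hhigh, hw, hlo, hhi⟩ := rounds (n + 1) le_rfl
    -- One initial inner run and `n + 1` rounds: the number of ticks plus one is multiplied by `n +
    -- 2`.
    have hcount : τ + (n + 1) * (1 + τ) = (n + 2) ^ (l + 1) - 1 := by
      have : (n + 2) ^ l = τ + 1 := by omega
      rw [pow_succ, this]
      have e : (τ + 1) * (n + 2) = τ + (n + 1) * (1 + τ) + 1 := by ring
      omega
    rw [hcount] at hs'
    rw [← hs']
    have hr' : ∀ i < d, InRange M (s'.1 i) (s'.2 i) := by
      rw [hs']
      exact iterate_tick_inRange f hH0 hHM hr _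
    have hx' : (point M s'.1 : Fin d → ℝ) ∈ _ := point_mem hM0 hr'
    -- The last halving sends step `1` to `0`, so the position is now the lower end itself and the
    -- bracket has width one unit.
    have hw0 : s'.2 k = 0 := by
      rw [hw]
      exact Int.ediv_eq_zero_of_lt hH0.le (pow_lt_pow_right₀ (by norm_num) (by omega))
    rw [hw0, sub_zero] at hlo hhi
    simp only [Nat.sub_self, pow_zero] at hhi
    have hxlow : ∀ i : Fin d, i < k → point M s'.1 i = point M s.1 i := by
      intro i hi
      simp only [point, (hlow i hi).1]
    refine ⟨hlow, fun i hi => ?_⟩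
    -- Both summands are at most `2 Λ ^ 3 ρ`, since `1 ≤ Λ` and the grid width never exceeds the
    -- inner tolerance.
    have hgrow : 2 * Λ ^ 2 * ρ + 2 * Λ ^ 3 * (1 / M) ≤ (4 * Λ ^ 3) ^ (l + 1) / 2 ^ (n + 1) := by
      have e1 : 2 * Λ ^ 2 * ρ ≤ 2 * Λ ^ 3 * ρ := by
        have : Λ ^ 2 ≤ Λ ^ 3 := pow_le_pow_right₀ hΛ (by norm_num)
        gcongr
      have e2 : 1 / (M : ℝ) ≤ ρ := by
        rw [hρ, hMr]
        have : 1 ≤ (4 * Λ ^ 3) ^ l := one_le_pow₀ (by nlinarith [one_le_pow₀ hΛ (n := 3)])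
        gcongr
      have e3 : 2 * Λ ^ 3 * (1 / (M : ℝ)) ≤ 2 * Λ ^ 3 * ρ := by gcongr
      calc _ ≤ 4 * Λ ^ 3 * ρ := by linarith
        _ = _ := by rw [hρ, pow_succ]; ring
    rcases hi.lt_or_eq with h | h
    · refine ⟨(hhigh i h).1, (hhigh i h).2.trans (le_trans ?_ hgrow)⟩
      have : 1 ≤ Λ ^ 2 := one_le_pow₀ hΛ
      have : 0 ≤ 2 * Λ ^ 3 * (1 / (M : ℝ)) := by positivity
      nlinarith
    · have hik : i = ⟨k, hkd⟩ := Fin.ext h.symm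
      refine ⟨by rw [← h]; exact hw0, ?_⟩
      rw [hik]
      have hη : 0 ≤ 1 / (M : ℝ) := by positivity
      have b1 := hf.le_residual (k := ⟨k, hkd⟩) hx' hρ0 (fun i hi => (hhigh i hi).2) ?_
      · have b2 := hf.residual_le (k := ⟨k, hkd⟩) hx' hρ0 hη (fun i hi => (hhigh i hi).2) ?_
        · have : 0 ≤ 2 * Λ ^ 3 * (1 / (M : ℝ)) := by positivity
          rw [abs_le]
          constructor <;> linarith
        · rcases hhi with hhi | ⟨y, hy, h1, h2, h3, h4⟩
          · left
            simp only [point]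
            rw [← add_div, div_eq_one_iff_eq hMr0.ne']
            exact_mod_cast hhi
          · refine Or.inr ⟨y, hy, fun i hi => ?_, ?_, h3, h4⟩
            · rw [h1 i hi, hxlow i hi]
            · rw [h2]
              simp only [point]
              push_cast
              ring
      · rcases hlo with hlo | ⟨y, hy, h1, h2, h3, h4⟩
        · left
          simp [point, hlo]
        · refine Or.inr ⟨y, hy, fun i hi => ?_, ?_, h3, h4⟩
          · rw [h1 i hi, hxlow i hi]
          · rw [h2]
            rfl

/-- The nested bisection approximates the fixpoint. -/
theorem norm_sub_le {f : (Fin d → ℝ) → Fin d → ℝ} {Λ : ℝ} (hf : IsConditioned f Λ) (n : ℕ)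
    {x : Fin d → ℝ} (hx : x ∈ Set.Icc (0 : Fin d → ℝ) 1) (hfx : f x = x) {s : State}
    (hs : ∀ i < d, s.1 i = 2 ^ n ∧ s.2 i = 2 ^ n) :
    ‖point (2 ^ (n + 1)) ((tick f (2 ^ (n + 1)) (2 ^ n))^[(n + 2) ^ d - 1] s).1 - x‖ ≤
      Λ * ((4 * Λ ^ 3) ^ d / 2 ^ (n + 1)) := by
  have hr : ∀ i < d, InRange (2 ^ (n + 1)) (s.1 i) (s.2 i) := by
    intro i hi
    rw [(hs i hi).1, (hs i hi).2]
    exact ⟨by positivity, le_rfl, by rw [pow_succ]; omega, pow_lt_pow_right₀ (by norm_num) (by omega)⟩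
  have h := (iterate_tick_spec hf n d 0 (by omega) s hr fun i _ hi => hs i hi).2
  have hΛ := hf.one_le
  refine hf.norm_sub_le 0 _ _ (point_mem (by positivity)
    (iterate_tick_inRange f (by positivity) (by rw [pow_succ]; omega) hr _)) hx _ (by positivity)
    (by simp) fun i _ => ?_
  rw [hfx, sub_self, sub_zero]
  exact (h i (Nat.zero_le _)).2

end Bisection

/-! ### Rational reconstruction -/

namespace RationalReconstruction

/-- Invariant of the extended Euclidean algorithm on `M` and `n`: `a > b` are successive
remainders, `u` and `v` are the absolute values of the cofactors of `n`. -/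
structure Inv (M n S a b u v : ℤ) : Prop where
  lt : b < a
  nonneg : 0 ≤ b
  large : S < a
  u_nonneg : 0 ≤ u
  v_pos : 0 < v
  u_le : u ≤ v
  cross : a * v + b * u = M
  cofactor : ∃ σ s t : ℤ, (σ = 1 ∨ σ = -1) ∧ n * v - s * M = σ * b ∧ n * u - t * M = -σ * a

theorem Inv.init {M n S : ℤ} (hn : 0 ≤ n) (hnM : n < M) (hS : S < M) : Inv M n S M n 0 1 :=
  ⟨hnM, hn, hS, le_rfl, one_pos, zero_le_one, by ring, 1, 0, 1, Or.inl rfl, by ring, by ring⟩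

theorem Inv.ediv_pos {M n S a b u v : ℤ} (h : Inv M n S a b u v) (hb : 0 < b) : 0 < a / b :=
  Int.le_ediv_of_mul_le hb (by linarith [h.lt])

theorem Inv.step {M n S a b u v : ℤ} (h : Inv M n S a b u v) (hS : 0 ≤ S) (hb : S < b) :
    Inv M n S b (a - a / b * b) v (u + a / b * v) := by
  have hb0 : 0 < b := by omega
  have hq : 0 < a / b := h.ediv_pos hb0
  have hmod : a - a / b * b = a % b := by
    have := Int.mul_ediv_add_emod a b
    linarith
  have hqv : v ≤ a / b * v := by nlinarith [h.v_pos]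
  have hu := h.u_nonneg
  have hv := h.v_pos
  refine ⟨?_, ?_, hb, hv.le, by omega, by omega, ?_, ?_⟩
  · rw [hmod]; exact Int.emod_lt_of_pos a hb0
  · rw [hmod]; exact Int.emod_nonneg a hb0.ne'
  · rw [← h.cross]; ring
  · obtain ⟨σ, s, t, hσ, h1, h2⟩ := h.cofactor
    refine ⟨-σ, t + a / b * s, s, by rcases hσ with rfl | rfl <;> simp, ?_, ?_⟩
    · linear_combination h2 + a / b * h1
    · linear_combination h1

/-- In `a v + b u = M` no term is negative, so no intermediate number of the algorithm outgrows `M`.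
-/
theorem Inv.bounds {M n S a b u v : ℤ} (h : Inv M n S a b u v) :
    0 ≤ a ∧ a ≤ M ∧ b ≤ M ∧ u ≤ M ∧ v ≤ M := by
  have h1 := h.lt
  have h2 := h.nonneg
  have h3 := h.v_pos
  have h4 := h.u_nonneg
  have h5 := h.cross
  have h6 : 0 ≤ b * u := by positivity
  have h7 := h.u_le
  have h8 : a ≤ a * v := by nlinarith
  have h9 : v ≤ a * v := by nlinarith
  refine ⟨?_, ?_, ?_, ?_, ?_⟩ <;> linarith

/-- The product of successive remainders at least halves, which bounds the number of divisions by a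
bit length. -/
theorem Inv.two_mul_le {M n S a b u v : ℤ} (h : Inv M n S a b u v) (hb : 0 < b) :
    2 * (b * (a - a / b * b)) ≤ a * b := by
  have hq := h.ediv_pos hb
  have hmod : a - a / b * b = a % b := by
    have := Int.mul_ediv_add_emod a b
    linarith
  have h1 : a - a / b * b < b := by rw [hmod]; exact Int.emod_lt_of_pos a hb
  have h2 : b ≤ a / b * b := by nlinarith
  nlinarith

/-- When the extended Euclidean algorithm passes the threshold, the cofactor is a denominator. -/
theorem Inv.mul_eq {M n S a b u v : ℤ} (h : Inv M n S a b u v) (hb : b ≤ S) {x : ℝ} {p q : ℤ}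
    (hq : 0 < q) (hx : x * q = p) {R : ℝ} (hR : |(n : ℝ) - x * M| * q ≤ R) (hRS : 2 * R ≤ S)
    (hSM : 2 * (S * q) < M) : x * v = ((2 * n * v + M) / (2 * M) : ℤ) := by
  obtain ⟨σ, s, t, hσ, h1, -⟩ := h.cofactor
  have hv := h.v_pos
  have hb0 := h.nonneg
  have hS : 0 ≤ S := hb0.trans hb
  have hM : 0 < M := by nlinarith [mul_nonneg hS hq.le]
  have hvS : S * v < M := by
    have h2 := h.cross
    have h3 : 0 ≤ b * u := mul_nonneg hb0 h.u_nonneg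
    have h4 := h.large
    nlinarith
  have hbq : 2 * (q * b) < M := by nlinarith
  have hqR : (0 : ℝ) < q := by exact_mod_cast hq
  have hvR : (0 : ℝ) < v := by exact_mod_cast hv
  have hMR : (0 : ℝ) < M := by exact_mod_cast hM
  -- This integer times `M` splits into an approximation error and a remainder term. The first is
  -- below `M / 2` because `S v < M`, the second because the remainder is at most `S` while `2 S q <
  -- M`; hence the integer vanishes.
  have hD : p * v - s * q = 0 := by
    have e : (M : ℝ) * (p * v - s * q) = v * (q * (x * M - n)) + q * (σ * b) := by
      have h1' : (n : ℝ) * v - s * M = σ * b := by exact_mod_cast h1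
      rw [← hx, ← h1']
      ring
    have b1 : |v * (q * (x * M - n))| * 2 < M := by
      rw [abs_mul, abs_mul, abs_of_pos hvR, abs_of_pos hqR, abs_sub_comm]
      have h5 : ((S * v : ℤ) : ℝ) < M := by exact_mod_cast hvS
      push_cast at h5
      nlinarith
    have b2 : |(q : ℝ) * (σ * b)| * 2 < M := by
      have h5 : ((2 * (q * b) : ℤ) : ℝ) < M := by exact_mod_cast hbq
      have h6 : |(σ : ℝ)| = 1 := by rcases hσ with rfl | rfl <;> simp
      have h7 : (0 : ℝ) ≤ b := by exact_mod_cast hb0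
      rw [abs_mul, abs_mul, h6, abs_of_pos hqR, abs_of_nonneg h7]
      push_cast at h5
      linarith
    have b3 : |(M : ℝ) * (p * v - s * q)| < M := by
      rw [e]
      refine (abs_add_le _ _).trans_lt ?_
      linarith
    rw [abs_mul, abs_of_pos hMR] at b3
    have b4 : |((p * v - s * q : ℤ) : ℝ)| < 1 := by
      push_cast
      by_contra hcon
      push Not at hcon
      nlinarith
    have b5 : |p * v - s * q| < 1 := by exact_mod_cast b4
    exact Int.abs_lt_one_iff.1 b5
  -- The quotient rounds `n v / M` to the nearest integer, and this number differs from `s` by `b /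
  -- M < 1 / 2`.
  have hs : (2 * n * v + M) / (2 * M) = s := by
    rw [Int.ediv_eq_iff_of_pos (by omega)]
    have h2b : 2 * b < M := by nlinarith
    rcases hσ with rfl | rfl <;> constructor <;> nlinarith
  rw [hs]
  have hD' : (p : ℝ) * v = s * q := by exact_mod_cast sub_eq_zero.1 hD
  rw [← hx] at hD'
  have : (x * v) * q = s * q := by linarith
  exact mul_right_cancel₀ hqR.ne' this

end RationalReconstruction

/-! ### Programs with bounded memory -/

namespace RAM

theorem len_add_le (a b : ℤ) : len (a + b) ≤ len a + len b := by
  have h1 : (a + b).natAbs < 2 ^ (max a.natAbs.size b.natAbs.size + 1) := by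
    have ha : a.natAbs < 2 ^ max a.natAbs.size b.natAbs.size :=
      (Nat.lt_size_self _).trans_le (Nat.pow_le_pow_right two_pos (le_max_left _ _))
    have hb : b.natAbs < 2 ^ max a.natAbs.size b.natAbs.size :=
      (Nat.lt_size_self _).trans_le (Nat.pow_le_pow_right two_pos (le_max_right _ _))
    have := Int.natAbs_add_le a b
    rw [pow_succ]
    omega
  have := Nat.size_le.2 h1
  simp only [len]
  omega

theorem len_neg (a : ℤ) : len (-a) = len a := by simp [len]

theorem len_sub_le (a b : ℤ) : len (a - b) ≤ len a + len b := by
  rw [sub_eq_add_neg, ← len_neg b]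
  exact len_add_le _ _

theorem len_mul_le (a b : ℤ) : len (a * b) ≤ len a + len b := by
  have h1 : (a * b).natAbs < 2 ^ (a.natAbs.size + b.natAbs.size) := by
    rw [Int.natAbs_mul, pow_add]
    exact Nat.mul_lt_mul'' (Nat.lt_size_self _) (Nat.lt_size_self _)
  have := Nat.size_le.2 h1
  simp only [len]
  omega

theorem len_div_le (a b : ℤ) : len (a / b) ≤ len a + len b := by
  have := Nat.size_le_size (Int.natAbs_ediv_le_natAbs a b)
  simp only [len]
  omega

namespace Expr

/-- Bounds the length of the value, relative to the length of the memory cells. -/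
def valWeight : Expr → ℕ
  | const n => len n
  | read _ e => valWeight e + 1
  | add e₁ e₂ => valWeight e₁ + valWeight e₂
  | sub e₁ e₂ => valWeight e₁ + valWeight e₂
  | mul e₁ e₂ => valWeight e₁ + valWeight e₂
  | div e₁ e₂ => valWeight e₁ + valWeight e₂

/-- Bounds the cost of the evaluation, relative to the length of the memory cells. -/
def costWeight : Expr → ℕ
  | const n => len n
  | read _ e => costWeight e + valWeight e + 1
  | add e₁ e₂ => costWeight e₁ + costWeight e₂ + (valWeight e₁ + valWeight e₂)
  | sub e₁ e₂ => costWeight e₁ + costWeight e₂ + (valWeight e₁ + valWeight e₂)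
  | mul e₁ e₂ => costWeight e₁ + costWeight e₂ + (valWeight e₁ + valWeight e₂)
  | div e₁ e₂ => costWeight e₁ + costWeight e₂ + (valWeight e₁ + valWeight e₂)

end Expr

/-- All memory cells have absolute value at most `N`. -/
def Bdd (N : ℕ) (μ : Mem) : Prop := ∀ b i, |μ b i| ≤ N

/-- Length of the numbers of absolute value at most `N`. -/
def lenBound (N : ℕ) : ℕ := N.size + 1

theorem Bdd.len_le {N : ℕ} {μ : Mem} (h : Bdd N μ) (b i : ℕ) : len (μ b i) ≤ lenBound N := by
  have h1 : (μ b i).natAbs ≤ N := by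
    have := h b i
    rw [Int.abs_eq_natAbs] at this
    exact_mod_cast this
  exact Nat.succ_le_succ (Nat.size_le_size h1)

/-- Length is subadditive under all four operations, multiplication and division included. So a
fixed expression yields lengths linear in `lenBound N`, with a factor depending on the expression
alone. -/
theorem len_val_le {N : ℕ} {μ : Mem} (h : Bdd N μ) (e : Expr) :
    len (e.val μ) ≤ e.valWeight * lenBound N := by
  have hB : 1 ≤ lenBound N := by simp [lenBound]
  induction e with
  | const n => exact Nat.le_mul_of_pos_right _ hB
  | read b e ih =>
    refine (h.len_le _ _).trans ?_
    rw [Expr.valWeight, add_mul, one_mul]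
    exact Nat.le_add_left _ _
  | add e₁ e₂ h₁ h₂ =>
    rw [Expr.valWeight, add_mul]
    exact (len_add_le _ _).trans (Nat.add_le_add h₁ h₂)
  | sub e₁ e₂ h₁ h₂ =>
    rw [Expr.valWeight, add_mul]
    exact (len_sub_le _ _).trans (Nat.add_le_add h₁ h₂)
  | mul e₁ e₂ h₁ h₂ =>
    rw [Expr.valWeight, add_mul]
    exact (len_mul_le _ _).trans (Nat.add_le_add h₁ h₂)
  | div e₁ e₂ h₁ h₂ =>
    rw [Expr.valWeight, add_mul]
    exact (len_div_le _ _).trans (Nat.add_le_add h₁ h₂)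

theorem cost_le {N : ℕ} {μ : Mem} (h : Bdd N μ) (e : Expr) :
    e.cost μ ≤ e.costWeight * lenBound N := by
  have hB : 1 ≤ lenBound N := by simp [lenBound]
  induction e with
  | const n => exact Nat.le_mul_of_pos_right _ hB
  | read b e ih =>
    have h1 := len_val_le h e
    have h2 := h.len_le b (e.val μ).toNat
    simp only [Expr.cost, Expr.costWeight, add_mul, one_mul]
    omega
  | add e₁ e₂ h₁ h₂ | sub e₁ e₂ h₁ h₂ | mul e₁ e₂ h₁ h₂ | div e₁ e₂ h₁ h₂ =>
    have h3 := len_val_le h e₁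
    have h4 := len_val_le h e₂
    simp only [Expr.cost, Expr.costWeight, add_mul]
    omega

/-- Bounds the cost of one step of a program, relative to the length of the memory cells. -/
def Prog.weight : Prog → ℕ
  | skip => 1
  | write _ e₁ e₂ => e₁.costWeight + e₂.costWeight + e₁.valWeight + e₂.valWeight
  | seq c₁ c₂ => weight c₁ + weight c₂
  | ite e c₁ c₂ => e.costWeight + e.valWeight + weight c₁ + weight c₂
  | loop e c => e.costWeight + e.valWeight + weight c

/-- `c` leads from `μ` to `ν` in at most `n` steps on numbers of absolute value at most `N`. -/
def Runs (N : ℕ) (c : Prog) (μ ν : Mem) (n : ℕ) : Prop :=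
  ∃ t, Exec c μ ν t ∧ t ≤ n * (c.weight * lenBound N)

variable {N : ℕ} {μ ν ξ : Mem}

theorem Runs.mono {c : Prog} {n n' : ℕ} (h : Runs N c μ ν n) (hn : n ≤ n') : Runs N c μ ν n' := by
  obtain ⟨t, h1, h2⟩ := h
  exact ⟨t, h1, h2.trans (Nat.mul_le_mul_right _ hn)⟩

theorem runs_skip : Runs N Prog.skip μ μ 1 :=
  ⟨1, Exec.skip μ, by simp [Prog.weight, lenBound]⟩

theorem runs_write (h : Bdd N μ) (b : ℕ) (e₁ e₂ : Expr) :
    Runs N (Prog.write b e₁ e₂) μ (μ.set b (e₁.val μ).toNat (e₂.val μ)) 1 := by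
  refine ⟨_, Exec.write b e₁ e₂ μ, ?_⟩
  have h1 := cost_le h e₁
  have h2 := cost_le h e₂
  have h3 := len_val_le h e₁
  have h4 := len_val_le h e₂
  simp only [Prog.weight, add_mul, one_mul]
  omega

theorem Runs.seq {c₁ c₂ : Prog} {n₁ n₂ : ℕ} (h₁ : Runs N c₁ μ ν n₁) (h₂ : Runs N c₂ ν ξ n₂) :
    Runs N (Prog.seq c₁ c₂) μ ξ (n₁ + n₂) := by
  obtain ⟨t₁, e₁, l₁⟩ := h₁
  obtain ⟨t₂, e₂, l₂⟩ := h₂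
  refine ⟨_, Exec.seq e₁ e₂, ?_⟩
  rw [Prog.weight]
  have h1 : n₁ * (c₁.weight * lenBound N) ≤ n₁ * ((c₁.weight + c₂.weight) * lenBound N) := by
    gcongr
    exact Nat.le_add_right _ _
  have h2 : n₂ * (c₂.weight * lenBound N) ≤ n₂ * ((c₁.weight + c₂.weight) * lenBound N) := by
    gcongr
    exact Nat.le_add_left _ _
  rw [add_mul n₁]
  omega

theorem test_le (h : Bdd N μ) (e : Expr) :
    e.cost μ + len (e.val μ) ≤ (e.costWeight + e.valWeight) * lenBound N := by
  rw [add_mul]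
  exact Nat.add_le_add (cost_le h e) (len_val_le h e)

theorem Runs.ite_pos {e : Expr} {c₁ c₂ : Prog} {n : ℕ} (hμ : Bdd N μ) (he : 0 < e.val μ)
    (h : Runs N c₁ μ ν n) : Runs N (Prog.ite e c₁ c₂) μ ν (n + 1) := by
  obtain ⟨t, h1, h2⟩ := h
  refine ⟨_, Exec.ite_pos he h1, ?_⟩
  have h3 := test_le hμ e
  have h4 : n * (c₁.weight * lenBound N) ≤ n * ((Prog.ite e c₁ c₂).weight * lenBound N) := by
    gcongr
    simp only [Prog.weight]
    omega
  have h5 : (e.costWeight + e.valWeight) * lenBound N ≤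
      (Prog.ite e c₁ c₂).weight * lenBound N := by
    gcongr
    simp only [Prog.weight]
    omega
  rw [add_mul, one_mul]
  omega

theorem Runs.ite_neg {e : Expr} {c₁ c₂ : Prog} {n : ℕ} (hμ : Bdd N μ) (he : e.val μ ≤ 0)
    (h : Runs N c₂ μ ν n) : Runs N (Prog.ite e c₁ c₂) μ ν (n + 1) := by
  obtain ⟨t, h1, h2⟩ := h
  refine ⟨_, Exec.ite_neg he h1, ?_⟩
  have h3 := test_le hμ e
  have h4 : n * (c₂.weight * lenBound N) ≤ n * ((Prog.ite e c₁ c₂).weight * lenBound N) := by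
    gcongr
    simp only [Prog.weight]
    omega
  have h5 : (e.costWeight + e.valWeight) * lenBound N ≤
      (Prog.ite e c₁ c₂).weight * lenBound N := by
    gcongr
    simp only [Prog.weight]
    omega
  rw [add_mul, one_mul]
  omega

theorem runs_loop_done {e : Expr} {c : Prog} (hμ : Bdd N μ) (he : e.val μ ≤ 0) :
    Runs N (Prog.loop e c) μ μ 1 := by
  refine ⟨_, Exec.loop_done he, (test_le hμ e).trans ?_⟩
  rw [one_mul]
  gcongr
  simp only [Prog.weight]
  omega

theorem Runs.loop_step {e : Expr} {c : Prog} {n₁ n₂ : ℕ} (hμ : Bdd N μ) (he : 0 < e.val μ)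
    (h₁ : Runs N c μ ν n₁) (h₂ : Runs N (Prog.loop e c) ν ξ n₂) :
    Runs N (Prog.loop e c) μ ξ (1 + n₁ + n₂) := by
  obtain ⟨t₁, e₁, l₁⟩ := h₁
  obtain ⟨t₂, e₂, l₂⟩ := h₂
  refine ⟨_, Exec.loop_step he e₁ e₂, ?_⟩
  have h3 := test_le hμ e
  have h4 : n₁ * (c.weight * lenBound N) ≤ n₁ * ((Prog.loop e c).weight * lenBound N) := by
    gcongr
    simp only [Prog.weight]
    omega
  have h5 : (e.costWeight + e.valWeight) * lenBound N ≤ (Prog.loop e c).weight * lenBound N := by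
    gcongr
    simp only [Prog.weight]
    omega
  rw [add_mul, add_mul, one_mul]
  omega

theorem Mem.set_self (μ : Mem) (b i : ℕ) (v : ℤ) : μ.set b i v b = Function.update (μ b) i v := by
  funext j
  simp [Mem.set, Function.update_apply]

theorem Mem.set_of_ne (μ : Mem) {b b' : ℕ} (i : ℕ) (v : ℤ) (h : b' ≠ b) :
    μ.set b i v b' = μ b' := by
  funext j
  simp [Mem.set, h]

theorem Bdd.set (h : Bdd N μ) (b i : ℕ) {v : ℤ} (hv : |v| ≤ N) : Bdd N (μ.set b i v) := by
  intro b' i'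
  simp only [Mem.set]
  split_ifs
  exacts [hv, h b' i']

/-- The scalar variable stored in bank `b`. -/
def Expr.var (b : ℕ) : Expr := Expr.read b (Expr.const 0)

/-- Assignment to the scalar variable stored in bank `b`. -/
def Prog.assign (b : ℕ) (e : Expr) : Prog := Prog.write b (Expr.const 0) e

/-- Sequential composition of a list of programs. -/
def Prog.block : List Prog → Prog
  | [] => Prog.skip
  | c :: cs => Prog.seq c (Prog.block cs)

/-- Repeat `c` as often as the variable in bank `b` says, counting it down to zero. -/
def Prog.forLoop (b : ℕ) (c : Prog) : Prog :=
  Prog.loop (Expr.var b) (Prog.seq c (Prog.assign b (Expr.sub (Expr.var b) (Expr.const 1))))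

/-- `c` leads from the memory `μ`, if it is bounded by `N`, to the memory `ν`, bounded as well, in
at most `n` steps. -/
def Steps (N : ℕ) (c : Prog) (μ ν : Mem) (n : ℕ) : Prop :=
  Bdd N μ → Runs N c μ ν n ∧ Bdd N ν

namespace Steps

theorem mono {c : Prog} {n n' : ℕ} (h : Steps N c μ ν n) (hn : n ≤ n') : Steps N c μ ν n' :=
  fun hμ => ⟨(h hμ).1.mono hn, (h hμ).2⟩

theorem skip : Steps N Prog.skip μ μ 1 := fun hμ => ⟨runs_skip, hμ⟩

theorem write {b i : ℕ} {e₁ e₂ : Expr} {v : ℤ} (h₁ : e₁.val μ = i) (h₂ : e₂.val μ = v)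
    (hv : |v| ≤ N) : Steps N (Prog.write b e₁ e₂) μ (μ.set b i v) 1 := by
  intro hμ
  have h := runs_write hμ b e₁ e₂
  rw [h₁, h₂, Int.toNat_natCast] at h
  exact ⟨h, hμ.set b i hv⟩

theorem assign {b : ℕ} {e : Expr} {v : ℤ} (h : e.val μ = v) (hv : |v| ≤ N) :
    Steps N (Prog.assign b e) μ (μ.set b 0 v) 1 :=
  write rfl h hv

theorem seq {c₁ c₂ : Prog} {n₁ n₂ : ℕ} (h₁ : Steps N c₁ μ ν n₁) (h₂ : Steps N c₂ ν ξ n₂) :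
    Steps N (Prog.seq c₁ c₂) μ ξ (n₁ + n₂) := fun hμ =>
  ⟨(h₁ hμ).1.seq (h₂ (h₁ hμ).2).1, (h₂ (h₁ hμ).2).2⟩

theorem nil : Steps N (Prog.block []) μ μ 1 := skip

theorem cons {c : Prog} {cs : List Prog} {n₁ n₂ : ℕ} (h₁ : Steps N c μ ν n₁)
    (h₂ : Steps N (Prog.block cs) ν ξ n₂) : Steps N (Prog.block (c :: cs)) μ ξ (n₁ + n₂) :=
  seq h₁ h₂

theorem ite_pos {e : Expr} {c₁ c₂ : Prog} {n : ℕ} (he : 0 < e.val μ) (h : Steps N c₁ μ ν n) :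
    Steps N (Prog.ite e c₁ c₂) μ ν (n + 1) := fun hμ =>
  ⟨(h hμ).1.ite_pos hμ he, (h hμ).2⟩

theorem ite_neg {e : Expr} {c₁ c₂ : Prog} {n : ℕ} (he : e.val μ ≤ 0) (h : Steps N c₂ μ ν n) :
    Steps N (Prog.ite e c₁ c₂) μ ν (n + 1) := fun hμ =>
  ⟨(h hμ).1.ite_neg hμ he, (h hμ).2⟩

theorem loop_done {e : Expr} {c : Prog} (he : e.val μ ≤ 0) : Steps N (Prog.loop e c) μ μ 1 :=
  fun hμ => ⟨runs_loop_done hμ he, hμ⟩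

theorem loop_step {e : Expr} {c : Prog} {n₁ n₂ : ℕ} (he : 0 < e.val μ) (h₁ : Steps N c μ ν n₁)
    (h₂ : Steps N (Prog.loop e c) ν ξ n₂) : Steps N (Prog.loop e c) μ ξ (1 + n₁ + n₂) := fun hμ =>
  ⟨Runs.loop_step hμ he (h₁ hμ).1 (h₂ (h₁ hμ).2).1, (h₂ (h₁ hμ).2).2⟩

/-- Total correctness of loops: `I n` is the invariant when at most `n` iterations are left. -/
theorem loop {e : Expr} {c : Prog} (I : ℕ → Mem → Prop) {k : ℕ}
    (step : ∀ n μ, I n μ → 0 < e.val μ → ∃ n' < n, ∃ ν, Steps N c μ ν k ∧ I n' ν) (n : ℕ)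
    (hI : I n μ) :
    ∃ ν n', Steps N (Prog.loop e c) μ ν (n * (k + 1) + 1) ∧ I n' ν ∧ e.val ν ≤ 0 := by
  induction n using Nat.strong_induction_on generalizing μ with
  | _ n ih =>
    by_cases he : 0 < e.val μ
    · obtain ⟨n', hn', ν, hr, hI'⟩ := step n μ hI he
      obtain ⟨ξ, n'', hr', hI'', he'⟩ := ih n' hn' hI'
      refine ⟨ξ, n'', (loop_step he hr hr').mono ?_, hI'', he'⟩
      have : (n' + 1) * (k + 1) ≤ n * (k + 1) := Nat.mul_le_mul_right _ hn'
      rw [add_mul, one_mul] at this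
      omega
    · exact ⟨μ, n, (loop_done (not_lt.1 he)).mono (by omega), hI, not_lt.1 he⟩

/-- Total correctness of counting loops: `I n` is the invariant when `n` iterations are left. -/
theorem forLoop {b : ℕ} {c : Prog} (I : ℕ → Mem → Prop) {k : ℕ}
    (step : ∀ n : ℕ, ∀ μ, I (n + 1) μ → μ b 0 = n + 1 →
      ∃ ν, Steps N c μ ν k ∧ ν b 0 = n + 1 ∧ I n (ν.set b 0 n)) (n : ℕ)
    (hI : I n μ) (hb : μ b 0 = n) :
    ∃ ν, Steps N (Prog.forLoop b c) μ ν (n * (k + 2) + 1) ∧ I 0 ν ∧ ν b 0 = 0 := by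
  induction n generalizing μ with
  | zero => exact ⟨μ, (loop_done (e := Expr.var b) (show μ b 0 ≤ 0 from le_of_eq hb)).mono (by omega), hI, hb⟩
  | succ n ih =>
    push_cast at hb
    obtain ⟨ν, hr, hν, hI'⟩ := step n μ hI hb
    obtain ⟨ξ, hr', hI'', h0⟩ := ih hI' (by simp [Mem.set])
    refine ⟨ξ, ?_, hI'', h0⟩
    intro hμ
    -- The decremented counter needs no separate size hypothesis: it is smaller than the counter
    -- already in memory.
    have hn : |(n : ℤ)| ≤ N := by
      have := hμ b 0
      rw [hb] at this
      rw [abs_of_nonneg (by positivity)] at this ⊢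
      omega
    have he : 0 < (Expr.var b).val μ := by
      change 0 < μ b 0
      omega
    have hdec : Steps N (Prog.assign b (Expr.sub (Expr.var b) (Expr.const 1))) ν (ν.set b 0 n) 1 :=
      assign (by change ν b 0 - 1 = n; omega) hn
    refine ((loop_step he (hr.seq hdec) hr').mono (le_of_eq ?_)) hμ
    ring

end Steps

/-- The memories agree outside the banks of `l`. -/
def AgreeOff (l : List ℕ) (μ ν : Mem) : Prop := ∀ b, b ∉ l → ν b = μ b

theorem AgreeOff.refl (l : List ℕ) (μ : Mem) : AgreeOff l μ μ := fun _ _ => rfl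

theorem AgreeOff.set {l : List ℕ} (h : AgreeOff l μ ν) {b : ℕ} (hb : b ∈ l) (i : ℕ) (v : ℤ) :
    AgreeOff l μ (ν.set b i v) := by
  intro b' hb'
  rw [← h b' hb']
  funext j
  have : b' ≠ b := fun e => hb' (e ▸ hb)
  simp [Mem.set, this]

theorem AgreeOff.mono {l l' : List ℕ} (h : AgreeOff l μ ν) (hl : l ⊆ l') : AgreeOff l' μ ν :=
  fun b hb => h b fun hb' => hb (hl hb')

end RAM

/-! ### Encoding of circuits and size bounds -/

theorem List.getD_flatMap_of_length {α β : Type*} {f : α → List β} {n : ℕ}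
    (hf : ∀ a, (f a).length = n) (l : List α) {k r : ℕ} (hk : k < l.length) (hr : r < n) (z : β) :
    (l.flatMap f).getD (n * k + r) z = (f l[k]).getD r z := by
  induction l generalizing k with
  | nil => simp at hk
  | cons a l ih =>
    rw [List.flatMap_cons]
    cases k with
    | zero =>
      rw [List.getD_append _ _ _ _ (by rw [hf]; omega)]
      simp
    | succ k =>
      rw [List.getD_append_right _ _ _ _ (by rw [hf, mul_add]; omega), hf]
      rw [show n * (k + 1) + r - n = n * k + r by rw [mul_add]; omega]
      exact ih (by simpa using hk)

theorem List.length_flatMap_of_length {α β : Type*} {f : α → List β} {n : ℕ}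
    (hf : ∀ a, (f a).length = n) (l : List α) : (l.flatMap f).length = n * l.length := by
  induction l with
  | nil => simp
  | cons a l ih =>
    rw [List.flatMap_cons, List.length_append, ih, hf, List.length_cons]
    ring

theorem LinGate.length_code (g : LinGate) : g.code.length = 4 := by
  cases g <;> rfl

namespace LinearFIXPCircuit

variable {d : ℕ} (C : LinearFIXPCircuit d)

theorem code_getD_zero : C.code.getD 0 0 = d := rfl

theorem code_getD_one : C.code.getD 1 0 = C.gates.length := rfl

theorem code_getD_gate {k r : ℕ} (hk : k < C.gates.length) (hr : r < 4) :
    C.code.getD (2 + 4 * k + r) 0 = (C.gates[k]).code.getD r 0 := by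
  have hlen := List.length_flatMap_of_length LinGate.length_code C.gates
  rw [code, List.getD_append _ _ _ _ (by simp only [List.length_append, hlen]; simp; omega),
    List.getD_append_right _ _ _ _ (by simp; omega)]
  rw [← List.getD_flatMap_of_length LinGate.length_code C.gates hk hr]
  congr 1
  simp
  omega

theorem code_getD_out (i : Fin d) :
    C.code.getD (2 + 4 * C.gates.length + i) 0 = C.out i := by
  have hlen := List.length_flatMap_of_length LinGate.length_code C.gates
  rw [code, List.getD_append_right _ _ _ _ (by simp only [List.length_append, hlen]; simp)]
  simp only [List.length_append, hlen]
  rw [show 2 + 4 * C.gates.length + (i : ℕ) -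
    ([(d : ℤ), (C.gates.length : ℤ)].length + 4 * C.gates.length) = i by simp]
  simp [List.getD_eq_getElem?_getD]

/-- The factor by which the error of the bisection grows in one coordinate. -/
def amp : ℕ := 4 * C.cond ^ 3

/-- The threshold of the rational reconstruction. -/
def threshold : ℕ := C.amp ^ (d + 1)

/-- Number of bits to which the fixpoint is approximated. -/
def bits : ℕ := Nat.clog 2 (C.threshold * C.amp)

/-- Denominator of the approximations. -/
def scale : ℕ := 2 ^ C.bits

/-- Bound for all numbers that occur in the computation. -/
def memBound : ℕ := C.scale ^ (d + 2)

theorem threshold_mul_amp_le : C.threshold * C.amp ≤ C.scale :=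
  Nat.le_pow_clog (by norm_num) _

theorem cond_mul_four_le_amp : 4 * C.cond ≤ C.amp :=
  Nat.mul_le_mul_left _ (Nat.le_self_pow (by norm_num) _)

theorem amp_le_threshold : C.amp ≤ C.threshold := Nat.le_self_pow (by omega) _

variable {C}

theorem denProd_le_base (hd : 1 ≤ d) : C.denProd ≤ C.base := by
  have h1 : C.denProd ≤ C.denProd * C.growthProd := Nat.le_mul_of_pos_right _ growthProd_pos
  exact h1.trans (Nat.le_mul_of_pos_left _ (by omega))

theorem growthProd_le_base (hd : 1 ≤ d) : C.growthProd ≤ C.base := by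
  have h1 : C.growthProd ≤ C.denProd * C.growthProd := Nat.le_mul_of_pos_left _ denProd_pos
  exact h1.trans (Nat.le_mul_of_pos_left _ (by omega))

theorem two_mul_dim_le_base : 2 * d ≤ C.base :=
  Nat.le_mul_of_pos_right _ (Nat.mul_pos denProd_pos growthProd_pos)

/-- Every growth factor is at least `2`, so the product dominates the number of gates; this keeps
the wire indices in the code below the memory bound. -/
theorem length_le_growthProd : C.gates.length ≤ C.growthProd := by
  have key : ∀ l : List LinGate, l.length + 1 ≤ (l.map LinGate.growth).prod := by
    intro l
    induction l with
    | nil => simp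
    | cons g l ih =>
      rw [List.map_cons, List.prod_cons, List.length_cons]
      have := Nat.mul_le_mul g.two_le_growth ih
      omega
  have := key C.gates
  rw [growthProd, growthUpTo, List.take_length]
  omega

theorem den_le_denProd {g : LinGate} (hg : g ∈ C.gates) : g.den ≤ C.denProd := by
  refine Nat.le_of_dvd denProd_pos ?_
  rw [denProd, denUpTo, List.take_length]
  exact List.dvd_prod (List.mem_map_of_mem hg)

theorem growth_le_growthProd {g : LinGate} (hg : g ∈ C.gates) : g.growth ≤ C.growthProd := by
  refine Nat.le_of_dvd growthProd_pos ?_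
  rw [growthProd, growthUpTo, List.take_length]
  exact List.dvd_prod (List.mem_map_of_mem hg)

/-- The inequalities between the bounds. -/
theorem bounds (hd : 1 ≤ d) : 1 ≤ d ∧ 2 * d ≤ C.base ∧ C.gates.length ≤ C.base ∧ C.denProd ≤ C.base ∧
    C.growthProd ≤ C.base ∧ C.base ≤ C.cond ∧ 4 * C.cond ≤ C.amp ∧ C.amp ≤ C.threshold ∧
    4 * C.threshold ≤ C.scale ∧ 4 * C.scale ≤ C.memBound := by
  have h1 := C.cond_mul_four_le_amp
  have h2 := base_le_cond (C := C) hd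
  have h3 := one_le_base (C := C) hd
  have h4 : C.threshold * 4 ≤ C.threshold * C.amp := Nat.mul_le_mul_left _ (by omega)
  have h5 := C.threshold_mul_amp_le
  have h6 := C.amp_le_threshold
  refine ⟨hd, two_mul_dim_le_base, length_le_growthProd.trans (growthProd_le_base hd),
    denProd_le_base hd, growthProd_le_base hd, h2, h1, h6, by omega, ?_⟩
  rw [memBound, pow_succ]
  exact Nat.mul_le_mul_right _ ((show 4 ≤ C.scale by omega).trans
    (Nat.le_self_pow (by omega) _))

theorem scale_mul_scale_le (hd : 1 ≤ d) : C.scale * C.scale ≤ C.memBound := by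
  have := bounds (C := C) hd
  rw [memBound, ← pow_two]
  exact Nat.pow_le_pow_right (by omega) (by omega)

/-- Besides scaled wire values, the memory holds the tick counter; this is why the exponent in
`memBound` grows with `d`. -/
theorem pow_bits_le (C : LinearFIXPCircuit d) : (C.bits + 1) ^ d ≤ C.memBound := by
  have h1 : C.bits + 1 ≤ C.scale := Nat.lt_two_pow_self
  exact (Nat.pow_le_pow_left h1 d).trans (Nat.pow_le_pow_right (by omega) (by omega))

theorem abs_code_getD_le (hd : 1 ≤ d) (i : ℕ) : |C.code.getD i 0| ≤ C.memBound := by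
  obtain ⟨-, b1, b2, b3, b4, b5, b6, b7, b8, b9⟩ := bounds (C := C) hd
  have key : ∀ z ∈ C.code, |z| ≤ C.memBound := by
    intro z hz
    rw [Int.abs_eq_natAbs]
    simp only [code, List.mem_append, List.mem_cons, List.not_mem_nil, or_false,
      List.mem_flatMap, List.mem_ofFn] at hz
    rcases hz with ((rfl | rfl) | ⟨g, hg, hz⟩) | ⟨i, rfl⟩
    · omega
    · omega
    · have h1 := den_le_denProd hg
      have h2 := growth_le_growthProd hg
      have h3 := g.natAbs_num_le_growth
      have h4 : ∀ a ∈ g.args, a < d + C.gates.length := by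
        obtain ⟨k, hk, rfl⟩ := List.getElem_of_mem hg
        intro a ha
        have := C.args_lt k hk a ha
        omega
      cases g <;> simp only [LinGate.code, LinGate.num, LinGate.den, LinGate.args, List.mem_cons,
        List.not_mem_nil, or_false, forall_eq_or_imp, forall_eq] at h1 h2 h3 h4 hz <;>
      rcases hz with rfl | rfl | rfl | rfl <;> omega
    · have := C.out_lt i
      omega
  rw [List.getD_eq_getElem?_getD]
  rcases h : C.code[i]? with _ | z
  · simp
  · exact key z (List.mem_of_getElem? h)

end LinearFIXPCircuit

/-! ### The program -/

namespace RAM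

open RAM.Expr RAM.Prog

instance : Add Expr := ⟨Expr.add⟩
instance : Sub Expr := ⟨Expr.sub⟩
instance : Mul Expr := ⟨Expr.mul⟩
instance : Div Expr := ⟨Expr.div⟩

section Values

variable {μ : Mem} {e e₁ e₂ : Expr}

@[simp] theorem val_add : (e₁ + e₂).val μ = e₁.val μ + e₂.val μ := rfl
@[simp] theorem val_sub : (e₁ - e₂).val μ = e₁.val μ - e₂.val μ := rfl
@[simp] theorem val_mul : (e₁ * e₂).val μ = e₁.val μ * e₂.val μ := rfl
@[simp] theorem val_div : (e₁ / e₂).val μ = e₁.val μ / e₂.val μ := rfl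
@[simp] theorem val_const {n : ℤ} : (const n).val μ = n := rfl
@[simp] theorem val_var {b : ℕ} : (var b).val μ = μ b 0 := rfl

theorem val_read {b i : ℕ} (h : e.val μ = i) : (read b e).val μ = μ b i := by
  simp [Expr.val, h]

theorem abs_natCast_le {a N : ℕ} (h : a ≤ N) : |(a : ℤ)| ≤ N := by
  rw [Nat.abs_cast]
  exact_mod_cast h

end Values

/-- Dimension of the circuit. -/
def dimExpr : Expr := read 0 (const 0)

/-- Number of gates of the circuit. -/
def gatesExpr : Expr := read 0 (const 1)

/-- Position in the input of the gate at which a loop with counter `7` has arrived. -/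
def gateExpr : Expr := const 2 + const 4 * (gatesExpr - var 7)

/-- Multiply the denominator and the growth factor of one gate into variables `5` and `6`. -/
def prodBody : Prog :=
  block [assign 16 gateExpr,
    assign 8 (const 0),
    assign 9 (const 1),
    ite (read 0 (var 16))
      (ite (read 0 (var 16) - const 4)
        (block [assign 8 (read 0 (var 16 + const 2)), assign 9 (read 0 (var 16 + const 3))]) skip)
      (block [assign 8 (read 0 (var 16 + const 1)), assign 9 (read 0 (var 16 + const 2))]),
    assign 5 (var 5 * var 9),
    assign 6 (var 6 * (const 2 + var 8 * var 8))]

/-- Raise the variable `b` to the power given by variable `7`, into the variable `a`. -/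
def powProg (a b : ℕ) : Prog :=
  block [assign a (const 1), forLoop 7 (assign a (var a * var b))]

/-- Double variable `12` until it exceeds variable `8`, counting the doublings in variable `13`. -/
def doubling : Prog :=
  block [assign 12 (const 1), assign 13 (const 0),
    loop (var 8 - var 12) (block [assign 12 (var 12 * const 2), assign 13 (var 13 + const 1)])]

/-- Compute the parameters of the algorithm. -/
def paramProg : Prog :=
  block [assign 5 (const 1), assign 6 (const 1), assign 7 gatesExpr, forLoop 7 prodBody,
    assign 6 (const 2 * dimExpr * (var 5 * var 6)),
    assign 7 (dimExpr + const 1), powProg 10 6,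
    assign 8 (const 4 * (var 10 * var 10 * var 10)),
    assign 7 (dimExpr + const 1), powProg 11 8,
    assign 8 (var 11 * var 8),
    doubling,
    assign 14 (var 12 / const 2),
    assign 9 (var 13 + const 1),
    assign 7 dimExpr, powProg 15 9,
    assign 15 (var 15 - const 1)]

/-- Start the bisection of all coordinates. -/
def initProg : Prog :=
  block [assign 7 dimExpr,
    forLoop 7 (block [write 3 (var 7 - const 1) (var 14), write 4 (var 7 - const 1) (var 14)])]

/-- Compute the value of one gate. -/
def gateBody : Prog :=
  block [assign 16 gateExpr,
    assign 8 (read 0 (var 16 + const 1)),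
    assign 9 (read 0 (var 16 + const 2)),
    assign 21 (read 0 (var 16 + const 3)),
    assign 16 (read 0 (var 16)),
    ite (var 16)
      (ite (var 16 - const 1)
        (ite (var 16 - const 2)
          (ite (var 16 - const 3)
            (ite (var 16 - const 4)
              (assign 22 (var 9 * read 2 (var 8) / var 21))
              (ite (read 2 (var 8) - read 2 (var 9))
                (assign 22 (read 2 (var 9))) (assign 22 (read 2 (var 8)))))
            (ite (read 2 (var 8) - read 2 (var 9))
              (assign 22 (read 2 (var 8))) (assign 22 (read 2 (var 9)))))
          (assign 22 (read 2 (var 8) - read 2 (var 9))))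
        (assign 22 (read 2 (var 8) + read 2 (var 9))))
      (assign 22 (var 8 * (var 12 * var 5) / var 9)),
    write 2 (dimExpr + (gatesExpr - var 7)) (var 22)]

/-- Evaluate the circuit at the current position. -/
def evalProg : Prog :=
  block [assign 7 dimExpr,
    forLoop 7 (write 2 (var 7 - const 1) (read 3 (var 7 - const 1) * var 5)),
    assign 7 gatesExpr,
    forLoop 7 gateBody]

/-- Reset a finished coordinate or advance an unfinished one. -/
def carryBody : Prog :=
  ite (read 4 (var 7 - const 1))
    (block [
      ite (read 2 (var 7 - const 1) -
          read 2 (read 0 (const 2 + const 4 * gatesExpr + (var 7 - const 1))))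
        (write 3 (var 7 - const 1) (read 3 (var 7 - const 1) - read 4 (var 7 - const 1))) skip,
      write 4 (var 7 - const 1) (read 4 (var 7 - const 1) / const 2),
      write 3 (var 7 - const 1) (read 3 (var 7 - const 1) + read 4 (var 7 - const 1)),
      assign 7 (const 0)])
    (block [write 3 (var 7 - const 1) (var 14), write 4 (var 7 - const 1) (var 14),
      assign 7 (var 7 - const 1)])

/-- One step of the nested bisection. -/
def tickProg : Prog :=
  block [evalProg, assign 7 dimExpr, loop (var 7) carryBody]

/-- One step of the extended Euclidean algorithm. -/
def euclidBody : Prog :=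
  block [assign 21 (var 17 / var 18),
    assign 22 (var 17 - var 21 * var 18),
    assign 17 (var 18),
    assign 18 (var 22),
    assign 22 (var 19 + var 21 * var 20),
    assign 19 (var 20),
    assign 20 (var 22)]

/-- Reconstruct one coordinate of the fixpoint from its approximation. -/
def outputBody : Prog :=
  block [assign 17 (var 12),
    assign 18 (read 3 (var 7 - const 1)),
    assign 19 (const 0),
    assign 20 (const 1),
    loop (var 18 - var 11) euclidBody,
    write 1 (const 2 * (var 7 - const 1) + const 1) (var 20),
    write 1 (const 2 * (var 7 - const 1))
      ((const 2 * read 3 (var 7 - const 1) * var 20 + var 12) / (const 2 * var 12))]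

/-- Reconstruct the fixpoint from its approximation. -/
def outputProg : Prog :=
  block [assign 7 dimExpr, forLoop 7 outputBody]

/-- The program that computes fixpoints of contractions given by circuits. -/
def fixpointProg : Prog :=
  block [paramProg, initProg, forLoop 15 tickProg, outputProg]

/-! ### Correctness of the computation of the parameters. -/

section Params

variable {d : ℕ} {C : LinearFIXPCircuit d} {μ : Mem}

/-- The memory holds the circuit in bank `0`. -/
def HasInput (C : LinearFIXPCircuit d) (μ : Mem) : Prop := ∀ i, μ 0 i = C.code.getD i 0

theorem HasInput.of_eq {ν : Mem} (h : HasInput C μ) (e : ν 0 = μ 0) : HasInput C ν := by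
  intro i
  rw [e]
  exact h i

theorem HasInput.dim (h : HasInput C μ) : dimExpr.val μ = d :=
  (h 0).trans C.code_getD_zero

theorem HasInput.gates (h : HasInput C μ) : gatesExpr.val μ = C.gates.length :=
  (h 1).trans C.code_getD_one

theorem HasInput.gateExpr_val (h : HasInput C μ) {n : ℕ} (hn : n < C.gates.length)
    (h7 : μ 7 0 = n + 1) : gateExpr.val μ = (2 + 4 * (C.gates.length - (n + 1)) : ℕ) := by
  have h1 : gatesExpr.val μ = C.gates.length := h.gates
  simp only [gateExpr, val_add, val_const, val_mul, val_sub, val_var, h1, h7]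
  omega

theorem HasInput.read_gate (h : HasInput C μ) {n r : ℕ} (hn : n < C.gates.length) (hr : r < 4) :
    μ 0 (2 + 4 * n + r) = (C.gates[n]).code.getD r 0 :=
  (h _).trans (C.code_getD_gate hn hr)

theorem steps_prodBody (hd : 1 ≤ d) (hin : HasInput C μ) {n : ℕ} (hn : n < C.gates.length)
    (h7 : μ 7 0 = n + 1) (h5 : μ 5 0 = C.denUpTo (C.gates.length - (n + 1)))
    (h6 : μ 6 0 = C.growthUpTo (C.gates.length - (n + 1))) :
    ∃ ν, Steps C.memBound prodBody μ ν 20 ∧ AgreeOff [5, 6, 8, 9, 16] μ ν ∧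
      ν 5 0 = C.denUpTo (C.gates.length - n) ∧ ν 6 0 = C.growthUpTo (C.gates.length - n) := by
  obtain ⟨-, b1, b2, b3, b4, b5, b6, b7, b8, b9⟩ := C.bounds hd
  -- The counter runs down from the number of gates while gates are processed in order, so the value
  -- `n + 1` belongs to this gate.
  set k := C.gates.length - (n + 1) with hk
  have hkl : k < C.gates.length := by omega
  rw [show C.gates.length - n = k + 1 by omega, C.denUpTo_succ hkl, C.growthUpTo_succ hkl]
  have hden : C.denUpTo k * (C.gates[k]).den ≤ C.denProd := by
    rw [← C.denUpTo_succ hkl]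
    exact Nat.le_of_dvd LinearFIXPCircuit.denProd_pos (C.denUpTo_mono hkl le_rfl)
  have hgrow : C.growthUpTo k * (C.gates[k]).growth ≤ C.growthProd := by
    rw [← C.growthUpTo_succ hkl]
    exact C.growthUpTo_mono hkl le_rfl
  have hcode : ∀ r < 4, μ 0 (2 + 4 * k + r) = (C.gates[k]).code.getD r 0 := fun r hr =>
    hin.read_gate hkl hr
  have hnum := (C.gates[k]).natAbs_num_le_growth
  have hgl : (C.gates[k]).growth ≤ C.growthProd :=
    LinearFIXPCircuit.growth_le_growthProd (List.getElem_mem hkl)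
  have hdl : (C.gates[k]).den ≤ C.denProd :=
    LinearFIXPCircuit.den_le_denProd (List.getElem_mem hkl)
  have hptr := hin.gateExpr_val hn h7
  rw [← hk] at hptr
  revert hden hgrow hcode hnum hgl hdl
  generalize C.gates[k] = g
  intro hden hgrow hcode hnum hgl hdl
  have s1 : Steps C.memBound (assign 16 gateExpr) μ (μ.set 16 0 (2 + 4 * k : ℕ)) 1 :=
    Steps.assign hptr (abs_natCast_le (by omega))
  set μ₁ := μ.set 16 0 (2 + 4 * k : ℕ) with hμ₁
  have s2 : Steps C.memBound (assign 8 (const 0)) μ₁ (μ₁.set 8 0 0) 1 :=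
    Steps.assign rfl (by simp)
  set μ₂ := μ₁.set 8 0 0 with hμ₂
  have s3 : Steps C.memBound (assign 9 (const 1)) μ₂ (μ₂.set 9 0 1) 1 :=
    Steps.assign rfl (by rw [abs_one]; omega)
  set μ₃ := μ₂.set 9 0 1 with hμ₃
  have agree₃ : AgreeOff [5, 6, 8, 9, 16] μ μ₃ :=
    (((AgreeOff.refl _ μ).set (by simp) _ _).set (by simp) _ _).set (by simp) _ _
  have h16 : μ₃ 16 0 = (2 + 4 * k : ℕ) := by simp [μ₃, μ₂, μ₁, Mem.set]
  have h0 : μ₃ 0 = μ 0 := agree₃ 0 (by simp)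
  have hread : ∀ ν : Mem, ν 16 0 = (2 + 4 * k : ℕ) → ν 0 = μ 0 → ∀ r : ℕ, r < 4 →
      (read 0 (var 16 + const r)).val ν = g.code.getD r 0 := by
    intro ν hν hν0 r hr
    rw [val_read (i := 2 + 4 * k + r) (by simp [hν]), hν0]
    exact hcode r hr
  have hread0 : (read 0 (var 16)).val μ₃ = g.code.getD 0 0 := by
    rw [val_read (i := 2 + 4 * k) (by simp [h16]), h0]
    exact hcode 0 (by omega)
  -- Gates without a constant keep the defaults, numerator `0` and denominator `1`, and so
  -- contribute the factors `1` and `2`.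
  have key : ∃ ν, Steps C.memBound (ite (read 0 (var 16))
      (ite (read 0 (var 16) - const 4)
        (block [assign 8 (read 0 (var 16 + const 2)), assign 9 (read 0 (var 16 + const 3))]) skip)
      (block [assign 8 (read 0 (var 16 + const 1)), assign 9 (read 0 (var 16 + const 2))]))
      μ₃ ν 5 ∧ AgreeOff [5, 6, 8, 9, 16] μ ν ∧ ν 5 0 = μ 5 0 ∧ ν 6 0 = μ 6 0 ∧
      ν 8 0 = g.num ∧ ν 9 0 = g.den := by
    have hnumN : |g.num| ≤ C.memBound := by
      rw [Int.abs_eq_natAbs]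
      omega
    have two : ∀ r : ℕ, r < 4 → ∀ r' : ℕ, r' < 4 → g.code.getD r 0 = g.num → g.code.getD r' 0 = g.den →
        ∃ ν, Steps C.memBound
          (block [assign 8 (read 0 (var 16 + const r)), assign 9 (read 0 (var 16 + const r'))])
          μ₃ ν 3 ∧ AgreeOff [5, 6, 8, 9, 16] μ ν ∧ ν 5 0 = μ 5 0 ∧ ν 6 0 = μ 6 0 ∧
          ν 8 0 = g.num ∧ ν 9 0 = g.den := by
      intro r hr r' hr' e1 e2
      refine ⟨_, ((Steps.assign ((hread _ h16 h0 r hr).trans e1) hnumN).cons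
        ((Steps.assign ((hread _ ?_ ?_ r' hr').trans e2) (abs_natCast_le (by omega))).cons
        Steps.nil)), ?_, ?_, ?_, ?_, ?_⟩
      · simpa [Mem.set] using h16
      · rw [Mem.set_of_ne _ _ _ (by norm_num), h0]
      · exact (agree₃.set (by simp) _ _).set (by simp) _ _
      all_goals simp [μ₃, μ₂, μ₁, Mem.set]
    have none : g.num = 0 → g.den = 1 → 0 < g.code.getD 0 0 → g.code.getD 0 0 ≤ 4 →
        ∃ ν, Steps C.memBound (ite (read 0 (var 16))
        (ite (read 0 (var 16) - const 4)
          (block [assign 8 (read 0 (var 16 + const 2)), assign 9 (read 0 (var 16 + const 3))]) skip)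
        (block [assign 8 (read 0 (var 16 + const 1)), assign 9 (read 0 (var 16 + const 2))]))
        μ₃ ν 5 ∧ AgreeOff [5, 6, 8, 9, 16] μ ν ∧ ν 5 0 = μ 5 0 ∧ ν 6 0 = μ 6 0 ∧
        ν 8 0 = g.num ∧ ν 9 0 = g.den := by
      intro e1 e2 e3 e4
      refine ⟨μ₃, (Steps.ite_pos (by rw [hread0]; exact e3) (Steps.ite_neg ?_ Steps.skip)).mono
        (by norm_num), agree₃, ?_, ?_, ?_, ?_⟩
      · rw [val_sub, hread0, val_const]
        omega
      all_goals simp [μ₃, μ₂, μ₁, Mem.set, e1, e2]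
    cases g with
    | const q =>
      obtain ⟨ν, s, h⟩ := two 1 (by omega) 2 (by omega) rfl rfl
      exact ⟨ν, (Steps.ite_neg (by rw [hread0]; exact le_rfl) s).mono (by norm_num), h⟩
    | scale ζ a =>
      obtain ⟨ν, s, h⟩ := two 2 (by omega) 3 (by omega) rfl rfl
      refine ⟨ν, (Steps.ite_pos (by rw [hread0]; simp [LinGate.code])
        (Steps.ite_pos ?_ s)).mono (by norm_num), h⟩
      rw [val_sub, hread0, val_const]
      simp [LinGate.code]
    | _ a b => exact none rfl rfl (by simp [LinGate.code]) (by simp [LinGate.code])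
  obtain ⟨ν, s4, agree, e5, e6, e8, e9⟩ := key
  have s5 : Steps C.memBound (assign 5 (var 5 * var 9)) ν
      (ν.set 5 0 (C.denUpTo k * g.den : ℕ)) 1 :=
    Steps.assign (by simp [e5, e9, h5]) (abs_natCast_le (by omega))
  have s6 : Steps C.memBound (assign 6 (var 6 * (const 2 + var 8 * var 8)))
      (ν.set 5 0 (C.denUpTo k * g.den : ℕ))
      ((ν.set 5 0 (C.denUpTo k * g.den : ℕ)).set 6 0 (C.growthUpTo k * g.growth : ℕ)) 1 := by
    refine Steps.assign ?_ (abs_natCast_le (by omega))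
    simp [Mem.set, e6, e8, h6, LinGate.growth, ← sq]
  refine ⟨_, (s1.cons (s2.cons (s3.cons (s4.cons (s5.cons (s6.cons Steps.nil)))))).mono
    (by norm_num), (agree.set (by simp) _ _).set (by simp) _ _, ?_, ?_⟩
  all_goals simp [Mem.set]

end Params

end RAM

namespace RAM

open RAM.Expr RAM.Prog

theorem AgreeOff.extend {μ ν ξ : Mem} {l l' : List ℕ} (h : AgreeOff l μ ν) (h' : AgreeOff l' ν ξ)
    (hl : l' ⊆ l) : AgreeOff l μ ξ := by
  intro b hb
  rw [h' b fun hb' => hb (hl hb'), h b hb]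

section Params

variable {d : ℕ} {C : LinearFIXPCircuit d} {μ : Mem}

theorem steps_prodLoop (hd : 1 ≤ d) (hin : HasInput C μ) (h7 : μ 7 0 = C.gates.length)
    (h5 : μ 5 0 = 1) (h6 : μ 6 0 = 1) :
    ∃ ν, Steps C.memBound (forLoop 7 prodBody) μ ν (C.gates.length * 22 + 1) ∧
      AgreeOff [5, 6, 7, 8, 9, 16] μ ν ∧ ν 5 0 = C.denProd ∧ ν 6 0 = C.growthProd := by
  have H := Steps.forLoop (N := C.memBound) (b := 7) (c := prodBody)
    (fun n ν => n ≤ C.gates.length ∧ AgreeOff [5, 6, 7, 8, 9, 16] μ ν ∧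
      ν 5 0 = C.denUpTo (C.gates.length - n) ∧ ν 6 0 = C.growthUpTo (C.gates.length - n))
    (k := 20) ?_ C.gates.length ⟨le_rfl, AgreeOff.refl _ _, ?_, ?_⟩ h7
  · obtain ⟨ν, s, ⟨-, ha, h5', h6'⟩, -⟩ := H
    exact ⟨ν, s, ha, h5', h6'⟩
  · rintro n ν ⟨hn, ha, h5, h6⟩ h7
    obtain ⟨ξ, s, ha', h5', h6'⟩ := steps_prodBody hd (hin.of_eq (ha 0 (by simp))) (n := n)
      (by omega) h7 h5 h6
    refine ⟨ξ, s, ?_, by omega, ?_, ?_, ?_⟩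
    · rw [ha' 7 (by simp), h7]
    · exact (ha.extend ha' (by simp)).set (by simp) _ _
    · simpa [Mem.set] using h5'
    · simpa [Mem.set] using h6'
  · simpa [LinearFIXPCircuit.denUpTo] using h5
  · simpa [LinearFIXPCircuit.growthUpTo] using h6

theorem steps_powProg {N a b x e : ℕ} (ha : a ≠ 7) (hb : b ≠ 7) (hab : b ≠ a) (hx : 1 ≤ x)
    (hN : x ^ e ≤ N) (h7 : μ 7 0 = e) (hμb : μ b 0 = x) :
    ∃ ν, Steps N (powProg a b) μ ν (e * 3 + 3) ∧ AgreeOff [a, 7] μ ν ∧ ν a 0 = (x ^ e : ℕ) := by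
  have hN1 : 1 ≤ N := (Nat.one_le_pow _ _ hx).trans hN
  have s1 : Steps N (assign a (const 1)) μ (μ.set a 0 1) 1 :=
    Steps.assign rfl (by rw [abs_one]; exact_mod_cast hN1)
  have H := Steps.forLoop (N := N) (b := 7) (c := assign a (var a * var b))
    (μ := μ.set a 0 1) (fun n ν => n ≤ e ∧ AgreeOff [a, 7] μ ν ∧ ν a 0 = (x ^ (e - n) : ℕ))
    (k := 1) ?_ e ⟨le_rfl, (AgreeOff.refl _ _).set (by simp) _ _, ?_⟩ ?_
  · obtain ⟨ν, s, ⟨-, hag, hν⟩, -⟩ := H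
    exact ⟨ν, (s1.cons (s.cons Steps.nil)).mono (by omega), hag, hν⟩
  · rintro n ν ⟨hn, hag, hν⟩ hν7
    have hpow : x ^ (e - n) = x ^ (e - (n + 1)) * x := by
      rw [← pow_succ]
      congr 1
      omega
    refine ⟨_, Steps.assign (v := (x ^ (e - n) : ℕ)) ?_ (abs_natCast_le
      ((Nat.pow_le_pow_right hx (by omega)).trans hN)), ?_, by omega, ?_, ?_⟩
    · rw [val_mul, val_var, val_var, hν, hag b (by simp [hab, hb]), hμb, hpow]
      push_cast
      ring
    · simpa [Mem.set, ha.symm] using hν7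
    · exact (hag.set (by simp) _ _).set (by simp) _ _
    · simp [Mem.set, ha]
  · simp [Mem.set]
  · simpa [Mem.set, ha.symm] using h7

/-- The loop leaves at the first power of two that reaches `X`, so the number of doublings is the
rounded-up logarithm. The invariant ties the iterations left to the exponent reached. -/
theorem steps_doubling {N X : ℕ} (hN : 2 ^ Nat.clog 2 X ≤ N) (h8 : μ 8 0 = X) :
    ∃ ν, Steps N doubling μ ν (Nat.clog 2 X * 4 + 4) ∧ AgreeOff [12, 13] μ ν ∧
      ν 12 0 = (2 ^ Nat.clog 2 X : ℕ) ∧ ν 13 0 = Nat.clog 2 X := by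
  have hN1 : 1 ≤ N := (Nat.one_le_two_pow).trans hN
  have s1 : Steps N (assign 12 (const 1)) μ (μ.set 12 0 1) 1 :=
    Steps.assign rfl (by rw [abs_one]; exact_mod_cast hN1)
  have s2 : Steps N (assign 13 (const 0)) (μ.set 12 0 1) ((μ.set 12 0 1).set 13 0 0) 1 :=
    Steps.assign rfl (by simp)
  have H := Steps.loop (N := N)
    (e := var 8 - var 12)
    (c := block [assign 12 (var 12 * const 2), assign 13 (var 13 + const 1)])
    (μ := (μ.set 12 0 1).set 13 0 0)
    (fun n ν => ∃ j, n + j = Nat.clog 2 X ∧ AgreeOff [12, 13] μ ν ∧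
      ν 12 0 = (2 ^ j : ℕ) ∧ ν 13 0 = j) (k := 3) ?_ (Nat.clog 2 X) ⟨0, rfl, ?_, ?_, ?_⟩
  · obtain ⟨ν, n', s, ⟨j, hj, hag, h12, h13⟩, he⟩ := H
    have : j = Nat.clog 2 X := by
      refine le_antisymm (by omega) (Nat.clog_le_of_le_pow ?_)
      rw [val_sub, val_var, val_var, h12, hag 8 (by simp), h8] at he
      omega
    rw [← this]
    exact ⟨ν, (s1.cons (s2.cons (s.cons Steps.nil))).mono (by omega), hag, h12, h13⟩
  · rintro n ν ⟨j, hj, hag, h12, h13⟩ he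
    rw [val_sub, val_var, val_var, h12, hag 8 (by simp), h8] at he
    have hlt : j < Nat.clog 2 X := by
      by_contra hcon
      have h1 := Nat.le_pow_clog (b := 2) (by norm_num) X
      have h2 : 2 ^ Nat.clog 2 X ≤ 2 ^ j := Nat.pow_le_pow_right (by norm_num) (by omega)
      omega
    have hle : 2 ^ (j + 1) ≤ N := (Nat.pow_le_pow_right (by norm_num) hlt).trans hN
    have t1 : Steps N (assign 12 (var 12 * const 2)) ν (ν.set 12 0 (2 ^ (j + 1) : ℕ)) 1 :=
      Steps.assign (by simp [h12, pow_succ]) (abs_natCast_le hle)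
    have t2 : Steps N (assign 13 (var 13 + const 1)) (ν.set 12 0 (2 ^ (j + 1) : ℕ))
        ((ν.set 12 0 (2 ^ (j + 1) : ℕ)).set 13 0 (j + 1 : ℕ)) 1 := by
      refine Steps.assign (by simp [Mem.set, h13]) (abs_natCast_le ?_)
      exact (Nat.lt_two_pow_self (n := j + 1)).le.trans hle
    refine ⟨n - 1, by omega, _, t1.cons (t2.cons Steps.nil), j + 1, by omega, ?_, ?_, ?_⟩
    · exact (hag.set (by simp) _ _).set (by simp) _ _
    · simp [Mem.set]
    · simp [Mem.set]
  · exact ((AgreeOff.refl _ _).set (by simp) _ _).set (by simp) _ _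
  · simp [Mem.set]
  · simp [Mem.set]

/-- The memory holds the circuit and the parameters of the algorithm. -/
structure HasParams (C : LinearFIXPCircuit d) (μ : Mem) : Prop where
  input : HasInput C μ
  den : μ 5 0 = C.denProd
  threshold : μ 11 0 = C.threshold
  scale : μ 12 0 = C.scale
  half : μ 14 0 = (2 ^ (C.bits - 1) : ℕ)

theorem HasParams.of_agreeOff {ν : Mem} {l : List ℕ} (h : HasParams C μ) (ha : AgreeOff l μ ν)
    (hl : 0 ∉ l ∧ 5 ∉ l ∧ 11 ∉ l ∧ 12 ∉ l ∧ 14 ∉ l) : HasParams C ν where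
  input := h.input.of_eq (ha 0 hl.1)
  den := by rw [ha 5 hl.2.1, h.den]
  threshold := by rw [ha 11 hl.2.2.1, h.threshold]
  scale := by rw [ha 12 hl.2.2.2.1, h.scale]
  half := by rw [ha 14 hl.2.2.2.2, h.half]

theorem one_le_bits (hd : 1 ≤ d) : 1 ≤ C.bits := by
  obtain ⟨-, b1, b2, b3, b4, b5, b6, b7, b8, b9⟩ := C.bounds hd
  by_contra h
  have : C.bits = 0 := by omega
  have : C.scale = 1 := by rw [LinearFIXPCircuit.scale, this, pow_zero]
  omega

theorem steps_paramProg (hd : 1 ≤ d) (hin : HasInput C μ) :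
    ∃ ν, Steps C.memBound paramProg μ ν (C.gates.length * 22 + d * 9 + C.bits * 4 + 60) ∧
      HasParams C ν ∧ ν 15 0 = ((C.bits + 1) ^ d - 1 : ℕ) := by
  obtain ⟨-, b1, b2, b3, b4, b5, b6, b7, b8, b9⟩ := C.bounds hd
  have hbase := LinearFIXPCircuit.one_le_base (C := C) hd
  have s1 : Steps C.memBound (assign 5 (const 1)) μ (μ.set 5 0 1) 1 :=
    Steps.assign rfl (by rw [abs_one]; omega)
  have s2 : Steps C.memBound (assign 6 (const 1)) (μ.set 5 0 1) ((μ.set 5 0 1).set 6 0 1) 1 :=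
    Steps.assign rfl (by rw [abs_one]; omega)
  have i2 : HasInput C ((μ.set 5 0 1).set 6 0 1) := hin.of_eq rfl
  have s3 := Steps.assign (b := 7) i2.gates (abs_natCast_le (N := C.memBound)
    (show C.gates.length ≤ C.memBound by omega))
  have i3 : HasInput C (((μ.set 5 0 1).set 6 0 1).set 7 0 C.gates.length) := hin.of_eq rfl
  obtain ⟨ν₄, s4, a4, h45, h46⟩ := steps_prodLoop hd i3 (by simp [Mem.set]) (by simp [Mem.set])
    (by simp [Mem.set])
  have i4 : HasInput C ν₄ := i3.of_eq (a4 0 (by simp))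
  have s5 : Steps C.memBound (assign 6 (const 2 * dimExpr * (var 5 * var 6))) ν₄
      (ν₄.set 6 0 C.base) 1 := by
    refine Steps.assign ?_ (abs_natCast_le (by omega))
    simp [i4.dim, h45, h46, LinearFIXPCircuit.base]
  have i5 : HasInput C (ν₄.set 6 0 C.base) := i4.of_eq rfl
  have s6 : Steps C.memBound (assign 7 (dimExpr + const 1)) (ν₄.set 6 0 C.base)
      ((ν₄.set 6 0 C.base).set 7 0 (d + 1 : ℕ)) 1 :=
    Steps.assign (by simp [i5.dim]) (abs_natCast_le (by omega))
  obtain ⟨ν₇, s7, a7, h7⟩ := steps_powProg (N := C.memBound) (a := 10) (b := 6) (x := C.base)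
    (e := d + 1) (μ := (ν₄.set 6 0 C.base).set 7 0 (d + 1 : ℕ)) (by norm_num) (by norm_num)
    (by norm_num) hbase (show C.cond ≤ C.memBound by omega) (by simp [Mem.set])
    (by simp [Mem.set])
  have i7 : HasInput C ν₇ := i5.of_eq (a7 0 (by simp))
  have h7' : ν₇ 10 0 = C.cond := h7
  have s8 : Steps C.memBound (assign 8 (const 4 * (var 10 * var 10 * var 10))) ν₇
      (ν₇.set 8 0 C.amp) 1 := by
    refine Steps.assign ?_ (abs_natCast_le (by omega))
    simp [h7', LinearFIXPCircuit.amp]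
    ring
  have i8 : HasInput C (ν₇.set 8 0 C.amp) := i7.of_eq rfl
  have s9 : Steps C.memBound (assign 7 (dimExpr + const 1)) (ν₇.set 8 0 C.amp)
      ((ν₇.set 8 0 C.amp).set 7 0 (d + 1 : ℕ)) 1 :=
    Steps.assign (by simp [i8.dim]) (abs_natCast_le (by omega))
  obtain ⟨ν₁₀, s10, a10, h10⟩ := steps_powProg (N := C.memBound) (a := 11) (b := 8) (x := C.amp)
    (e := d + 1) (μ := (ν₇.set 8 0 C.amp).set 7 0 (d + 1 : ℕ)) (by norm_num) (by norm_num)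
    (by norm_num) (by omega) (show C.threshold ≤ C.memBound by omega) (by simp [Mem.set])
    (by simp [Mem.set])
  have i10 : HasInput C ν₁₀ := i8.of_eq (a10 0 (by simp))
  have h10' : ν₁₀ 11 0 = C.threshold := h10
  have s11 : Steps C.memBound (assign 8 (var 11 * var 8)) ν₁₀
      (ν₁₀.set 8 0 (C.threshold * C.amp : ℕ)) 1 := by
    refine Steps.assign ?_ (abs_natCast_le (by have := C.threshold_mul_amp_le; omega))
    simp [h10', a10 8 (by simp), Mem.set]
  obtain ⟨ν₁₂, s12, a12, h12, h13⟩ := steps_doubling (N := C.memBound) (X := C.threshold * C.amp)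
    (μ := ν₁₀.set 8 0 (C.threshold * C.amp : ℕ)) (show C.scale ≤ C.memBound by omega)
    (by simp [Mem.set])
  replace s12 : Steps _ doubling _ ν₁₂ (C.bits * 4 + 4) := s12
  have h12' : ν₁₂ 12 0 = C.scale := h12
  have h13' : ν₁₂ 13 0 = C.bits := h13
  have hbits := one_le_bits (C := C) hd
  have hscale : C.scale = 2 ^ (C.bits - 1) * 2 := by
    rw [← pow_succ, Nat.sub_add_cancel hbits, LinearFIXPCircuit.scale]
  have s13 : Steps C.memBound (assign 14 (var 12 / const 2)) ν₁₂
      (ν₁₂.set 14 0 (2 ^ (C.bits - 1) : ℕ)) 1 := by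
    refine Steps.assign ?_ (abs_natCast_le (by omega))
    rw [val_div, val_var, val_const, h12', hscale]
    push_cast
    exact Int.mul_ediv_cancel _ (by norm_num)
  have hblt : C.bits + 1 ≤ C.scale := Nat.lt_two_pow_self
  have s14 : Steps C.memBound (assign 9 (var 13 + const 1)) (ν₁₂.set 14 0 (2 ^ (C.bits - 1) : ℕ))
      ((ν₁₂.set 14 0 (2 ^ (C.bits - 1) : ℕ)).set 9 0 (C.bits + 1 : ℕ)) 1 :=
    Steps.assign (by simp [Mem.set, h13']) (abs_natCast_le (by omega))
  have i14 : HasInput C ((ν₁₂.set 14 0 (2 ^ (C.bits - 1) : ℕ)).set 9 0 (C.bits + 1 : ℕ)) :=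
    i10.of_eq (a12 0 (by simp))
  have s15 := Steps.assign (b := 7) i14.dim (abs_natCast_le (N := C.memBound)
    (show d ≤ C.memBound by omega))
  obtain ⟨ν₁₆, s16, a16, h16⟩ := steps_powProg (N := C.memBound) (a := 15) (b := 9)
    (x := C.bits + 1) (e := d)
    (μ := ((ν₁₂.set 14 0 (2 ^ (C.bits - 1) : ℕ)).set 9 0 (C.bits + 1 : ℕ)).set 7 0 d)
    (by norm_num) (by norm_num) (by norm_num) (by omega) C.pow_bits_le (by simp [Mem.set])
    (by simp [Mem.set])
  have hpos : 1 ≤ (C.bits + 1) ^ d := Nat.one_le_pow _ _ (by omega)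
  have s17 : Steps C.memBound (assign 15 (var 15 - const 1)) ν₁₆
      (ν₁₆.set 15 0 ((C.bits + 1) ^ d - 1 : ℕ)) 1 := by
    refine Steps.assign ?_ (abs_natCast_le (by have := C.pow_bits_le; omega))
    rw [val_sub, val_var, val_const, h16]
    omega
  have total := s1.cons (s2.cons (s3.cons (s4.cons (s5.cons (s6.cons (s7.cons (s8.cons (s9.cons
    (s10.cons (s11.cons (s12.cons (s13.cons (s14.cons (s15.cons (s16.cons (s17.cons
    Steps.nil))))))))))))))))
  refine ⟨_, total.mono ?_, ⟨?_, ?_, ?_, ?_, ?_⟩, by simp [Mem.set]⟩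
  · linarith
  · exact i14.of_eq (a16 0 (by simp))
  · simp [Mem.set, a16 5 (by simp), a12 5 (by simp), a10 5 (by simp), a7 5 (by simp), h45]
  · simp [Mem.set, a16 11 (by simp), a12 11 (by simp), h10']
  · simp [Mem.set, a16 12 (by simp), h12']
  · simp [Mem.set, a16 14 (by simp)]

end Params

end RAM

/-! ### Exact evaluation of the circuit in scaled integers. -/

theorem LinearFIXPCircuit.isGrid_wire {d M : ℕ} (C : LinearFIXPCircuit d) {x : Fin d → ℝ}
    (hx : ∀ i, IsGrid M 1 (x i)) :
    ∀ j < d + C.gates.length,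
      IsGrid (M * C.denUpTo (j + 1 - d)) (C.growthUpTo (j + 1 - d)) (C.wire x j) := by
  refine C.wire_induction (fun i hi => ?_) fun k hk ih => ?_
  · rw [C.wire_input _ hi]
    exact (hx _).mono (dvd_mul_right _ _) (C.growthUpTo_pos _)
  · rw [show d + k + 1 - d = k + 1 by omega, C.denUpTo_succ hk, C.growthUpTo_succ hk,
      C.wire_gate _ hk, ← mul_assoc]
    have args : ∀ a ∈ (C.gates[k]).args,
        IsGrid (M * C.denUpTo k) (C.growthUpTo k) (C.wire x a) := by
      intro a ha
      have hlt := C.args_lt k hk a ha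
      exact (ih a ha).mono (mul_dvd_mul_left _ (C.denUpTo_mono (by omega) (by omega)))
        (C.growthUpTo_mono (by omega) (by omega))
    have hpos : 1 ≤ C.growthUpTo k := C.growthUpTo_pos k
    have hg1 := (C.gates[k]).natAbs_num_le_growth
    have hg2 := (C.gates[k]).two_le_growth
    revert args hg1 hg2
    generalize C.gates[k] = g
    intro args hg1 hg2
    have hm : C.growthUpTo k ≤ C.growthUpTo k * g.growth := Nat.le_mul_of_pos_right _ (by omega)
    have hm2 : C.growthUpTo k * 2 ≤ C.growthUpTo k * g.growth := Nat.mul_le_mul_left _ hg2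
    have hmn : C.growthUpTo k * g.num.natAbs ≤ C.growthUpTo k * g.growth :=
      Nat.mul_le_mul_left _ hg1
    cases g <;> simp only [LinGate.args, List.mem_cons, List.not_mem_nil, or_false,
      forall_eq_or_imp, forall_eq] at args <;> simp only [LinGate.evalFn]
    · exact (IsGrid.rat _).mono (dvd_mul_left _ _) (hmn.trans' (Nat.le_mul_of_pos_left _ hpos))
    · exact (args.1.add args.2).mono (dvd_mul_right _ _) hm2
    · exact (args.1.sub args.2).mono (dvd_mul_right _ _) hm2
    · rcases max_choice (C.wire x _) (C.wire x _) with h | h <;> rw [h]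
      exacts [args.1.mono (dvd_mul_right _ _) hm, args.2.mono (dvd_mul_right _ _) hm]
    · rcases min_choice (C.wire x _) (C.wire x _) with h | h <;> rw [h]
      exacts [args.1.mono (dvd_mul_right _ _) hm, args.2.mono (dvd_mul_right _ _) hm]
    · exact (args.rat_mul _).mono dvd_rfl hmn

namespace RAM

open RAM.Expr RAM.Prog

section Eval

variable {d : ℕ} {C : LinearFIXPCircuit d} {μ : Mem}

/-- At grid points a single factor clears the denominators of all wires, so the machine stores each
wire as one integer. Its size is at most the product of scale, denominators and growth, which stays
under the square of the scale. -/
theorem exists_int_wire (hd : 1 ≤ d) {x : Fin d → ℝ} (hx : ∀ i, IsGrid C.scale 1 (x i)) {j : ℕ}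
    (hj : j < d + C.gates.length) :
    ∃ v : ℤ, (v : ℝ) = C.wire x j * (C.scale * C.denProd) ∧ |v| ≤ C.memBound := by
  obtain ⟨⟨v, hv⟩, hb⟩ := (C.isGrid_wire hx j hj).mono
    (mul_dvd_mul_left C.scale (C.denUpTo_mono (show j + 1 - d ≤ C.gates.length by omega) le_rfl))
    (C.growthUpTo_mono (show j + 1 - d ≤ C.gates.length by omega) le_rfl)
  change _ * ((C.scale * C.denProd : ℕ) : ℝ) = _ at hv
  change _ ≤ (C.growthProd : ℝ) at hb
  push_cast at hv
  refine ⟨v, hv.symm, ?_⟩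
  have h1 : |(v : ℝ)| ≤ C.growthProd * (C.scale * C.denProd) := by
    rw [← hv, abs_mul, abs_of_nonneg (show (0 : ℝ) ≤ C.scale * C.denProd by positivity)]
    gcongr
  have h2 : C.growthProd * (C.scale * C.denProd) ≤ C.memBound := by
    obtain ⟨-, b1, b2, b3, b4, b5, b6, b7, b8, b9⟩ := C.bounds hd
    refine le_trans ?_ (LinearFIXPCircuit.scale_mul_scale_le hd)
    have h3 : C.denProd * C.growthProd ≤ C.base := Nat.le_mul_of_pos_left _ (by omega)
    calc C.growthProd * (C.scale * C.denProd) = C.denProd * C.growthProd * C.scale := by ring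
      _ ≤ C.scale * C.scale := Nat.mul_le_mul_right _ (by omega)
  have h3 : |(v : ℝ)| ≤ (C.memBound : ℝ) := h1.trans (by exact_mod_cast h2)
  exact_mod_cast h3

/-- Bank `2` holds the scaled values of the first `n` wires. -/
def HasWires (C : LinearFIXPCircuit d) (x : Fin d → ℝ) (n : ℕ) (μ : Mem) : Prop :=
  ∀ j < n, (μ 2 j : ℝ) = C.wire x j * (C.scale * C.denProd)

/-- The integer divisions for constants and scalings are exact, because the scaled value of the new
wire is known in advance to be an integer. Hence no rounding error enters the sign tests. -/
theorem steps_gateBody (hd : 1 ≤ d) (hμ : HasParams C μ) {x : Fin d → ℝ}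
    (hx : ∀ i, IsGrid C.scale 1 (x i)) {n : ℕ} (hn : n < C.gates.length) (h7 : μ 7 0 = n + 1)
    (hw : HasWires C x (d + (C.gates.length - (n + 1))) μ) :
    ∃ ν, Steps C.memBound gateBody μ ν 20 ∧ AgreeOff [2, 8, 9, 16, 21, 22] μ ν ∧
      HasWires C x (d + (C.gates.length - n)) ν := by
  obtain ⟨-, b1, b2, b3, b4, b5, b6, b7, b8, b9⟩ := C.bounds hd
  set k := C.gates.length - (n + 1) with hk
  have hkl : k < C.gates.length := by omega
  rw [show C.gates.length - n = k + 1 by omega]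
  have hcode : ∀ r < 4, μ 0 (2 + 4 * k + r) = (C.gates[k]).code.getD r 0 := fun r hr =>
    hμ.input.read_gate hkl hr
  have hcodeN : ∀ r < 4, |(C.gates[k]).code.getD r 0| ≤ C.memBound := by
    intro r hr
    rw [← C.code_getD_gate hkl hr]
    exact LinearFIXPCircuit.abs_code_getD_le hd _
  have hptr := hμ.input.gateExpr_val hn h7
  rw [← hk] at hptr
  have hargs := C.args_lt k hkl
  obtain ⟨v, hv, hvN⟩ := exists_int_wire hd hx (show d + k < d + C.gates.length by omega)
  rw [C.wire_gate x hkl] at hv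
  have hwire := C.wire_gate x hkl
  revert hcode hcodeN hargs hv hwire
  generalize C.gates[k] = g
  intro hcode hcodeN hargs hv hwire
  have s1 : Steps C.memBound (assign 16 gateExpr) μ (μ.set 16 0 (2 + 4 * k : ℕ)) 1 :=
    Steps.assign hptr (abs_natCast_le (by omega))
  have hread : ∀ ν : Mem, ν 16 0 = (2 + 4 * k : ℕ) → ν 0 = μ 0 → ∀ r : ℕ, r < 4 →
      (read 0 (var 16 + const r)).val ν = g.code.getD r 0 := by
    intro ν hν hν0 r hr
    rw [val_read (i := 2 + 4 * k + r) (by simp [hν]), hν0]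
    exact hcode r hr
  set μ₁ := μ.set 16 0 (2 + 4 * k : ℕ) with hμ₁
  have s2 : Steps C.memBound (assign 8 (read 0 (var 16 + const 1))) μ₁
      (μ₁.set 8 0 (g.code.getD 1 0)) 1 :=
    Steps.assign (hread μ₁ (by simp [μ₁, Mem.set]) rfl 1 (by omega)) (hcodeN 1 (by omega))
  set μ₂ := μ₁.set 8 0 (g.code.getD 1 0) with hμ₂
  have s3 : Steps C.memBound (assign 9 (read 0 (var 16 + const 2))) μ₂
      (μ₂.set 9 0 (g.code.getD 2 0)) 1 :=
    Steps.assign (hread μ₂ (by simp [μ₂, μ₁, Mem.set]) rfl 2 (by omega)) (hcodeN 2 (by omega))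
  set μ₃ := μ₂.set 9 0 (g.code.getD 2 0) with hμ₃
  have s4 : Steps C.memBound (assign 21 (read 0 (var 16 + const 3))) μ₃
      (μ₃.set 21 0 (g.code.getD 3 0)) 1 :=
    Steps.assign (hread μ₃ (by simp [μ₃, μ₂, μ₁, Mem.set]) rfl 3 (by omega)) (hcodeN 3 (by omega))
  set μ₄ := μ₃.set 21 0 (g.code.getD 3 0) with hμ₄
  have s5 : Steps C.memBound (assign 16 (read 0 (var 16))) μ₄
      (μ₄.set 16 0 (g.code.getD 0 0)) 1 := by
    refine Steps.assign ?_ (hcodeN 0 (by omega))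
    rw [val_read (i := 2 + 4 * k) (by simp [μ₄, μ₃, μ₂, μ₁, Mem.set])]
    exact hcode 0 (by omega)
  set μ₅ := μ₄.set 16 0 (g.code.getD 0 0) with hμ₅
  have agree₅ : AgreeOff [2, 8, 9, 16, 21, 22] μ μ₅ :=
    (((((AgreeOff.refl _ μ).set (by simp) _ _).set (by simp) _ _).set (by simp) _ _).set
      (by simp) _ _).set (by simp) _ _
  have e8 : μ₅ 8 0 = g.code.getD 1 0 := by simp [μ₅, μ₄, μ₃, μ₂, μ₁, Mem.set]
  have e9 : μ₅ 9 0 = g.code.getD 2 0 := by simp [μ₅, μ₄, μ₃, μ₂, μ₁, Mem.set]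
  have e21 : μ₅ 21 0 = g.code.getD 3 0 := by simp [μ₅, μ₄, μ₃, μ₂, μ₁, Mem.set]
  have e16 : μ₅ 16 0 = g.code.getD 0 0 := by simp [μ₅, μ₄, μ₃, μ₂, μ₁, Mem.set]
  have e5 : μ₅ 5 0 = C.denProd := by rw [agree₅ 5 (by simp), hμ.den]
  have e12 : μ₅ 12 0 = C.scale := by rw [agree₅ 12 (by simp), hμ.scale]
  have hw₅ : ∀ a, a < d + k → (μ₅ 2 a : ℝ) = C.wire x a * (C.scale * C.denProd) := by
    intro a ha
    have : μ₅ 2 = μ 2 := by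
      funext i
      simp [μ₅, μ₄, μ₃, μ₂, μ₁, Mem.set]
    rw [this]
    exact hw a ha
  have i5 : HasInput C μ₅ := hμ.input.of_eq rfl
  have h75 : μ₅ 7 0 = n + 1 := by rw [agree₅ 7 (by simp), h7]
  have r8 : ∀ a : ℕ, g.code.getD 1 0 = a → (read 2 (var 8)).val μ₅ = μ₅ 2 a :=
    fun a ha => val_read (by rw [val_var, e8, ha])
  have r9 : ∀ a : ℕ, g.code.getD 2 0 = a → (read 2 (var 9)).val μ₅ = μ₅ 2 a :=
    fun a ha => val_read (by rw [val_var, e9, ha])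
  clear_value μ₅
  have hpos : (0 : ℝ) < C.scale * C.denProd := by
    have h1 : 0 < C.scale := by omega
    have h2 : 0 < C.denProd := LinearFIXPCircuit.denProd_pos
    exact_mod_cast Nat.mul_pos h1 h2
  have key : Steps C.memBound
      (ite (var 16)
        (ite (var 16 - const 1)
          (ite (var 16 - const 2)
            (ite (var 16 - const 3)
              (ite (var 16 - const 4)
                (assign 22 (var 9 * read 2 (var 8) / var 21))
                (ite (read 2 (var 8) - read 2 (var 9))
                  (assign 22 (read 2 (var 9))) (assign 22 (read 2 (var 8)))))
              (ite (read 2 (var 8) - read 2 (var 9))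
                (assign 22 (read 2 (var 8))) (assign 22 (read 2 (var 9)))))
            (assign 22 (read 2 (var 8) - read 2 (var 9))))
          (assign 22 (read 2 (var 8) + read 2 (var 9))))
        (assign 22 (var 8 * (var 12 * var 5) / var 9))) μ₅ (μ₅.set 22 0 v) 7 := by
    cases g with
    | const q =>
      refine (Steps.ite_neg (by rw [val_var, e16]; exact le_rfl)
        (Steps.assign ?_ hvN)).mono (by norm_num)
      have hq : (q.den : ℤ) ≠ 0 := by exact_mod_cast q.den_ne_zero
      simp only [val_div, val_mul, val_var, e8, e9, e5, e12]
      refine Int.ediv_eq_of_eq_mul_left hq ?_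
      have h1 : (q : ℝ) * q.den = q.num := by exact_mod_cast Rat.mul_den_eq_num q
      have h2 : ((q.num * (C.scale * C.denProd) : ℤ) : ℝ) = ((v * q.den : ℤ) : ℝ) := by
        push_cast
        rw [hv, ← h1]
        simp only [LinGate.evalFn]
        ring
      exact_mod_cast h2
    | add a b =>
      refine (Steps.ite_pos (by rw [val_var, e16]; simp [LinGate.code])
        (Steps.ite_neg (by rw [val_sub, val_var, e16]; simp [LinGate.code])
        (Steps.assign ?_ hvN))).mono (by norm_num)
      rw [val_add, r8 a rfl, r9 b rfl]
      have h : ((μ₅ 2 a + μ₅ 2 b : ℤ) : ℝ) = v := by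
        push_cast
        rw [hw₅ a (hargs a (by simp [LinGate.args])), hw₅ b (hargs b (by simp [LinGate.args])), hv]
        simp only [LinGate.evalFn]
        ring
      exact_mod_cast h
    | sub a b =>
      refine (Steps.ite_pos (by rw [val_var, e16]; simp [LinGate.code])
        (Steps.ite_pos (by rw [val_sub, val_var, e16]; simp [LinGate.code])
        (Steps.ite_neg (by rw [val_sub, val_var, e16]; simp [LinGate.code])
        (Steps.assign ?_ hvN)))).mono (by norm_num)
      rw [val_sub, r8 a rfl, r9 b rfl]
      have h : ((μ₅ 2 a - μ₅ 2 b : ℤ) : ℝ) = v := by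
        push_cast
        rw [hw₅ a (hargs a (by simp [LinGate.args])), hw₅ b (hargs b (by simp [LinGate.args])), hv]
        simp only [LinGate.evalFn]
        ring
      exact_mod_cast h
    | max a b =>
      have ha := hw₅ a (hargs a (by simp [LinGate.args]))
      have hb := hw₅ b (hargs b (by simp [LinGate.args]))
      simp only [LinGate.evalFn] at hv
      rw [max_mul_of_nonneg _ _ hpos.le, ← ha, ← hb, ← Int.cast_max, Int.cast_inj] at hv
      refine (Steps.ite_pos (by rw [val_var, e16]; simp [LinGate.code])
        (Steps.ite_pos (by rw [val_sub, val_var, e16]; simp [LinGate.code])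
        (Steps.ite_pos (by rw [val_sub, val_var, e16]; simp [LinGate.code])
        (Steps.ite_neg (by rw [val_sub, val_var, e16]; simp [LinGate.code])
        (show Steps _ _ _ _ 2 from ?_))))).mono (by norm_num)
      rcases lt_or_ge 0 (μ₅ 2 a - μ₅ 2 b) with h | h
      · refine Steps.ite_pos (by rw [val_sub, r8 a rfl, r9 b rfl]; exact h) (Steps.assign ?_ hvN)
        rw [r8 a rfl, hv, max_eq_left (by omega)]
      · refine Steps.ite_neg (by rw [val_sub, r8 a rfl, r9 b rfl]; exact h) (Steps.assign ?_ hvN)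
        rw [r9 b rfl, hv, max_eq_right (by omega)]
    | min a b =>
      have ha := hw₅ a (hargs a (by simp [LinGate.args]))
      have hb := hw₅ b (hargs b (by simp [LinGate.args]))
      simp only [LinGate.evalFn] at hv
      rw [min_mul_of_nonneg _ _ hpos.le, ← ha, ← hb, ← Int.cast_min, Int.cast_inj] at hv
      refine (Steps.ite_pos (by rw [val_var, e16]; simp [LinGate.code])
        (Steps.ite_pos (by rw [val_sub, val_var, e16]; simp [LinGate.code])
        (Steps.ite_pos (by rw [val_sub, val_var, e16]; simp [LinGate.code])
        (Steps.ite_pos (by rw [val_sub, val_var, e16]; simp [LinGate.code])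
        (Steps.ite_neg (by rw [val_sub, val_var, e16]; simp [LinGate.code])
        (show Steps _ _ _ _ 2 from ?_)))))).mono (by norm_num)
      rcases lt_or_ge 0 (μ₅ 2 a - μ₅ 2 b) with h | h
      · refine Steps.ite_pos (by rw [val_sub, r8 a rfl, r9 b rfl]; exact h) (Steps.assign ?_ hvN)
        rw [r9 b rfl, hv, min_eq_right (by omega)]
      · refine Steps.ite_neg (by rw [val_sub, r8 a rfl, r9 b rfl]; exact h) (Steps.assign ?_ hvN)
        rw [r8 a rfl, hv, min_eq_left (by omega)]
    | scale ζ a =>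
      refine (Steps.ite_pos (by rw [val_var, e16]; simp [LinGate.code])
        (Steps.ite_pos (by rw [val_sub, val_var, e16]; simp [LinGate.code])
        (Steps.ite_pos (by rw [val_sub, val_var, e16]; simp [LinGate.code])
        (Steps.ite_pos (by rw [val_sub, val_var, e16]; simp [LinGate.code])
        (Steps.ite_pos (by rw [val_sub, val_var, e16]; simp [LinGate.code])
        (Steps.assign ?_ hvN)))))).mono (by norm_num)
      have hq : (ζ.den : ℤ) ≠ 0 := by exact_mod_cast ζ.den_ne_zero
      simp only [val_div, val_mul, val_var, e9, e21, r8 a rfl]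
      refine Int.ediv_eq_of_eq_mul_left hq ?_
      have h1 : (ζ : ℝ) * ζ.den = ζ.num := by exact_mod_cast Rat.mul_den_eq_num ζ
      have h2 : ((ζ.num * μ₅ 2 a : ℤ) : ℝ) = ((v * ζ.den : ℤ) : ℝ) := by
        push_cast
        rw [hv, ← h1, hw₅ a (hargs a (by simp [LinGate.args]))]
        simp only [LinGate.evalFn]
        ring
      exact_mod_cast h2
  have i6 : HasInput C (μ₅.set 22 0 v) := i5.of_eq rfl
  have s7 : Steps C.memBound (Prog.write 2 (dimExpr + (gatesExpr - var 7)) (var 22)) (μ₅.set 22 0 v)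
      ((μ₅.set 22 0 v).set 2 (d + k) v) 1 := by
    refine Steps.write ?_ (by simp [Mem.set]) hvN
    simp only [val_add, val_sub, val_var, i6.dim, i6.gates]
    simp only [Mem.set, h75, hk]
    norm_num
    omega
  refine ⟨_, (s1.cons (s2.cons (s3.cons (s4.cons (s5.cons (key.cons (s7.cons
    Steps.nil))))))).mono (by norm_num), (agree₅.set (by simp) _ _).set (by simp) _ _, ?_⟩
  intro j hj
  rcases eq_or_ne j (d + k) with rfl | hne
  · simp [Mem.set, hv, hwire]
  · rw [← hw₅ j (by omega)]
    simp [Mem.set, hne]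

theorem steps_evalProg (hd : 1 ≤ d) (hμ : HasParams C μ)
    (hr : ∀ i < d, 0 ≤ μ 3 i ∧ μ 3 i ≤ C.scale) :
    ∃ ν, Steps C.memBound evalProg μ ν (d * 3 + C.gates.length * 22 + 5) ∧
      AgreeOff [2, 7, 8, 9, 16, 21, 22] μ ν ∧
      HasWires C (Bisection.point C.scale (μ 3)) (d + C.gates.length) ν := by
  obtain ⟨-, b1, b2, b3, b4, b5, b6, b7, b8, b9⟩ := C.bounds hd
  have hscale : (0 : ℝ) < C.scale := by exact_mod_cast (show 0 < C.scale by omega)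
  have hx : ∀ i : Fin d, IsGrid C.scale 1 (Bisection.point (C.scale : ℤ) (μ 3) i) := by
    intro i
    obtain ⟨h1, h2⟩ := hr i i.2
    have h1' : (0 : ℝ) ≤ μ 3 i := by exact_mod_cast h1
    have h2' : (μ 3 i : ℝ) ≤ C.scale := by exact_mod_cast h2
    refine ⟨⟨μ 3 i, ?_⟩, ?_⟩
    · simp only [Bisection.point, Int.cast_natCast]
      field_simp
    · simp only [Bisection.point, Int.cast_natCast, Nat.cast_one]
      rw [abs_of_nonneg (by positivity)]
      exact (div_le_one hscale).2 h2'
  have s1 : Steps C.memBound (assign 7 dimExpr) μ (μ.set 7 0 d) 1 :=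
    Steps.assign hμ.input.dim (abs_natCast_le (by omega))
  have H := Steps.forLoop (N := C.memBound) (b := 7)
    (c := Prog.write 2 (var 7 - const 1) (read 3 (var 7 - const 1) * var 5)) (μ := μ.set 7 0 d)
    (fun n ν => n ≤ d ∧ AgreeOff [2, 7] μ ν ∧
      ∀ j, n ≤ j → j < d → ν 2 j = μ 3 j * C.denProd) (k := 1) ?_ d
    ⟨le_rfl, (AgreeOff.refl _ _).set (by simp) _ _, fun j h1 h2 => by omega⟩ (by simp [Mem.set])
  · obtain ⟨ν₂, s2, ⟨-, a2, w2⟩, -⟩ := H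
    have p2 : HasParams C ν₂ := hμ.of_agreeOff a2 (by simp)
    have s3 : Steps C.memBound (assign 7 gatesExpr) ν₂ (ν₂.set 7 0 C.gates.length) 1 :=
      Steps.assign p2.input.gates (abs_natCast_le (by omega))
    have H := Steps.forLoop (N := C.memBound) (b := 7) (c := gateBody)
      (μ := ν₂.set 7 0 C.gates.length)
      (fun n ν => n ≤ C.gates.length ∧ AgreeOff [2, 7, 8, 9, 16, 21, 22] μ ν ∧
        HasWires C (Bisection.point C.scale (μ 3)) (d + (C.gates.length - n)) ν) (k := 20) ?_
      C.gates.length ⟨le_rfl, (a2.mono (by simp)).set (by simp) _ _, ?_⟩ (by simp [Mem.set])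
    · obtain ⟨ν₄, s4, ⟨-, a4, w4⟩, -⟩ := H
      exact ⟨ν₄, (s1.cons (s2.cons (s3.cons (s4.cons Steps.nil)))).mono (by omega), a4, w4⟩
    · rintro n ν ⟨hn, ha, hw⟩ h7
      obtain ⟨ξ, s, ha', hw'⟩ := steps_gateBody hd (hμ.of_agreeOff ha (by simp)) hx
        (by omega) h7 hw
      refine ⟨ξ, s, by rw [ha' 7 (by simp), h7], by omega,
        (ha.extend ha' (by simp)).set (by simp) _ _, fun j hj => ?_⟩
      simpa [Mem.set] using hw' j hj
    · intro j hj
      have hj' : j < d := by omega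
      have e : (ν₂.set 7 0 C.gates.length) 2 j = ν₂ 2 j := by simp [Mem.set]
      rw [e, w2 j (Nat.zero_le _) hj', C.wire_input _ hj']
      simp only [Bisection.point]
      push_cast
      field_simp
  · rintro n ν ⟨hn, ha, hw⟩ h7
    have hT : ν 3 = μ 3 := ha 3 (by simp)
    obtain ⟨h1, h2⟩ := hr n (by omega)
    have hidx : (var 7 - const 1).val ν = n := by
      rw [val_sub, val_var, val_const, h7]
      omega
    refine ⟨_, Steps.write hidx (v := μ 3 n * C.denProd) ?_ ?_, ?_, by omega, ?_, ?_⟩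
    · rw [val_mul, val_read hidx, hT, val_var, ha 5 (by simp), hμ.den]
    · rw [abs_of_nonneg (by positivity)]
      have h3 : C.scale * C.denProd ≤ C.memBound :=
        (Nat.mul_le_mul_left _ (by omega)).trans (LinearFIXPCircuit.scale_mul_scale_le hd)
      have h4 : μ 3 n * C.denProd ≤ C.scale * C.denProd := by gcongr
      exact h4.trans (by exact_mod_cast h3)
    · simpa [Mem.set] using h7
    · exact (ha.set (by simp) _ _).set (by simp) _ _
    · intro j h1 h2
      rcases eq_or_ne j n with rfl | hne
      · simp [Mem.set]
      · simpa [Mem.set, hne] using hw j (by omega) h2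

end Eval

end RAM

namespace RAM

open RAM.Expr RAM.Prog

/-! ### Correctness of the bisection and of the Euclidean loop. -/

section Main

variable {d : ℕ} {C : LinearFIXPCircuit d} {μ : Mem}

theorem steps_initProg (hd : 1 ≤ d) (hμ : HasParams C μ) :
    ∃ ν, Steps C.memBound initProg μ ν (d * 5 + 3) ∧ AgreeOff [3, 4, 7] μ ν ∧
      ∀ i < d, ν 3 i = (2 ^ (C.bits - 1) : ℕ) ∧ ν 4 i = (2 ^ (C.bits - 1) : ℕ) := by
  obtain ⟨-, b1, b2, b3, b4, b5, b6, b7, b8, b9⟩ := C.bounds hd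
  have s1 : Steps C.memBound (assign 7 dimExpr) μ (μ.set 7 0 d) 1 :=
    Steps.assign hμ.input.dim (abs_natCast_le (by omega))
  have hhalf : 2 ^ (C.bits - 1) ≤ C.scale := Nat.pow_le_pow_right (by norm_num) (by omega)
  have h14 := hμ.half
  generalize 2 ^ (C.bits - 1) = H at hhalf h14 ⊢
  have hN : |(H : ℤ)| ≤ C.memBound := abs_natCast_le (by omega)
  have loop := Steps.forLoop (N := C.memBound) (b := 7)
    (c := block [Prog.write 3 (var 7 - const 1) (var 14), Prog.write 4 (var 7 - const 1) (var 14)])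
    (μ := μ.set 7 0 d)
    (fun n ν => n ≤ d ∧ AgreeOff [3, 4, 7] μ ν ∧
      ∀ i, n ≤ i → i < d → ν 3 i = H ∧ ν 4 i = H)
    (k := 3) ?_ d
    ⟨le_rfl, (AgreeOff.refl _ _).set (by simp) _ _, fun j h1 h2 => by omega⟩ (by simp [Mem.set])
  · obtain ⟨ν, s, ⟨-, ha, h⟩, -⟩ := loop
    refine ⟨ν, (s1.cons (s.cons Steps.nil)).mono (by omega), ha, fun i hi => ?_⟩
    exact h i (Nat.zero_le _) hi
  · rintro n ν ⟨hn, ha, h⟩ h7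
    have t1 : Steps C.memBound (Prog.write 3 (var 7 - const 1) (var 14)) ν
        (ν.set 3 n H) 1 := by
      refine Steps.write ?_ ?_ hN
      · rw [val_sub, val_var, val_const, h7]
        omega
      · rw [val_var, ha 14 (by simp), h14]
    have t2 : Steps C.memBound (Prog.write 4 (var 7 - const 1) (var 14))
        (ν.set 3 n H)
        ((ν.set 3 n H).set 4 n H) 1 := by
      refine Steps.write ?_ ?_ hN
      · simp [Mem.set, h7]
      · have h14' : ν 14 0 = H := by rw [ha 14 (by simp), h14]
        simp [Mem.set, h14']
    refine ⟨_, (t1.cons (t2.cons Steps.nil)).mono (by norm_num), by simpa [Mem.set] using h7, by omega,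
      ((ha.set (by simp) _ _).set (by simp) _ _).set (by simp) _ _, fun i h1 h2 => ?_⟩
    rcases eq_or_ne i n with rfl | hne
    · simp [Mem.set]
    · simpa [Mem.set, hne] using h i (by omega) h2

-- The loop follows the recursion of `Bisection.carry` with its counter as the recursion argument;
-- advancing a coordinate sets the counter to `0` and so ends the loop.
open Classical in
theorem steps_carryLoop (hd : 1 ≤ d) {t : ℕ → ℤ} (e : ℕ) (he : e ≤ d) (hμ : HasParams C μ)
    (hw : HasWires C (Bisection.point C.scale t) (d + C.gates.length) μ) (h7 : μ 7 0 = e)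
    (hr : ∀ i < d, Bisection.InRange C.scale (μ 3 i) (μ 4 i)) :
    ∃ ν, Steps C.memBound (Prog.loop (var 7) carryBody) μ ν (e * 10 + 1) ∧
      AgreeOff [3, 4, 7] μ ν ∧
      (ν 3, ν 4) = Bisection.carry (2 ^ (C.bits - 1)) (Bisection.Rejects C.eval C.scale t) e
        (μ 3, μ 4) := by
  obtain ⟨-, b1, b2, b3, b4, b5, b6, b7, b8, b9⟩ := C.bounds hd
  induction e generalizing μ with
  | zero => exact ⟨μ, Steps.loop_done (le_of_eq h7), AgreeOff.refl _ _, rfl⟩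
  | succ e ih =>
    have hpos : 0 < (var 7).val μ := by
      rw [val_var, h7]
      omega
    have hidx : (var 7 - const 1).val μ = e := by
      rw [val_sub, val_var, val_const, h7]
      omega
    have hed : e < d := by omega
    obtain ⟨r1, r2, r3, r4⟩ := hr e hed
    have hNs : (C.scale : ℤ) ≤ C.memBound := by omega
    rw [Bisection.carry]
    split_ifs with hstep
    · have htest : (read 2 (var 7 - const 1) -
          read 2 (read 0 (const 2 + const 4 * gatesExpr + (var 7 - const 1)))).val μ =
          μ 2 e - μ 2 (C.out ⟨e, hed⟩) := by
        rw [val_sub, val_read hidx]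
        have h1 : (const 2 + const 4 * gatesExpr + (var 7 - const 1)).val μ =
            (2 + 4 * C.gates.length + e : ℕ) := by
          rw [val_add, val_add, val_mul, hidx, hμ.input.gates]
          simp
        have h2 := C.code_getD_out ⟨e, hed⟩
        rw [val_read (i := C.out ⟨e, hed⟩) (by rw [val_read h1, hμ.input]; exact h2)]
      have hscale : (0 : ℝ) < C.scale * C.denProd := by
        have h1 : 0 < C.scale := by omega
        have h2 : 0 < C.denProd := LinearFIXPCircuit.denProd_pos
        exact_mod_cast Nat.mul_pos h1 h2
      -- Input wire and output wire carry the same positive scaling factor, so comparing the stored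
      -- integers decides the sign of the residual.
      have hiff : Bisection.Rejects C.eval C.scale t e ↔ 0 < μ 2 e - μ 2 (C.out ⟨e, hed⟩) := by
        have h1 := hw e (by omega)
        have h2 := hw (C.out ⟨e, hed⟩) (C.out_lt _)
        rw [C.wire_input _ hed] at h1
        rw [sub_pos, ← Int.cast_lt (R := ℝ), h1, h2, mul_lt_mul_iff_left₀ hscale]
        exact ⟨fun ⟨_, h⟩ => h, fun h => ⟨hed, h⟩⟩
      have choice : ∃ u, (u = if Bisection.Rejects C.eval C.scale t e then μ 3 e - μ 4 e
          else μ 3 e) ∧ ∃ ν, Steps C.memBound (ite (read 2 (var 7 - const 1) -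
          read 2 (read 0 (const 2 + const 4 * gatesExpr + (var 7 - const 1))))
        (Prog.write 3 (var 7 - const 1) (read 3 (var 7 - const 1) - read 4 (var 7 - const 1)))
        skip) μ ν 2 ∧ ν 4 = μ 4 ∧ ν 3 = Function.update (μ 3) e u ∧ AgreeOff [3, 4, 7] μ ν ∧
        ν 7 0 = e + 1 := by
        by_cases hrej : Bisection.Rejects C.eval C.scale t e
        · refine ⟨_, (if_pos hrej).symm, _, Steps.ite_pos (by rw [htest]; exact hiff.1 hrej)
            (Steps.write hidx (v := μ 3 e - μ 4 e) ?_ ?_), rfl, Mem.set_self _ _ _ _,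
            (AgreeOff.refl _ _).set (by simp) _ _, by simpa [Mem.set] using h7⟩
          · rw [val_sub, val_read hidx, val_read hidx]
          · rw [abs_le]
            constructor <;> omega
        · refine ⟨_, (if_neg hrej).symm, μ, Steps.ite_neg
            (by rw [htest]; exact not_lt.1 fun h => hrej (hiff.2 h)) Steps.skip, rfl, ?_,
            AgreeOff.refl _ _, by simpa using h7⟩
          rw [Function.update_eq_self]
      obtain ⟨u, hu, ν₁, t1, e4, e3, ha, e7⟩ := choice
      have hu0 : 0 ≤ u ∧ u ≤ C.scale := by
        rw [hu]
        split_ifs <;> omega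
      have huw : u + μ 4 e / 2 ≤ C.scale := by
        rw [hu]
        split_ifs <;> omega
      have idx₁ : (var 7 - const 1).val ν₁ = e := by
        rw [val_sub, val_var, val_const, e7]
        omega
      have t2 : Steps C.memBound (Prog.write 4 (var 7 - const 1) (read 4 (var 7 - const 1) / const 2))
          ν₁ (ν₁.set 4 e (μ 4 e / 2)) 1 := by
        refine Steps.write idx₁ ?_ ?_
        · rw [val_div, val_read idx₁, e4, val_const]
        · rw [abs_le]
          constructor <;> omega
      have idx₂ : (var 7 - const 1).val (ν₁.set 4 e (μ 4 e / 2)) = e := by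
        rw [val_sub, val_var, val_const, Mem.set_of_ne _ _ _ (by norm_num), e7]
        omega
      have t3 : Steps C.memBound (Prog.write 3 (var 7 - const 1)
          (read 3 (var 7 - const 1) + read 4 (var 7 - const 1))) (ν₁.set 4 e (μ 4 e / 2))
          ((ν₁.set 4 e (μ 4 e / 2)).set 3 e (u + μ 4 e / 2)) 1 := by
        refine Steps.write idx₂ ?_ ?_
        · rw [val_add, val_read idx₂, val_read idx₂, Mem.set_of_ne _ _ _ (by norm_num), Mem.set_self,
            e3, Function.update_self, Function.update_self]
        · rw [abs_le]
          constructor <;> omega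
      have t4 : Steps C.memBound (assign 7 (const 0))
          ((ν₁.set 4 e (μ 4 e / 2)).set 3 e (u + μ 4 e / 2))
          (((ν₁.set 4 e (μ 4 e / 2)).set 3 e (u + μ 4 e / 2)).set 7 0 0) 1 :=
        Steps.assign rfl (by simp)
      have body := Steps.ite_pos (e := read 4 (var 7 - const 1))
        (c₂ := block [Prog.write 3 (var 7 - const 1) (var 14),
          Prog.write 4 (var 7 - const 1) (var 14), assign 7 (var 7 - const 1)])
        (by rw [val_read hidx]; exact hstep)
        (t1.cons (t2.cons (t3.cons (t4.cons Steps.nil))))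
      refine ⟨_, (Steps.loop_step hpos body (Steps.loop_done ?_)).mono (by omega),
        ((ha.set (by simp) _ _).set (by simp) _ _).set (by simp) _ _, ?_⟩
      · simp [Mem.set]
      · rw [Bisection.choose, Mem.set_of_ne _ _ _ (by norm_num), Mem.set_self,
          Mem.set_of_ne _ _ _ (by norm_num), Mem.set_of_ne _ _ _ (by norm_num),
          Mem.set_of_ne _ _ _ (by norm_num), Mem.set_self, e3, e4, Function.update_idem, hu]
    · have hhalf : 2 ^ (C.bits - 1) ≤ C.scale := Nat.pow_le_pow_right (by norm_num) (by omega)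
      have hN : |((2 ^ (C.bits - 1) : ℕ) : ℤ)| ≤ C.memBound := abs_natCast_le (by omega)
      set H : ℤ := ((2 ^ (C.bits - 1) : ℕ) : ℤ) with hH
      have t1 : Steps C.memBound (Prog.write 3 (var 7 - const 1) (var 14)) μ (μ.set 3 e H) 1 :=
        Steps.write hidx hμ.half hN
      have t2 : Steps C.memBound (Prog.write 4 (var 7 - const 1) (var 14)) (μ.set 3 e H)
          ((μ.set 3 e H).set 4 e H) 1 := by
        refine Steps.write ?_ ?_ hN
        · simp [Mem.set, h7]
        · have h14 := hμ.half
          simp [Mem.set, h14, H]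
      have t3 : Steps C.memBound (assign 7 (var 7 - const 1)) ((μ.set 3 e H).set 4 e H)
          (((μ.set 3 e H).set 4 e H).set 7 0 e) 1 :=
        Steps.assign (by simp [Mem.set, h7]) (abs_natCast_le (by omega))
      have body := Steps.ite_neg (e := read 4 (var 7 - const 1))
        (c₁ := block [
          ite (read 2 (var 7 - const 1) -
              read 2 (read 0 (const 2 + const 4 * gatesExpr + (var 7 - const 1))))
            (Prog.write 3 (var 7 - const 1) (read 3 (var 7 - const 1) - read 4 (var 7 - const 1)))
            skip,
          Prog.write 4 (var 7 - const 1) (read 4 (var 7 - const 1) / const 2),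
          Prog.write 3 (var 7 - const 1) (read 3 (var 7 - const 1) + read 4 (var 7 - const 1)),
          assign 7 (const 0)])
        (by rw [val_read hidx]; exact not_lt.1 hstep)
        (t1.cons (t2.cons (t3.cons Steps.nil)))
      have a3 : AgreeOff [3, 4, 7] μ (((μ.set 3 e H).set 4 e H).set 7 0 e) :=
        (((AgreeOff.refl _ _).set (by simp) _ _).set (by simp) _ _).set (by simp) _ _
      have m3 : (((μ.set 3 e H).set 4 e H).set 7 0 e) 3 = Function.update (μ 3) e H := by
        rw [Mem.set_of_ne _ _ _ (by norm_num), Mem.set_of_ne _ _ _ (by norm_num), Mem.set_self]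
      have m4 : (((μ.set 3 e H).set 4 e H).set 7 0 e) 4 = Function.update (μ 4) e H := by
        rw [Mem.set_of_ne _ _ _ (by norm_num), Mem.set_self, Mem.set_of_ne _ _ _ (by norm_num)]
      have hHH : H + H = C.scale := by
        rw [hH, LinearFIXPCircuit.scale, ← Nat.cast_add, ← mul_two, ← pow_succ,
          Nat.sub_add_cancel (one_le_bits hd)]
      have hHpos : 0 < H := by
        rw [hH]
        positivity
      obtain ⟨ν, s, ha, hν⟩ := ih (μ := ((μ.set 3 e H).set 4 e H).set 7 0 e) (by omega)
        (hμ.of_agreeOff a3 (by simp)) (by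
          intro j hj
          have : (((μ.set 3 e H).set 4 e H).set 7 0 e) 2 = μ 2 := a3 2 (by simp)
          rw [this]
          exact hw j hj) (by simp [Mem.set]) (by
          rw [m3, m4]
          intro i hi
          rcases eq_or_ne i e with rfl | hne
          · simp only [Function.update_self]
            exact ⟨hHpos.le, le_rfl, hHH.le, by omega⟩
          · simpa [hne] using hr i hi)
      refine ⟨ν, (Steps.loop_step hpos body s).mono (by omega), a3.extend ha (by simp), ?_⟩
      rw [hν, m3, m4, Bisection.reset]
      simp [H]

theorem steps_tickProg (hd : 1 ≤ d) (hμ : HasParams C μ)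
    (hr : ∀ i < d, Bisection.InRange C.scale (μ 3 i) (μ 4 i)) :
    ∃ ν, Steps C.memBound tickProg μ ν (d * 13 + C.gates.length * 22 + 10) ∧
      AgreeOff [2, 3, 4, 7, 8, 9, 16, 21, 22] μ ν ∧
      (ν 3, ν 4) = Bisection.tick C.eval C.scale (2 ^ (C.bits - 1)) (μ 3, μ 4) := by
  obtain ⟨-, b1, b2, b3, b4, b5, b6, b7, b8, b9⟩ := C.bounds hd
  obtain ⟨ν₁, s1, a1, w1⟩ := steps_evalProg hd hμ fun i hi => by
    obtain ⟨h1, h2, h3, h4⟩ := hr i hi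
    omega
  have p1 : HasParams C ν₁ := hμ.of_agreeOff a1 (by simp)
  have s2 : Steps C.memBound (assign 7 dimExpr) ν₁ (ν₁.set 7 0 d) 1 :=
    Steps.assign p1.input.dim (abs_natCast_le (by omega))
  have a2 : AgreeOff [2, 7, 8, 9, 16, 21, 22] μ (ν₁.set 7 0 d) := a1.set (by simp) _ _
  have m3 : (ν₁.set 7 0 d) 3 = μ 3 := a2 3 (by simp)
  have m4 : (ν₁.set 7 0 d) 4 = μ 4 := a2 4 (by simp)
  obtain ⟨ν₃, s3, a3, h3⟩ := steps_carryLoop (μ := ν₁.set 7 0 d) hd (t := μ 3) d le_rfl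
    (hμ.of_agreeOff a2 (by simp)) (fun j hj => by simpa [Mem.set] using w1 j hj)
    (by simp [Mem.set]) (by rw [m3, m4]; exact hr)
  refine ⟨ν₃, (s1.cons (s2.cons (s3.cons Steps.nil))).mono (by omega),
    (a2.mono (by simp)).extend a3 (by simp), ?_⟩
  rw [h3, m3, m4]
  rfl

theorem steps_tickLoop (hd : 1 ≤ d) (hμ : HasParams C μ)
    (hr : ∀ i < d, Bisection.InRange C.scale (μ 3 i) (μ 4 i)) {n : ℕ} (h15 : μ 15 0 = n) :
    ∃ ν, Steps C.memBound (forLoop 15 tickProg) μ ν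
        (n * (d * 13 + C.gates.length * 22 + 12) + 1) ∧
      AgreeOff [2, 3, 4, 7, 8, 9, 15, 16, 21, 22] μ ν ∧
      (ν 3, ν 4) = (Bisection.tick C.eval C.scale (2 ^ (C.bits - 1)))^[n] (μ 3, μ 4) := by
  have hHH : (2 : ℤ) ^ (C.bits - 1) + 2 ^ (C.bits - 1) ≤ C.scale := by
    rw [LinearFIXPCircuit.scale, ← mul_two, ← pow_succ, Nat.sub_add_cancel (one_le_bits hd)]
    simp
  have H := Steps.forLoop (N := C.memBound) (b := 15) (c := tickProg) (μ := μ)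
    (fun k ν => k ≤ n ∧ AgreeOff [2, 3, 4, 7, 8, 9, 15, 16, 21, 22] μ ν ∧
      (ν 3, ν 4) = (Bisection.tick C.eval C.scale (2 ^ (C.bits - 1)))^[n - k] (μ 3, μ 4))
    (k := d * 13 + C.gates.length * 22 + 10) ?_ n
    ⟨le_rfl, AgreeOff.refl _ _, by simp⟩ h15
  · obtain ⟨ν, s, ⟨-, ha, h⟩, -⟩ := H
    exact ⟨ν, s, ha, h⟩
  · rintro k ν ⟨hk, ha, h⟩ hν
    have hr' := Bisection.iterate_tick_inRange C.eval (by positivity) hHH (s := (μ 3, μ 4)) hr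
      (n - (k + 1))
    rw [← h] at hr'
    obtain ⟨ξ, s, ha', h'⟩ := steps_tickProg hd (hμ.of_agreeOff ha (by simp)) hr'
    refine ⟨ξ, s, by rw [ha' 15 (by simp), hν], by omega,
      (ha.extend ha' (by simp)).set (by simp) _ _, ?_⟩
    rw [Mem.set_of_ne _ _ _ (by norm_num), Mem.set_of_ne _ _ _ (by norm_num), h', h,
      ← Function.iterate_succ_apply' (Bisection.tick C.eval C.scale (2 ^ (C.bits - 1)))]
    congr 2
    omega

theorem steps_euclidLoop {N : ℕ} {M n S : ℤ} (hS : 0 ≤ S) (hMN : M ≤ N) (h11 : μ 11 0 = S) (e : ℕ)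
    (hinv : RationalReconstruction.Inv M n S (μ 17 0) (μ 18 0) (μ 19 0) (μ 20 0))
    (he : μ 17 0 * μ 18 0 < 2 ^ e) :
    ∃ ν, Steps N (Prog.loop (var 18 - var 11) euclidBody) μ ν (e * 10 + 1) ∧
      AgreeOff [17, 18, 19, 20, 21, 22] μ ν ∧
      RationalReconstruction.Inv M n S (ν 17 0) (ν 18 0) (ν 19 0) (ν 20 0) ∧ ν 18 0 ≤ S := by
  have H := Steps.loop (N := N) (e := var 18 - var 11) (c := euclidBody) (μ := μ)
    (fun k ν => AgreeOff [17, 18, 19, 20, 21, 22] μ ν ∧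
      RationalReconstruction.Inv M n S (ν 17 0) (ν 18 0) (ν 19 0) (ν 20 0) ∧
      ν 17 0 * ν 18 0 < 2 ^ k) (k := 9) ?_ e ⟨AgreeOff.refl _ _, hinv, he⟩
  · obtain ⟨ν, n', s, ⟨ha, hI, -⟩, hexit⟩ := H
    refine ⟨ν, s, ha, hI, ?_⟩
    rw [val_sub, val_var, val_var, ha 11 (by simp), h11] at hexit
    omega
  · rintro k ν ⟨ha, hI, hk⟩ hpos
    rw [val_sub, val_var, val_var, ha 11 (by simp), h11] at hpos
    generalize ea : ν 17 0 = a at hI hk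
    generalize eb : ν 18 0 = b at hI hk hpos
    generalize eu : ν 19 0 = u at hI
    generalize ev : ν 20 0 = v at hI
    have hb : S < b := by omega
    have hstep := hI.step hS hb
    obtain ⟨c1, c2, c3, c4, c5⟩ := hI.bounds
    obtain ⟨c1', c2', c3', c4', c5'⟩ := hstep.bounds
    have hhalf := hI.two_mul_le (by omega)
    have hq : 0 < a / b := hI.ediv_pos (by omega)
    have hqa : a / b ≤ a := Int.ediv_le_self _ c1
    have hlt := hI.lt
    have hb0 := hI.nonneg
    have hu0 := hI.u_nonneg
    have hv0 := hI.v_pos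
    have hr0 := hstep.nonneg
    have hv0' := hstep.v_pos
    have k1 : 0 < k := by
      rcases Nat.eq_zero_or_pos k with rfl | h
      · have : 0 < a * b := mul_pos (by omega) (by omega)
        rw [pow_zero] at hk
        omega
      · exact h
    have t1 : Steps N (assign 21 (var 17 / var 18)) ν (ν.set 21 0 (a / b)) 1 :=
      Steps.assign (by rw [val_div, val_var, val_var, ea, eb])
        (by rw [abs_le]; constructor <;> omega)
    have t2 : Steps N (assign 22 (var 17 - var 21 * var 18)) (ν.set 21 0 (a / b))
        ((ν.set 21 0 (a / b)).set 22 0 (a - a / b * b)) 1 :=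
      Steps.assign (by simp [Mem.set, ea, eb]) (by rw [abs_le]; constructor <;> omega)
    have t3 : Steps N (assign 17 (var 18)) ((ν.set 21 0 (a / b)).set 22 0 (a - a / b * b))
        (((ν.set 21 0 (a / b)).set 22 0 (a - a / b * b)).set 17 0 b) 1 :=
      Steps.assign (by simp [Mem.set, eb]) (by rw [abs_le]; constructor <;> omega)
    have t4 : Steps N (assign 18 (var 22))
        (((ν.set 21 0 (a / b)).set 22 0 (a - a / b * b)).set 17 0 b)
        ((((ν.set 21 0 (a / b)).set 22 0 (a - a / b * b)).set 17 0 b).set 18 0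
          (a - a / b * b)) 1 :=
      Steps.assign (by simp [Mem.set]) (by rw [abs_le]; constructor <;> omega)
    set ν₄ := (((ν.set 21 0 (a / b)).set 22 0 (a - a / b * b)).set 17 0 b).set 18 0
          (a - a / b * b) with hν₄
    have d17 : ν₄ 17 0 = b := by simp [ν₄, Mem.set]
    have d18 : ν₄ 18 0 = a - a / b * b := by simp [ν₄, Mem.set]
    have d19 : ν₄ 19 0 = u := by simp [ν₄, Mem.set, eu]
    have d20 : ν₄ 20 0 = v := by simp [ν₄, Mem.set, ev]
    have d21 : ν₄ 21 0 = a / b := by simp [ν₄, Mem.set]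
    have a4 : AgreeOff [17, 18, 19, 20, 21, 22] μ ν₄ :=
      (((ha.set (by simp) _ _).set (by simp) _ _).set (by simp) _ _).set (by simp) _ _
    clear_value ν₄
    have t5 : Steps N (assign 22 (var 19 + var 21 * var 20)) ν₄
        (ν₄.set 22 0 (u + a / b * v)) 1 :=
      Steps.assign (by simp [d19, d20, d21]) (by rw [abs_le]; constructor <;> omega)
    have t6 : Steps N (assign 19 (var 20)) (ν₄.set 22 0 (u + a / b * v))
        ((ν₄.set 22 0 (u + a / b * v)).set 19 0 v) 1 :=
      Steps.assign (by simp [Mem.set, d20]) (by rw [abs_le]; constructor <;> omega)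
    have t7 : Steps N (assign 20 (var 22)) ((ν₄.set 22 0 (u + a / b * v)).set 19 0 v)
        (((ν₄.set 22 0 (u + a / b * v)).set 19 0 v).set 20 0 (u + a / b * v)) 1 :=
      Steps.assign (by simp [Mem.set]) (by rw [abs_le]; constructor <;> omega)
    refine ⟨k - 1, by omega, _, (t1.cons (t2.cons (t3.cons (t4.cons (t5.cons (t6.cons (t7.cons
      Steps.nil))))))).mono (by norm_num),
      ((a4.set (by simp) _ _).set (by simp) _ _).set (by simp) _ _, ?_, ?_⟩
    · simpa [Mem.set, d17, d18] using hstep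
    · have h2 : (2 : ℤ) ^ k = 2 ^ (k - 1) * 2 := by
        rw [← pow_succ]
        congr 1
        omega
      have : b * (a - a / b * b) < 2 ^ (k - 1) := by omega
      simpa [Mem.set, d17, d18] using this

end Main

end RAM

namespace RAM

open RAM.Expr RAM.Prog

/-! ### Correctness of the reconstruction loop. -/

section Output

variable {d : ℕ} {C : LinearFIXPCircuit d} {μ : Mem}

theorem steps_outputBody (hd : 1 ≤ d) (hμ : HasParams C μ) {n : ℕ} (h7 : μ 7 0 = n + 1)
    (h0 : 0 ≤ μ 3 n) (hlt : μ 3 n < C.scale) :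
    ∃ ν, Steps C.memBound outputBody μ ν (C.bits * 20 + 8) ∧
      AgreeOff [1, 17, 18, 19, 20, 21, 22] μ ν ∧ ∃ a b u v : ℤ,
        RationalReconstruction.Inv C.scale (μ 3 n) C.threshold a b u v ∧ b ≤ C.threshold ∧
        ν 1 = Function.update (Function.update (μ 1) (2 * n + 1) v) (2 * n)
          ((2 * μ 3 n * v + C.scale) / (2 * C.scale)) := by
  obtain ⟨-, b1, b2, b3, b4, b5, b6, b7, b8, b9⟩ := C.bounds hd
  have hM0 : 0 < C.scale := by omega
  -- The first two remainders have product below the square of the scale, which allows at most `2 *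
  -- C.bits` divisions.
  have hpow : (C.scale : ℤ) * C.scale = 2 ^ (C.bits * 2) := by
    rw [LinearFIXPCircuit.scale, pow_mul]
    push_cast
    ring
  have idx : ∀ ν : Mem, ν 7 = μ 7 → (var 7 - const 1).val ν = n := by
    intro ν hν
    rw [val_sub, val_var, val_const, hν, h7]
    omega
  have hscale := hμ.scale
  have hthr := hμ.threshold
  generalize C.scale = M at *
  generalize C.threshold = S at *
  generalize ht : μ 3 n = t at *
  have s1 : Steps C.memBound (assign 17 (var 12)) μ (μ.set 17 0 M) 1 :=
    Steps.assign hscale (by rw [abs_le]; constructor <;> omega)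
  have s2 : Steps C.memBound (assign 18 (read 3 (var 7 - const 1))) (μ.set 17 0 M)
      ((μ.set 17 0 M).set 18 0 t) 1 :=
    Steps.assign (by rw [val_read (idx _ (Mem.set_of_ne _ _ _ (by norm_num))),
      Mem.set_of_ne _ _ _ (by norm_num), ht]) (by rw [abs_le]; constructor <;> omega)
  have s3 : Steps C.memBound (assign 19 (const 0)) ((μ.set 17 0 M).set 18 0 t)
      (((μ.set 17 0 M).set 18 0 t).set 19 0 0) 1 :=
    Steps.assign rfl (by simp)
  have s4 : Steps C.memBound (assign 20 (const 1)) (((μ.set 17 0 M).set 18 0 t).set 19 0 0)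
      ((((μ.set 17 0 M).set 18 0 t).set 19 0 0).set 20 0 1) 1 :=
    Steps.assign rfl (by rw [abs_one]; omega)
  set μ₄ := (((μ.set 17 0 M).set 18 0 t).set 19 0 0).set 20 0 1 with hμ₄
  have c17 : μ₄ 17 0 = M := by simp [μ₄, Mem.set]
  have c18 : μ₄ 18 0 = t := by simp [μ₄, Mem.set]
  have c19 : μ₄ 19 0 = 0 := by simp [μ₄, Mem.set]
  have c20 : μ₄ 20 0 = 1 := by simp [μ₄, Mem.set]
  have a4 : AgreeOff [1, 17, 18, 19, 20, 21, 22] μ μ₄ :=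
    ((((AgreeOff.refl _ _).set (by simp) _ _).set (by simp) _ _).set (by simp) _ _).set
      (by simp) _ _
  have c1 : μ₄ 1 = μ 1 := by
    funext j
    simp [μ₄, Mem.set]
  clear_value μ₄
  obtain ⟨ν₅, s5, a5, hI, hle⟩ := steps_euclidLoop (N := C.memBound) (μ := μ₄) (M := M) (n := t)
    (S := S) (by omega) (by omega) (by rw [a4 11 (by simp), hthr]) (C.bits * 2)
    (by rw [c17, c18, c19, c20]; exact RationalReconstruction.Inv.init h0 hlt (by omega))
    (by rw [c17, c18, ← hpow]; nlinarith)
  have a5' : AgreeOff [1, 17, 18, 19, 20, 21, 22] μ ν₅ := a4.extend a5 (by simp)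
  have e1 : ν₅ 1 = μ 1 := (a5 1 (by simp)).trans c1
  obtain ⟨k1, k2, k3, k4, k5⟩ := hI.bounds
  have hv := hI.v_pos
  generalize hv20 : ν₅ 20 0 = v at hI hv k5
  have i5 := idx ν₅ (a5' 7 (by simp))
  have s6 : Steps C.memBound (Prog.write 1 (const 2 * (var 7 - const 1) + const 1) (var 20)) ν₅
      (ν₅.set 1 (2 * n + 1) v) 1 := by
    refine Steps.write ?_ hv20 (by rw [abs_le]; constructor <;> omega)
    rw [val_add, val_mul, i5]
    simp
  have i6 := idx (ν₅.set 1 (2 * n + 1) v)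
    (by rw [Mem.set_of_ne _ _ _ (by norm_num), a5' 7 (by simp)])
  have hdiv0 : 0 ≤ (2 * t * v + M) / (2 * M) := by positivity
  -- Since `t < M`, the rounded numerator does not exceed the denominator `v`, hence fits into
  -- memory.
  have hdiv1 : (2 * t * v + M) / (2 * M) < v + 1 := by
    refine Int.ediv_lt_of_lt_mul (by omega) ?_
    nlinarith
  have s7 : Steps C.memBound (Prog.write 1 (const 2 * (var 7 - const 1))
      ((const 2 * read 3 (var 7 - const 1) * var 20 + var 12) / (const 2 * var 12)))
      (ν₅.set 1 (2 * n + 1) v) ((ν₅.set 1 (2 * n + 1) v).set 1 (2 * n)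
        ((2 * t * v + M) / (2 * M))) 1 := by
    refine Steps.write ?_ ?_ (by rw [abs_le]; constructor <;> omega)
    · rw [val_mul, i6]
      simp
    · rw [val_div, val_add, val_mul, val_mul, val_mul, val_read i6, val_var, val_var, val_const,
        Mem.set_of_ne _ _ _ (by norm_num), Mem.set_of_ne _ _ _ (by norm_num),
        Mem.set_of_ne _ _ _ (by norm_num), hv20, a5' 3 (by simp), a5' 12 (by simp), ht, hscale]
  refine ⟨_, (s1.cons (s2.cons (s3.cons (s4.cons (s5.cons (s6.cons (s7.cons
    Steps.nil))))))).mono (by omega), (a5'.set (by simp) _ _).set (by simp) _ _, _, _, _, v, hI,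
    hle, ?_⟩
  rw [Mem.set_self, Mem.set_self, e1]

theorem steps_outputProg (hd : 1 ≤ d) (hμ : HasParams C μ)
    (ht : ∀ i < d, 0 ≤ μ 3 i ∧ μ 3 i < C.scale) {x : Fin d → ℝ}
    (hx : ∀ (i : Fin d) (a b u v : ℤ),
      RationalReconstruction.Inv C.scale (μ 3 i) C.threshold a b u v → b ≤ C.threshold →
      x i * v = ((2 * μ 3 i * v + C.scale) / (2 * C.scale) : ℤ)) :
    ∃ ν, Steps C.memBound outputProg μ ν (d * (C.bits * 20 + 10) + 3) ∧
      ∀ i : Fin d, 0 < ν 1 (2 * i + 1) ∧ x i * ν 1 (2 * i + 1) = ν 1 (2 * i) := by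
  obtain ⟨-, b1, b2, b3, b4, b5, b6, b7, b8, b9⟩ := C.bounds hd
  have s1 : Steps C.memBound (assign 7 dimExpr) μ (μ.set 7 0 d) 1 :=
    Steps.assign hμ.input.dim (abs_natCast_le (by omega))
  have H := Steps.forLoop (N := C.memBound) (b := 7) (c := outputBody) (μ := μ.set 7 0 d)
    (fun n ν => n ≤ d ∧ AgreeOff [1, 7, 17, 18, 19, 20, 21, 22] μ ν ∧
      ∀ i : Fin d, n ≤ i → 0 < ν 1 (2 * i + 1) ∧ x i * ν 1 (2 * i + 1) = ν 1 (2 * i))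
    (k := C.bits * 20 + 8) ?_ d
    ⟨le_rfl, (AgreeOff.refl _ _).set (by simp) _ _, fun j h1 => by omega⟩ (by simp [Mem.set])
  · obtain ⟨ν, s, ⟨-, -, h⟩, -⟩ := H
    exact ⟨ν, (s1.cons (s.cons Steps.nil)).mono (le_of_eq (by ring)), fun i => h i (Nat.zero_le _)⟩
  · rintro n ν ⟨hn, ha, h⟩ h7
    have e3 : ν 3 = μ 3 := ha 3 (by simp)
    obtain ⟨ht0, ht1⟩ := ht n hn
    obtain ⟨ξ, s, a, a', b, u, v, hI, hb, hξ⟩ := steps_outputBody hd (hμ.of_agreeOff ha (by simp))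
      h7 (by rwa [e3]) (by rwa [e3])
    rw [e3] at hI hξ
    refine ⟨ξ, s, by rw [a 7 (by simp), h7], by omega,
      (ha.extend a (by simp)).set (by simp) _ _, fun i hi => ?_⟩
    rw [Mem.set_of_ne _ _ _ (by norm_num), hξ]
    rcases eq_or_ne (i : ℕ) n with rfl | hne
    · rw [Function.update_of_ne (by omega), Function.update_self, Function.update_self]
      exact ⟨hI.v_pos, hx i _ _ _ _ hI hb⟩
    · rw [Function.update_of_ne (by omega), Function.update_of_ne (by omega),
        Function.update_of_ne (by omega), Function.update_of_ne (by omega)]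
      exact h i (by omega)

end Output

end RAM

/-! ### Accuracy sufficient for exact reconstruction. -/

namespace LinearFIXPCircuit

variable {d : ℕ} {C : LinearFIXPCircuit d}

/-- Rational reconstruction recovers the fixpoint from a good approximation. -/
theorem IsContraction.mul_eq_of_inv {p : ℝ≥0∞} [Fact (1 ≤ p)] (h : C.IsContraction p)
    (hd : 1 ≤ d) {x : Fin d → ℝ} (hx : x ∈ Set.Icc (0 : Fin d → ℝ) 1) (hfx : C.eval x = x)
    {t : ℕ → ℤ} (ht : ‖Bisection.point C.scale t - x‖ ≤
      C.cond * ((4 * (C.cond : ℝ) ^ 3) ^ d / C.scale)) (i : Fin d) {a b u v : ℤ}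
    (hI : RationalReconstruction.Inv C.scale (t i) C.threshold a b u v) (hb : b ≤ C.threshold) :
    x i * v = ((2 * t i * v + C.scale) / (2 * C.scale) : ℤ) := by
  obtain ⟨-, b1, b2, b3, b4, b5, b6, b7, b8, b9⟩ := C.bounds hd
  obtain ⟨n, q, hq, hqb, hxq⟩ := h.exists_rat hx hfx i
  have hM : (0 : ℝ) < C.scale := by exact_mod_cast (show 0 < C.scale by omega)
  have hbase := one_le_base (C := C) hd
  have hqc : q ≤ C.cond := hqb.trans (Nat.pow_le_pow_right hbase (by omega))
  have hi : |(t i : ℝ) - x i * C.scale| ≤ C.cond * C.amp ^ d := by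
    have h1 := (norm_le_pi_norm (Bisection.point C.scale t - x) i).trans ht
    rw [Pi.sub_apply, Bisection.point, Real.norm_eq_abs, Int.cast_natCast] at h1
    have h2 : (t i : ℝ) - x i * C.scale = (t i / C.scale - x i) * C.scale := by
      field_simp
    rw [h2, abs_mul, abs_of_pos hM]
    calc _ ≤ C.cond * ((4 * (C.cond : ℝ) ^ 3) ^ d / C.scale) * C.scale := by gcongr
      _ = _ := by
        rw [amp]
        push_cast
        field_simp
  have hc : 1 ≤ C.cond := hbase.trans b5
  -- The approximation error in grid units is at most `cond * amp ^ d`, and the denominator `q` is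
  -- at most `cond`. One spare factor `amp` in the threshold absorbs `2 * cond ^ 2`.
  have h1 : 2 * (C.cond * C.cond) ≤ C.amp := by
    have h2 : C.cond ^ 2 ≤ C.cond ^ 3 := Nat.pow_le_pow_right hc (by norm_num)
    rw [pow_two] at h2
    have h3 : C.amp = 4 * C.cond ^ 3 := rfl
    omega
  have h2 : 2 * (C.cond * C.amp ^ d * C.cond) ≤ C.threshold :=
    calc 2 * (C.cond * C.amp ^ d * C.cond) = C.amp ^ d * (2 * (C.cond * C.cond)) := by ring
      _ ≤ C.amp ^ d * C.amp := Nat.mul_le_mul_left _ h1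
      _ = C.threshold := (pow_succ _ _).symm
  -- The further factor `amp` in the scale, at least `4 * q`, separates the threshold from the
  -- modulus.
  have h3 : 2 * (C.threshold * q) < C.scale := by
    have h5 := C.threshold_mul_amp_le
    have h6 : C.threshold * (4 * q) ≤ C.threshold * C.amp :=
      Nat.mul_le_mul_left _ ((Nat.mul_le_mul_left 4 hqc).trans b6)
    have h7 : 0 < C.threshold * q := Nat.mul_pos (by omega) hq
    rw [mul_left_comm] at h6
    omega
  have hqc' : (q : ℝ) ≤ C.cond := by exact_mod_cast hqc
  have h2' : 2 * ((C.cond : ℝ) * C.amp ^ d * C.cond) ≤ C.threshold := by exact_mod_cast h2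
  have h3' : 2 * ((C.threshold : ℤ) * q) < C.scale := by exact_mod_cast h3
  have hR : |(t i : ℝ) - x i * C.scale| * q ≤ C.cond * C.amp ^ d * C.cond :=
    mul_le_mul hi hqc' (by positivity) (by positivity)
  generalize C.scale = M at *
  generalize C.threshold = S at *
  exact hI.mul_eq (p := n) (q := q) hb (by exact_mod_cast hq) (by exact_mod_cast hxq)
    (by exact_mod_cast hR) (by exact_mod_cast h2') h3'

end LinearFIXPCircuit

/-! ### Estimates in terms of the size of the circuit. -/

namespace LinGate

/-- The numerator enters squared and so counts twice; the additive `2` of the growth factor is paid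
by the extra bit per gate. -/
theorem den_mul_growth_le (g : LinGate) : g.den * g.growth ≤ 2 ^ (2 * g.constBits + 1) := by
  have hg : g.growth ≤ 2 ^ (2 * g.num.natAbs.size + 1) := by
    have h1 := Nat.lt_size_self g.num.natAbs
    have h2 : g.num.natAbs * g.num.natAbs ≤
        (2 ^ g.num.natAbs.size - 1) * (2 ^ g.num.natAbs.size - 1) :=
      Nat.mul_le_mul (by omega) (by omega)
    obtain ⟨m, hm⟩ : ∃ m, 2 ^ g.num.natAbs.size = m + 1 := ⟨2 ^ g.num.natAbs.size - 1, by
      have := Nat.one_le_two_pow (n := g.num.natAbs.size)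
      omega⟩
    rw [pow_succ, mul_comm 2, pow_mul, growth, hm, pow_two]
    rw [hm, Nat.add_sub_cancel] at h2
    nlinarith
  have hb : g.den * 2 ^ (2 * g.num.natAbs.size + 1) ≤ 2 ^ (2 * g.constBits + 1) := by
    have key : ∀ q : ℚ, q.den * 2 ^ (2 * q.num.natAbs.size + 1) ≤ 2 ^ (2 * ratBits q + 1) := by
      intro q
      calc q.den * 2 ^ (2 * q.num.natAbs.size + 1)
          ≤ 2 ^ q.den.size * 2 ^ (2 * q.num.natAbs.size + 1) :=
            Nat.mul_le_mul_right _ (Nat.lt_size_self _).le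
        _ ≤ 2 ^ (2 * ratBits q + 1) := by
            rw [← pow_add]
            refine Nat.pow_le_pow_right (by norm_num) ?_
            rw [ratBits]
            omega
    cases g <;> simp [den, num, constBits, key]
  exact (Nat.mul_le_mul_left _ hg).trans hb

end LinGate

namespace LinearFIXPCircuit

variable {d : ℕ} {C : LinearFIXPCircuit d}

theorem denProd_mul_growthProd_le : C.denProd * C.growthProd ≤ 2 ^ (2 * C.size) := by
  have key : ∀ l : List LinGate, (l.map LinGate.den).prod * (l.map LinGate.growth).prod ≤
      2 ^ (2 * (l.map LinGate.constBits).sum + l.length) := by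
    intro l
    induction l with
    | nil => simp
    | cons g l ih =>
      simp only [List.map_cons, List.prod_cons, List.sum_cons, List.length_cons]
      calc _ = (g.den * g.growth) * ((l.map LinGate.den).prod * (l.map LinGate.growth).prod) := by
            ring
        _ ≤ 2 ^ (2 * g.constBits + 1) * 2 ^ (2 * (l.map LinGate.constBits).sum + l.length) :=
            Nat.mul_le_mul g.den_mul_growth_le ih
        _ = _ := by
            rw [← pow_add]
            congr 1
            ring
  rw [denProd, growthProd, denUpTo, growthUpTo, List.take_length]
  refine (key _).trans (Nat.pow_le_pow_right (by norm_num) ?_)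
  rw [size]
  omega

theorem one_le_size (hd : 1 ≤ d) : 1 ≤ C.size := by
  rw [size]
  omega

theorem base_le_two_pow (hd : 1 ≤ d) : C.base ≤ 2 ^ (4 * C.size) := by
  have h1 : d ≤ 2 ^ C.size :=
    (show d ≤ C.size by rw [size]; omega).trans Nat.lt_two_pow_self.le
  have h2 := one_le_size (C := C) hd
  calc C.base ≤ 2 * 2 ^ C.size * 2 ^ (2 * C.size) :=
        Nat.mul_le_mul (Nat.mul_le_mul_left _ h1) denProd_mul_growthProd_le
    _ = 2 ^ (1 + C.size + 2 * C.size) := by rw [pow_add, pow_add, pow_one]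
    _ ≤ _ := Nat.pow_le_pow_right (by norm_num) (by omega)

theorem cond_le_two_pow (hd : 1 ≤ d) : C.cond ≤ 2 ^ (8 * C.size ^ 2) := by
  calc C.cond ≤ (2 ^ (4 * C.size)) ^ (d + 1) := Nat.pow_le_pow_left (base_le_two_pow hd) _
    _ = 2 ^ (4 * C.size * (d + 1)) := (pow_mul _ _ _).symm
    _ ≤ 2 ^ (4 * C.size * (2 * C.size)) := by
        refine Nat.pow_le_pow_right (by norm_num) (Nat.mul_le_mul_left _ ?_)
        rw [size]
        omega
    _ = _ := by
        congr 1
        ring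

/-- The amplification has `2 + 3 * 8 = 26` times `size ^ 2` bits at most, and it is raised to the
power `d + 2 ≤ 3 * size`. -/
theorem bits_le (hd : 1 ≤ d) : C.bits ≤ 78 * C.size ^ 3 := by
  have hs := one_le_size (C := C) hd
  have hds : d + 2 ≤ 3 * C.size := by
    rw [size] at hs ⊢
    omega
  have h1 : C.amp ≤ 2 ^ (26 * C.size ^ 2) := by
    calc C.amp ≤ 4 * (2 ^ (8 * C.size ^ 2)) ^ 3 :=
          Nat.mul_le_mul_left _ (Nat.pow_le_pow_left (cond_le_two_pow hd) _)
      _ = 2 ^ (2 + 8 * C.size ^ 2 * 3) := by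
          rw [pow_add, ← pow_mul]
          norm_num
      _ ≤ _ := by
          refine Nat.pow_le_pow_right (by norm_num) ?_
          have : 1 ≤ C.size ^ 2 := Nat.one_le_pow _ _ hs
          omega
  refine Nat.clog_le_of_le_pow ?_
  calc C.threshold * C.amp = C.amp ^ (d + 2) := (pow_succ _ _).symm
    _ ≤ (2 ^ (26 * C.size ^ 2)) ^ (d + 2) := Nat.pow_le_pow_left h1 _
    _ = 2 ^ (26 * C.size ^ 2 * (d + 2)) := (pow_mul _ _ _).symm
    _ ≤ 2 ^ (26 * C.size ^ 2 * (3 * C.size)) :=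
        Nat.pow_le_pow_right (by norm_num) (Nat.mul_le_mul_left _ hds)
    _ = _ := by
        congr 1
        ring

theorem lenBound_memBound_le (hd : 1 ≤ d) :
    RAM.lenBound C.memBound ≤ 3 * C.size * (C.bits + 1) := by
  have hs := one_le_size (C := C) hd
  have hds : d + 2 ≤ 3 * C.size := by
    rw [size] at hs ⊢
    omega
  have h1 : C.memBound.size = C.bits * (d + 2) + 1 := by
    rw [memBound, scale, ← pow_mul, Nat.size_pow]
  have h2 : C.bits * (d + 2) ≤ C.bits * (3 * C.size) := Nat.mul_le_mul_left _ hds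
  have h3 : 3 * C.size * (C.bits + 1) = C.bits * (3 * C.size) + 3 * C.size := by ring
  rw [RAM.lenBound, h1, h3]
  omega

/-- Polynomial bound for the bit lengths and the running time. -/
noncomputable def bitPoly : Polynomial ℕ := Polynomial.C 6241 * Polynomial.X ^ 8

theorem eval_bitPoly (s : ℕ) : bitPoly.eval s = 6241 * s ^ 8 := by simp [bitPoly]

/-- The coefficient of the polynomial is `79 ^ 2`, with `79 * size ^ 3` bounding `C.bits + 1`. One
factor of size times bits stands for the steps, one for the length of the numbers. -/
theorem size_mul_bits_le (hd : 1 ≤ d) :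
    C.size ^ 2 * (C.bits + 1) ^ 2 ≤ bitPoly.eval C.size := by
  have h1 : C.bits + 1 ≤ 79 * C.size ^ 3 := by
    have := bits_le (C := C) hd
    have : 1 ≤ C.size ^ 3 := Nat.one_le_pow _ _ (one_le_size hd)
    omega
  calc C.size ^ 2 * (C.bits + 1) ^ 2 ≤ C.size ^ 2 * (79 * C.size ^ 3) ^ 2 :=
        Nat.mul_le_mul_left _ (Nat.pow_le_pow_left h1 _)
    _ = bitPoly.eval C.size := by
        rw [eval_bitPoly]
        ring

theorem ratBits_le {x : ℚ} {N e : ℕ} (h0 : 0 ≤ x) (h1 : x ≤ 1) (hden : x.den ≤ N) (hN : N ≤ 2 ^ e) :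
    ratBits x ≤ 2 * e + 2 := by
  have hnum : x.num.natAbs ≤ x.den := by
    have h2 : (0 : ℤ) ≤ x.num := Rat.num_nonneg.2 h0
    have h3 : x.num ≤ x.den := by
      have h4 : (x.num : ℚ) ≤ x.den := by
        rw [← Rat.mul_den_eq_num]
        exact mul_le_of_le_one_left (by positivity) h1
      exact_mod_cast h4
    omega
  have h5 : 2 ^ e < 2 ^ (e + 1) := Nat.pow_lt_pow_right (by norm_num) (by omega)
  have h6 : x.num.natAbs.size ≤ e + 1 := Nat.size_le.2 (by omega)
  have h7 : x.den.size ≤ e + 1 := Nat.size_le.2 (by omega)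
  rw [ratBits]
  omega

/-- The fixpoint of a contraction is a rational vector of polynomial bit length. -/
theorem IsContraction.exists_rat_isFixed {p : ℝ≥0∞} [Fact (1 ≤ p)] (h : C.IsContraction p)
    (hd : 1 ≤ d) : ∃ x : Fin d → ℚ, (fun i => (x i : ℝ)) ∈ Set.Icc (0 : Fin d → ℝ) 1 ∧
      C.eval (fun i => (x i : ℝ)) = (fun i => (x i : ℝ)) ∧
      ∀ i, ratBits (x i) ≤ bitPoly.eval C.size := by
  obtain ⟨y, hy, hfy⟩ := h.exists_isFixed
  choose a q hq hqb hxq using fun i => h.exists_rat hy hfy i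
  have hx : (fun i => (((a i : ℚ) / (q i : ℚ) : ℚ) : ℝ)) = y := by
    funext i
    have : (q i : ℝ) ≠ 0 := by exact_mod_cast (hq i).ne'
    push_cast
    rw [← hxq i]
    field_simp
  refine ⟨fun i => (a i : ℚ) / (q i : ℚ), by rwa [hx], by rwa [hx], fun i => ?_⟩
  have hi : (((a i : ℚ) / (q i : ℚ) : ℚ) : ℝ) = y i := congrFun hx i
  have h0 : (0 : ℚ) ≤ (a i : ℚ) / (q i : ℚ) := by
    have h2 : (0 : ℝ) ≤ y i := hy.1 i
    rwa [← hi, Rat.cast_nonneg] at h2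
  have h1 : (a i : ℚ) / (q i : ℚ) ≤ 1 := by
    have h2 : y i ≤ (1 : ℝ) := hy.2 i
    rw [← hi] at h2
    exact_mod_cast h2
  have hden : ((a i : ℚ) / (q i : ℚ)).den ≤ C.cond := by
    have h2 := Rat.den_dvd (a i) (q i)
    have h3 := Nat.le_of_dvd (hq i) (Int.natCast_dvd_natCast.1 h2)
    exact_mod_cast h3.trans ((hqb i).trans (Nat.pow_le_pow_right (one_le_base hd) (by omega)))
  refine (ratBits_le h0 h1 hden (cond_le_two_pow hd)).trans ?_
  rw [eval_bitPoly]
  have h2 : C.size ^ 2 ≤ C.size ^ 8 := Nat.pow_le_pow_right (one_le_size hd) (by norm_num)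
  have h3 : 1 ≤ C.size ^ 8 := Nat.one_le_pow _ _ (one_le_size hd)
  omega

end LinearFIXPCircuit

/-! ### The complete program and its running time. -/

namespace RAM

open RAM.Expr RAM.Prog

variable {d : ℕ} {C : LinearFIXPCircuit d}

theorem steps_fixpointProg {p : ℝ≥0∞} [Fact (1 ≤ p)] (h : C.IsContraction p) (hd : 1 ≤ d)
    {x : Fin d → ℝ} (hx : x ∈ Set.Icc (0 : Fin d → ℝ) 1) (hfx : C.eval x = x) {μ : Mem}
    (hμ : HasInput C μ) :
    ∃ ν, Steps C.memBound fixpointProg μ ν (185 * C.size * (C.bits + 1) ^ d) ∧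
      ∀ i : Fin d, 0 < ν 1 (2 * i + 1) ∧ x i * ν 1 (2 * i + 1) = ν 1 (2 * i) := by
  have hbits := one_le_bits (C := C) hd
  obtain ⟨ν₁, s1, p1, h15⟩ := steps_paramProg hd hμ
  obtain ⟨ν₂, s2, a2, h2⟩ := steps_initProg hd p1
  have p2 : HasParams C ν₂ := p1.of_agreeOff a2 (by simp)
  have hscale : (C.scale : ℤ) = 2 ^ (C.bits - 1 + 1) := by
    rw [LinearFIXPCircuit.scale, Nat.sub_add_cancel hbits]
    simp
  have hH : (0 : ℤ) < 2 ^ (C.bits - 1) := by positivity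
  have hHH : (2 : ℤ) ^ (C.bits - 1) + 2 ^ (C.bits - 1) ≤ C.scale := by
    rw [hscale, pow_succ, mul_two]
  have hr : ∀ i < d, Bisection.InRange C.scale (ν₂ 3 i) (ν₂ 4 i) := by
    intro i hi
    obtain ⟨e3, e4⟩ := h2 i hi
    rw [e3, e4]
    push_cast
    exact ⟨hH.le, le_rfl, hHH, by omega⟩
  obtain ⟨ν₃, s3, a3, h3⟩ := steps_tickLoop hd p2 hr (n := (C.bits + 1) ^ d - 1)
    (by rw [a2 15 (by simp), h15])
  have p3 : HasParams C ν₃ := p2.of_agreeOff a3 (by simp)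
  have hr3 := Bisection.iterate_tick_inRange C.eval hH hHH (s := (ν₂ 3, ν₂ 4)) hr
    ((C.bits + 1) ^ d - 1)
  rw [← h3] at hr3
  -- With `n = C.bits - 1` the grid denominator `2 ^ (n + 1)` is the scale and the number of ticks
  -- is `(C.bits + 1) ^ d - 1`; truncation is harmless since `C.bits` is positive.
  have happ := Bisection.norm_sub_le (h.isConditioned hd) (C.bits - 1) hx hfx (s := (ν₂ 3, ν₂ 4))
    (fun i hi => by simpa using h2 i hi)
  rw [← hscale, show C.bits - 1 + 2 = C.bits + 1 by omega, ← h3,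
    show (2 : ℝ) ^ (C.bits - 1 + 1) = C.scale by exact_mod_cast hscale.symm] at happ
  obtain ⟨ν₄, s4, h4⟩ := steps_outputProg hd p3
    (fun i hi => by obtain ⟨c1, c2, c3, c4⟩ := hr3 i hi; exact ⟨c1.trans c2, c4⟩) (x := x)
    (fun i a b u v hI hb => h.mul_eq_of_inv hd hx hfx happ i hI hb)
  refine ⟨ν₄, (s1.cons (s2.cons (s3.cons (s4.cons Steps.nil)))).mono ?_, h4⟩
  have hs : C.size = d + C.gates.length + (C.gates.map LinGate.constBits).sum := rfl
  have hB : C.bits + 1 ≤ (C.bits + 1) ^ d := Nat.le_self_pow (by omega) _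
  obtain ⟨B, hB'⟩ : ∃ B, (C.bits + 1) ^ d = B + 1 := ⟨(C.bits + 1) ^ d - 1, by omega⟩
  rw [hB', Nat.add_sub_cancel]
  rw [hB'] at hB
  have k1 : B * (d * 13 + C.gates.length * 22 + 12) ≤ B * (47 * C.size) :=
    Nat.mul_le_mul_left _ (by omega)
  have k2 : d * (C.bits * 20 + 10) ≤ C.size * (B * 20 + 10) :=
    Nat.mul_le_mul (by omega) (by omega)
  have k3 : B ≤ C.size * B := Nat.le_mul_of_pos_left _ (by omega)
  have k4 : 185 * C.size * (B + 1) = 185 * (C.size * B) + 185 * C.size := by ring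
  have k5 : B * (47 * C.size) = 47 * (C.size * B) := by ring
  have k6 : C.size * (B * 20 + 10) = 20 * (C.size * B) + 10 * C.size := by ring
  omega

theorem computesWithin_fixpointProg {p : ℝ≥0∞} [Fact (1 ≤ p)] (h : C.IsContraction p)
    (hd : 1 ≤ d) {x : Fin d → ℚ} (hx : (fun i => (x i : ℝ)) ∈ Set.Icc (0 : Fin d → ℝ) 1)
    (hfx : C.eval (fun i => (x i : ℝ)) = (fun i => (x i : ℝ))) :
    ComputesWithin fixpointProg C.code x
      (555 * fixpointProg.weight * (LinearFIXPCircuit.bitPoly.eval C.size) ^ d) := by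
  obtain ⟨ν, s, hν⟩ := steps_fixpointProg h hd hx hfx (μ := input C.code) fun i => rfl
  have hbdd : Bdd C.memBound (input C.code) := by
    intro b i
    rw [input]
    split_ifs
    · exact LinearFIXPCircuit.abs_code_getD_le hd i
    · simp
  obtain ⟨t, hexec, ht⟩ := (s hbdd).1
  refine ⟨ν, t, hexec, ht.trans ?_, fun i => ?_⟩
  · have hs := LinearFIXPCircuit.one_le_size (C := C) hd
    -- The cost is a multiple of `size ^ 2 * (bits + 1) ^ (d + 1)`. For `d ≥ 1` both exponents are
    -- at most `2 * d`, which makes the bound a pure `d`-th power.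
    have h1 : C.size ^ 2 ≤ C.size ^ (2 * d) := Nat.pow_le_pow_right hs (by omega)
    have h2 : (C.bits + 1) ^ (d + 1) ≤ (C.bits + 1) ^ (2 * d) :=
      Nat.pow_le_pow_right (by omega) (by omega)
    calc 185 * C.size * (C.bits + 1) ^ d * (fixpointProg.weight * lenBound C.memBound)
        ≤ 185 * C.size * (C.bits + 1) ^ d *
            (fixpointProg.weight * (3 * C.size * (C.bits + 1))) := by
          gcongr
          exact LinearFIXPCircuit.lenBound_memBound_le hd
      _ = 555 * fixpointProg.weight * (C.size ^ 2 * (C.bits + 1) ^ (d + 1)) := by ring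
      _ ≤ 555 * fixpointProg.weight * (C.size ^ (2 * d) * (C.bits + 1) ^ (2 * d)) := by gcongr
      _ = 555 * fixpointProg.weight * (C.size ^ 2 * (C.bits + 1) ^ 2) ^ d := by
          rw [mul_pow, ← pow_mul, ← pow_mul]
      _ ≤ _ := by
          gcongr
          exact LinearFIXPCircuit.size_mul_bits_le hd
  · obtain ⟨hpos, hmul⟩ := hν i
    refine ⟨hpos, ?_⟩
    have hne : (ν 1 (2 * i + 1) : ℚ) ≠ 0 := by exact_mod_cast hpos.ne'
    rw [eq_div_iff hne]
    exact_mod_cast hmul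

end RAM

theorem mainTheorem5 :
    ∃ (prog : RAM.Prog) (P : Polynomial ℕ) (K : ℕ),
      ∀ (d : ℕ) (_hd : 1 ≤ d) (C : LinearFIXPCircuit d) (p : ℝ≥0∞) [Fact (1 ≤ p)],
        C.IsContraction p →
        ∃ x : Fin d → ℚ,
          (fun i => (x i : ℝ)) ∈ Set.Icc (0 : Fin d → ℝ) 1 ∧
          C.eval (fun i => (x i : ℝ)) = (fun i => (x i : ℝ)) ∧
          (∀ y ∈ Set.Icc (0 : Fin d → ℝ) 1, C.eval y = y → y = fun i => (x i : ℝ)) ∧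
          (∀ i, ratBits (x i) ≤ P.eval C.size) ∧
          RAM.ComputesWithin prog C.code x (K * (P.eval C.size) ^ d) := by
  refine ⟨RAM.fixpointProg, LinearFIXPCircuit.bitPoly, 555 * RAM.fixpointProg.weight, ?_⟩
  intro d hd C p _ h
  obtain ⟨x, hx, hfx, hbits⟩ := h.exists_rat_isFixed hd
  exact ⟨x, hx, hfx, fun y hy hfy => h.eq_of_isFixed hy hx hfy hfx, hbits,
    RAM.computesWithin_fixpointProg h hd hx hfx⟩
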